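/- **Double-ended eertrees.** Let $\Sigma$ be an alphabet of size $\sigma\ge 1$, identified with $\{0,\dots,\sigma-1\}$. The *eertree* of a string $s$ over $\Sigma$ has as nodes a root $\mathsf{odd}$ (representing an empty string of length $-1$) and one node for every distinct palindromic substring of $s$, where the node of the empty string is the root $\mathsf{even}$. Its edges are $\mathrm{next}(v,c)=\text{the node of } c\,\mathrm{str}(v)\,c$ if that string occurs in $s$, and $\mathrm{null}$ otherwise (with $c\,\mathrm{str}(\mathsf{odd})\,c=c$). The suffix link $\mathrm{link}(v)$ is the node of the longest proper palindromic suffix of $\mathrm{str}(v)$, and $\mathrm{link}(\mathsf{even})=\mathrm{link}(\mathsf{odd})=\mathsf{odd}$. A *surface* of $s$ is an occurrence $s[i..j]$ of a non-empty palindrome such that no $s[i..r]$ with $j<r\le|s|$ and no $s[l..j]$ with $1\le l<i$ is a palindrome. Let $\mathit{presurf}(s,i)$ and $\mathit{sufsurf}(s,i)$ be the surface of $s$ with start position $i$ and with end position $i$, respectively (the empty string if there is none). For a non-empty palindromic substring $t$ of $s$ let $\mathit{cnt}(s,t)$ be the number of $i$ such that $t$ is the longest palindromic prefix of $s[i..|s|]$.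 Work in the word RAM with $w$-bit words, instructions restricted to constants, moves, loads, stores, comparisons, addition and subtraction modulo $2^w$, and unit cost per instruction. The space used is the length of the initial segment of the memory that contains all cells accessed so far, and the space of an operation is the increase of this number. Then there are fixed programs and a constant $C$, independent of $\sigma$, $w$ and $N$, such that for all $\sigma\ge1$, $N$ and $w$ with $2^w\ge C\,(\sigma+(N+1)(1+\lfloor\log_2\sigma\rfloor))$ the following holds. 1. Creating the data structure for the empty string takes time and space at most $C(1+\lfloor\log_2\sigma\rfloor)$. 2. In every sequence of at most $N$ operations $\mathtt{push\_back}(c)$ ($s\gets sc$), $\mathtt{push\_front}(c)$ ($s\gets cs$), $\mathtt{pop\_back}$ and $\mathtt{pop\_front}$ (removal of the last, respectively first, character of $s$, allowed only for non-empty $s$), started from the empty string, each push takes worst-case time and space at most $C(1+\lfloor\log_2\sigma\rfloor)$ and each pop takes worst-case time and space at most $C$. 3. After each of these operations (and after the creation) the memory holds the eertree of the current string $s$: the nodes are named by distinct non-null words, and read-only queries return $\mathsf{even}$, $\mathsf{odd}$, $\mathrm{link}(v)$ and the length of $\mathrm{str}(v)$ (modulo $2^w$) in time at most $C$, and $\mathrm{next}(v,c)$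 in time at most $C(1+\lfloor\log_2\sigma\rfloor)$. Moreover, the following are returned by read-only queries in time at most $C$: the number of distinct palindromic substrings of $s$ (including the empty one); the nodes of the longest palindromic prefix and of the longest palindromic suffix of $s$; for $s$ non-empty, whether each of these occurs only once in $s$; the nodes of $\mathit{presurf}(s,i)$ and $\mathit{sufsurf}(s,i)$ for $1\le i\le|s|$; and $\mathit{cnt}(s,t)$ for the node of every non-empty palindromic substring $t$ of $s$, which also equals the number of $i$ such that $t$ is the longest palindromic suffix of $s[1..i]$. -/

import Mathlib

/-! ## The word RAM

Memory is an array of `w`-bit words, addressed by `w`-bit words; a program also has finitely many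
registers (those it mentions), which hold `w`-bit words.  The instructions are those of the RAM
with the arithmetic restricted to addition and subtraction modulo `2 ^ w`; control flow is given
by conditionals and loops.  Every executed instruction and every evaluated test costs one step. -/

namespace WordRAM

/-- A test compares two registers (as unsigned integers). -/
inductive Test where
  | lt (a b : ℕ)
  | eq (a b : ℕ)

/-- Programs; `d`, `a`, `b` are register numbers. -/
inductive Prog where
  /-- no operation -/
  | skip
  /-- `R[d] ← k` -/
  | const (d k : ℕ)
  /-- `R[d] ← R[a]` -/
  | move (d a : ℕ)
  /-- `R[d] ← R[a] + R[b]` modulo `2 ^ w` -/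
  | add (d a b : ℕ)
  /-- `R[d] ← R[a] - R[b]` modulo `2 ^ w` -/
  | sub (d a b : ℕ)
  /-- `R[d] ← A[R[a]]` -/
  | load (d a : ℕ)
  /-- `A[R[a]] ← R[b]` -/
  | store (a b : ℕ)
  /-- sequential composition -/
  | seq (P Q : Prog)
  /-- `if T then P else Q` -/
  | ite (T : Test) (P Q : Prog)
  /-- `while T do P` -/
  | loop (T : Test) (P : Prog)

/-- The memory: its contents, and the space used so far, that is, the least `u` such that all
cells accessed so far have addresses below `u`. -/
structure Memory where
  cell : ℕ → ℕ
  used : ℕ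

/-- The initial memory: all words are zero and nothing has been accessed. -/
def Memory.empty : Memory := ⟨fun _ => 0, 0⟩

/-- A configuration: the registers and the memory. -/
structure Config where
  reg : ℕ → ℕ
  mem : Memory

/-- Truth value of a test. -/
def Test.Holds : Test → (ℕ → ℕ) → Prop
  | .lt a b, R => R a < R b
  | .eq a b, R => R a = R b

/-- Reading or writing the cell with address `a` makes it a used cell. -/
def Memory.touch (m : Memory) (a : ℕ) : Memory := ⟨m.cell, max m.used (a + 1)⟩

/-- Write `x` into the cell with address `a`. -/
def Memory.write (m : Memory) (a x : ℕ) : Memory :=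
  ⟨Function.update m.cell a x, max m.used (a + 1)⟩

/-- Write `x` into register `d`. -/
def Config.setReg (κ : Config) (d x : ℕ) : Config := ⟨Function.update κ.reg d x, κ.mem⟩

/-- `Exec w P κ t κ'`: with word size `w`, the program `P` started in the configuration `κ`
halts after exactly `t` steps in the configuration `κ'`. -/
inductive Exec (w : ℕ) : Prog → Config → ℕ → Config → Prop
  | skip (κ : Config) : Exec w .skip κ 1 κ
  | const (d k : ℕ) (κ : Config) : Exec w (.const d k) κ 1 (κ.setReg d (k % 2 ^ w))
  | move (d a : ℕ) (κ : Config) : Exec w (.move d a) κ 1 (κ.setReg d (κ.reg a))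
  | add (d a b : ℕ) (κ : Config) :
      Exec w (.add d a b) κ 1 (κ.setReg d ((κ.reg a + κ.reg b) % 2 ^ w))
  | sub (d a b : ℕ) (κ : Config) :
      Exec w (.sub d a b) κ 1 (κ.setReg d ((κ.reg a + (2 ^ w - κ.reg b)) % 2 ^ w))
  | load (d a : ℕ) (κ : Config) :
      Exec w (.load d a) κ 1
        ⟨Function.update κ.reg d (κ.mem.cell (κ.reg a)), κ.mem.touch (κ.reg a)⟩
  | store (a b : ℕ) (κ : Config) :
      Exec w (.store a b) κ 1 ⟨κ.reg, κ.mem.write (κ.reg a) (κ.reg b)⟩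
  | seq {P Q : Prog} {κ κ' κ'' : Config} {t t' : ℕ} :
      Exec w P κ t κ' → Exec w Q κ' t' κ'' → Exec w (.seq P Q) κ (t + t') κ''
  | ite_true {T : Test} {P Q : Prog} {κ κ' : Config} {t : ℕ} :
      T.Holds κ.reg → Exec w P κ t κ' → Exec w (.ite T P Q) κ (t + 1) κ'
  | ite_false {T : Test} {P Q : Prog} {κ κ' : Config} {t : ℕ} :
      ¬ T.Holds κ.reg → Exec w Q κ t κ' → Exec w (.ite T P Q) κ (t + 1) κ'
  | loop_true {T : Test} {P : Prog} {κ κ' κ'' : Config} {t t' : ℕ} :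
      T.Holds κ.reg → Exec w P κ t κ' → Exec w (.loop T P) κ' t' κ'' →
        Exec w (.loop T P) κ (t + t' + 1) κ''
  | loop_false {T : Test} {P : Prog} {κ : Config} :
      ¬ T.Holds κ.reg → Exec w (.loop T P) κ 1 κ

/-- `Runs w P args m t res m'`: the program `P`, called on the memory `m` with the arguments
`args` in registers `0, 1, …` and zero in all other registers, halts after `t` steps with the
result `res` in register `0` and the memory `m'`.  Registers do not survive a call. -/
def Runs (w : ℕ) (P : Prog) (args : List ℕ) (m : Memory) (t res : ℕ) (m' : Memory) : Prop :=
  ∃ R : ℕ → ℕ, Exec w P ⟨fun r => args.getD r 0, m⟩ t ⟨R, m'⟩ ∧ R 0 = res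

/-- `Answers w P args m T res`: called on the memory `m` with the arguments `args`, the program
`P` returns `res` within `T` steps; it neither changes the memory nor uses a fresh cell. -/
def Answers (w : ℕ) (P : Prog) (args : List ℕ) (m : Memory) (T res : ℕ) : Prop :=
  ∃ t ≤ T, Runs w P args m t res m

end WordRAM

/-! ## Palindromes, surfaces and eertrees

Strings over an alphabet of size `σ` are lists over `Fin σ`; positions in strings start at `1`. -/

namespace Eertree

variable {σ : ℕ}

/-- The substring `s[i..j]` if `1 ≤ i ≤ j ≤ |s|`, and the empty string otherwise. -/
def sub (s : List (Fin σ)) (i j : ℕ) : List (Fin σ) :=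
  if 1 ≤ i ∧ i ≤ j ∧ j ≤ s.length then (s.take j).drop (i - 1) else []

/-- The length of the longest non-empty palindrome starting at position `i` of `s`. -/
def prelen (s : List (Fin σ)) (i : ℕ) : ℕ :=
  ((Finset.Icc 1 (s.length + 1 - i)).filter
    fun l => (sub s i (i + l - 1)).Palindrome).sup id

/-- The length of the longest non-empty palindrome ending at position `i` of `s`. -/
def suflen (s : List (Fin σ)) (i : ℕ) : ℕ :=
  ((Finset.Icc 1 i).filter fun l => (sub s (i + 1 - l) i).Palindrome).sup id

/-- The longest palindromic prefix of `s[i..|s|]`. -/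
def prepal (s : List (Fin σ)) (i : ℕ) : List (Fin σ) := sub s i (i + prelen s i - 1)

/-- The longest palindromic suffix of `s[1..i]`. -/
def sufpal (s : List (Fin σ)) (i : ℕ) : List (Fin σ) := sub s (i + 1 - suflen s i) i

/-- The occurrence `s[i..j]` is a surface in `s`: it is a non-empty palindrome and neither a
proper prefix nor a proper suffix of a longer palindromic substring at that place. -/
def IsSurface (s : List (Fin σ)) (i j : ℕ) : Prop :=
  (1 ≤ i ∧ i ≤ j ∧ j ≤ s.length) ∧ (sub s i j).Palindrome ∧
    (∀ r ∈ Finset.Icc (j + 1) s.length, ¬ (sub s i r).Palindrome) ∧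
    (∀ l ∈ Finset.Icc 1 (i - 1), ¬ (sub s l j).Palindrome)

instance (s : List (Fin σ)) (i j : ℕ) : Decidable (IsSurface s i j) := by
  unfold IsSurface; infer_instance

/-- The surface of `s` with start position `i`, or the empty string if there is none. -/
def presurf (s : List (Fin σ)) (i : ℕ) : List (Fin σ) :=
  if IsSurface s i (i + prelen s i - 1) then prepal s i else []

/-- The surface of `s` with end position `i`, or the empty string if there is none. -/
def sufsurf (s : List (Fin σ)) (i : ℕ) : List (Fin σ) :=
  if IsSurface s (i + 1 - suflen s i) i then sufpal s i else []

/-- The number of positions `i` such that `t` is the longest palindromic prefix of `s[i..|s|]`. -/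
def precnt (s t : List (Fin σ)) : ℕ :=
  ((Finset.Icc 1 s.length).filter fun i => prepal s i = t).card

/-- The number of positions `i` such that `t` is the longest palindromic suffix of `s[1..i]`. -/
def sufcnt (s t : List (Fin σ)) : ℕ :=
  ((Finset.Icc 1 s.length).filter fun i => sufpal s i = t).card

/-- The start positions of the occurrences of the non-empty string `t` in `s`. -/
def occur (s t : List (Fin σ)) : Finset ℕ :=
  (Finset.Icc 1 (s.length + 1 - t.length)).filter fun i => sub s i (i + t.length - 1) = t

/-- The non-empty string `t` occurs exactly once in `s`. -/
def IsUnique (s t : List (Fin σ)) : Prop := (occur s t).card = 1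

instance (s t : List (Fin σ)) : Decidable (IsUnique s t) := by
  unfold IsUnique; infer_instance

/-- The set of all distinct palindromic substrings of `s`, the empty string included. -/
def palSubstrings (s : List (Fin σ)) : Set (List (Fin σ)) := {t | t.Palindrome ∧ t <:+: s}

/-- A node of an eertree: the root `odd`, which represents the empty string of length `-1`, or
the node of a palindrome. -/
inductive Node (σ : ℕ) where
  | odd
  | pal (t : List (Fin σ))

/-- The root `even`, which represents the empty string. -/
def Node.even : Node σ := .pal []

/-- The length of the string of a node. -/
def Node.len : Node σ → ℤ
  | .odd => -1
  | .pal t => t.length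

/-- The node set of the (minimal) eertree of `s`. -/
def nodes (s : List (Fin σ)) : Set (Node σ) := {v | v = .odd ∨ ∃ t ∈ palSubstrings s, v = .pal t}

/-- The string `c str(v) c`. -/
def Node.wrap (c : Fin σ) : Node σ → List (Fin σ)
  | .odd => [c]
  | .pal t => c :: (t ++ [c])

/-- The edge labelled `c` that leaves the node `v` in the eertree of `s`, if there is one. -/
def next (s : List (Fin σ)) (v : Node σ) (c : Fin σ) : Option (Node σ) :=
  if v.wrap c <:+: s then some (.pal (v.wrap c)) else none

/-- The length of the longest proper palindromic suffix of a non-empty string. -/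
def linkLen (t : List (Fin σ)) : ℕ :=
  ((Finset.range t.length).filter fun l => (t.drop (t.length - l)).Palindrome).sup id

/-- The suffix link: the node of the longest proper palindromic suffix; both roots link
to `odd`. -/
def link : Node σ → Node σ
  | .odd => .odd
  | .pal t => if t = [] then .odd else .pal (t.drop (t.length - linkLen t))

/-! ## Double-ended eertrees -/

/-- The deque operations. -/
inductive Op (σ : ℕ) where
  | pushBack (c : Fin σ)
  | pushFront (c : Fin σ)
  | popBack
  | popFront

/-- The effect of an operation on the string. -/
def Op.apply : Op σ → List (Fin σ) → List (Fin σ)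
  | .pushBack c, s => s ++ [c]
  | .pushFront c, s => c :: s
  | .popBack, s => s.dropLast
  | .popFront, s => s.tail

/-- The pop operations are only allowed on a non-empty string. -/
def Op.Allowed : Op σ → List (Fin σ) → Prop
  | .pushBack _, _ => True
  | .pushFront _, _ => True
  | .popBack, s => s ≠ []
  | .popFront, s => s ≠ []

/-- The argument of an operation as a list of words. -/
def Op.args : Op σ → List ℕ
  | .pushBack c => [c]
  | .pushFront c => [c]
  | .popBack => []
  | .popFront => []

/-- The time and space bound of an operation: `O(1 + log σ)` for a push, `O(1)` for a pop. -/
def Op.bound (C : ℕ) : Op σ → ℕ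
  | .pushBack _ => C * (Nat.log 2 σ + 1)
  | .pushFront _ => C * (Nat.log 2 σ + 1)
  | .popBack => C
  | .popFront => C

/-- A software package for the word RAM: the programs for creating the data structure, for the
four deque operations and for the queries. -/
structure Package where
  create : WordRAM.Prog
  pushBack : WordRAM.Prog
  pushFront : WordRAM.Prog
  popBack : WordRAM.Prog
  popFront : WordRAM.Prog
  even : WordRAM.Prog
  odd : WordRAM.Prog
  next : WordRAM.Prog
  link : WordRAM.Prog
  len : WordRAM.Prog
  count : WordRAM.Prog
  longestPrefix : WordRAM.Prog
  longestSuffix : WordRAM.Prog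
  prefixUnique : WordRAM.Prog
  suffixUnique : WordRAM.Prog
  presurf : WordRAM.Prog
  sufsurf : WordRAM.Prog
  cnt : WordRAM.Prog

/-- The program for an operation. -/
def Package.prog (D : Package) : Op σ → WordRAM.Prog
  | .pushBack _ => D.pushBack
  | .pushFront _ => D.pushFront
  | .popBack => D.popBack
  | .popFront => D.popFront

/-- `D.Reaches w n s m`: the memory `m` can arise by creating the data structure (for the alphabet
size `σ`) on the empty memory and then calling `n` allowed operations, which turn the empty string
into `s`. -/
inductive Package.Reaches (D : Package) (w : ℕ) :
    ℕ → List (Fin σ) → WordRAM.Memory → Prop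
  | create {t res : ℕ} {m : WordRAM.Memory} :
      WordRAM.Runs w D.create [σ] WordRAM.Memory.empty t res m → D.Reaches w 0 [] m
  | op {n t res : ℕ} {s : List (Fin σ)} {m m' : WordRAM.Memory} (o : Op σ) :
      D.Reaches w n s m → o.Allowed s → WordRAM.Runs w (D.prog o) o.args m t res m' →
        D.Reaches w (n + 1) (o.apply s) m'

/-- `D.Represents w C s m`: the memory `m` holds the eertree of `s`, together with the surfaces
of `s` and the counters of its nodes.  The nodes are named by distinct non-zero words (the word
`0` is the null pointer), and the queries are answered correctly by read-only programs, for
`next` in time `O(1 + log σ)` and for all other queries in time `O(1)`. -/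
def Package.Represents (D : Package) (w C : ℕ) (s : List (Fin σ)) (m : WordRAM.Memory) : Prop :=
  ∃ h : Node σ → ℕ,
    Set.InjOn h (nodes s) ∧
    (∀ v ∈ nodes s, 0 < h v ∧ h v < 2 ^ w) ∧
    -- the eertree of `s`
    WordRAM.Answers w D.even [] m C (h .even) ∧
    WordRAM.Answers w D.odd [] m C (h .odd) ∧
    (∀ v ∈ nodes s, ∀ c : Fin σ,
      WordRAM.Answers w D.next [h v, c] m (C * (Nat.log 2 σ + 1))
        ((Eertree.next s v c).elim 0 h)) ∧
    (∀ v ∈ nodes s, WordRAM.Answers w D.link [h v] m C (h (Eertree.link v))) ∧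
    -- lengths, as words: the length `-1` of the root `odd` is the word `2 ^ w - 1`
    (∀ v ∈ nodes s, WordRAM.Answers w D.len [h v] m C (v.len % 2 ^ w).toNat) ∧
    -- the number of distinct palindromic substrings
    WordRAM.Answers w D.count [] m C (palSubstrings s).ncard ∧
    -- the longest palindromic prefix and suffix, and whether they are unique
    WordRAM.Answers w D.longestPrefix [] m C (h (.pal (prepal s 1))) ∧
    WordRAM.Answers w D.longestSuffix [] m C (h (.pal (sufpal s s.length))) ∧
    (s ≠ [] →
      WordRAM.Answers w D.prefixUnique [] m C (if IsUnique s (prepal s 1) then 1 else 0)) ∧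
    (s ≠ [] →
      WordRAM.Answers w D.suffixUnique [] m C
        (if IsUnique s (sufpal s s.length) then 1 else 0)) ∧
    -- the surfaces, and the counters of the nodes other than the roots
    (∀ i ∈ Finset.Icc 1 s.length,
      WordRAM.Answers w D.presurf [i] m C (h (.pal (Eertree.presurf s i)))) ∧
    (∀ i ∈ Finset.Icc 1 s.length,
      WordRAM.Answers w D.sufsurf [i] m C (h (.pal (Eertree.sufsurf s i)))) ∧
    (∀ t ∈ palSubstrings s, t ≠ [] →
      WordRAM.Answers w D.cnt [h (.pal t)] m C (precnt s t) ∧ precnt s t = sufcnt s t)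

end Eertree

/-!
# Double-ended eertrees

The structure maintains, besides the eertree, all surfaces of the string `s` (indexed by their start
and by their end positions), and for every palindrome `t` the number `cnt t` of positions at which
`t` is the longest palindrome and the number `linkCount t` of nodes with the suffix link `t`.

*Combinatorics.*  The longest palindromic suffix of `s` is the surface that ends at the last
position, so it is read off from the array of the surfaces.  Appending a character `c` creates
exactly one surface, the new longest palindromic suffix `x`, and destroys at most one, which has the
same start position as `x` and is the longest proper palindromic prefix of `x`
(`isSurface_append_iff`); when `c` is removed again, the longest proper palindromic prefix of `x` is
restored unless another surface ends where it ends (`isSurface_sufStart_iff`, `isSurface_linkStr`).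
Reflection inside a palindrome shows that the number of positions where `t` is the longest
palindromic prefix equals the number of positions where it is the longest palindromic suffix
(`precnt_eq_sufcnt`), so one counter serves both ends.  A non-empty palindrome `t` occurs in `s` if
and only if `cnt t + linkCount t > 0` (`mem_palSubstrings_iff`), and the longest palindromic suffix
is unique if and only if this sum is `1` (`isUnique_iff`).  All of these data are symmetric under
the reversal of `s`, so the operations at the front are those at the back in the reverse direction:
positions are integers, the reflection `p ↦ 1 - p` exchanges the directions, and the programs take a
flag for it.

*Nodes.*  The longest palindromic suffix of `s c` is `c y c`, where `y` is the longest palindromic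
suffix of `s` that is preceded by `c`, or `c` if there is none (`isLongestSuffix_append`); the
suffix link of `c y c` arises from `y` in the same way (`linkStr_wrap`).  Therefore every node
stores a table that maps `c` to the longest palindromic suffix of its string preceded by `c`.  The
table of `x` differs from that of its suffix link in a single entry (`isLongestBefore_of_link`), so
with persistent binary tries of height `⌈log₂ σ⌉` a new table costs time and space `O(1 + log σ)`;
the edges are kept in such tries too. Apart from its edges, a node depends only on its own string.
Hence a pop need not delete it: it only updates counters and surfaces, in constant time, and a later
push finds the node again.  Nodes that do not occur in the current string are recognized by their
counters, and `next` hides them.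

*Machine.*  The programs are written in a small structured language over the integers, `Code`, with
blocks of `32` memory cells, arrays indexed by integers, and loops of `K = ⌈log₂ σ⌉` iterations. Its
compiler is verified by weakest preconditions with a bound for the running time and for the cells
that are used (`result_of_wp`).  The invariant of the data structure is `Inv`; it is preserved by
`wp_push` and `wp_pop`, and determinism of the word RAM transfers it to every reachable memory
(`stored_of_reaches`).
-/

namespace Eertree

variable {σ : ℕ}

/-! ### Palindromic occurrences -/

/-- The occurrence `s[i..j]` is non-empty and a palindrome. -/
def PalAt (s : List (Fin σ)) (i j : ℕ) : Prop :=
  1 ≤ i ∧ i ≤ j ∧ j ≤ s.length ∧ ∀ k, i ≤ k → k ≤ j → s[k - 1]? = s[i + j - k - 1]?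

theorem sub_eq {s : List (Fin σ)} {i j : ℕ} (h1 : 1 ≤ i) (h2 : i ≤ j) (h3 : j ≤ s.length) :
    sub s i j = (s.take j).drop (i - 1) := if_pos ⟨h1, h2, h3⟩

theorem length_sub {s : List (Fin σ)} {i j : ℕ} (h1 : 1 ≤ i) (h2 : i ≤ j) (h3 : j ≤ s.length) :
    (sub s i j).length = j + 1 - i := by
  rw [sub_eq h1 h2 h3]; simp; omega

theorem sub_ne_nil {s : List (Fin σ)} {i j : ℕ} (h1 : 1 ≤ i) (h2 : i ≤ j) (h3 : j ≤ s.length) :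
    sub s i j ≠ [] := by
  intro h
  have := length_sub h1 h2 h3
  rw [h] at this; simp at this; omega

theorem of_sub_ne_nil {s : List (Fin σ)} {i j : ℕ} (h : sub s i j ≠ []) :
    1 ≤ i ∧ i ≤ j ∧ j ≤ s.length := by
  by_contra hc
  exact h (if_neg hc)

theorem getElem?_sub {s : List (Fin σ)} {i j : ℕ} (h1 : 1 ≤ i) (h2 : i ≤ j) (h3 : j ≤ s.length)
    (k : ℕ) : (sub s i j)[k]? = if k < j + 1 - i then s[i + k - 1]? else none := by
  rw [sub_eq h1 h2 h3, List.getElem?_drop, List.getElem?_take]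
  have e : i - 1 + k = i + k - 1 := by omega
  rw [e]
  split_ifs <;> first | rfl | omega

theorem palindrome_sub_iff {s : List (Fin σ)} {i j : ℕ} (h1 : 1 ≤ i) (h2 : i ≤ j)
    (h3 : j ≤ s.length) :
    (sub s i j).Palindrome ↔ ∀ k, i ≤ k → k ≤ j → s[k - 1]? = s[i + j - k - 1]? := by
  rw [List.Palindrome.iff_reverse_eq]
  have hl := length_sub h1 h2 h3
  constructor
  · intro h k hk1 hk2
    have h' := congrArg (fun l => l[k - i]?) h
    rw [List.getElem?_reverse (by omega), getElem?_sub h1 h2 h3, getElem?_sub h1 h2 h3, hl,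
      if_pos (by omega), if_pos (by omega)] at h'
    rw [show i + (k - i) - 1 = k - 1 by omega,
      show i + (j + 1 - i - 1 - (k - i)) - 1 = i + j - k - 1 by omega] at h'
    exact h'.symm
  · intro h
    apply List.ext_getElem?
    intro k
    by_cases hk : k < j + 1 - i
    · rw [List.getElem?_reverse (by omega), getElem?_sub h1 h2 h3, getElem?_sub h1 h2 h3, hl,
        if_pos (by omega), if_pos (by omega)]
      have := h (i + k) (by omega) (by omega)
      rw [this]
      congr 1; omega
    · rw [List.getElem?_eq_none (by simp; omega), List.getElem?_eq_none (by omega)]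

theorem palAt_iff {s : List (Fin σ)} {i j : ℕ} :
    PalAt s i j ↔ (1 ≤ i ∧ i ≤ j ∧ j ≤ s.length) ∧ (sub s i j).Palindrome := by
  constructor
  · rintro ⟨h1, h2, h3, h4⟩
    exact ⟨⟨h1, h2, h3⟩, (palindrome_sub_iff h1 h2 h3).2 h4⟩
  · rintro ⟨⟨h1, h2, h3⟩, h4⟩
    exact ⟨h1, h2, h3, (palindrome_sub_iff h1 h2 h3).1 h4⟩

theorem PalAt.self {s : List (Fin σ)} {i : ℕ} (h1 : 1 ≤ i) (h2 : i ≤ s.length) : PalAt s i i :=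
  ⟨h1, le_rfl, h2, fun k hk1 hk2 => by
    obtain rfl : k = i := le_antisymm hk2 hk1
    congr 1; omega⟩

/-- A palindrome inside a palindrome can be reflected at the centre of the latter. -/
theorem PalAt.reflect {s : List (Fin σ)} {a b c d : ℕ} (h : PalAt s a b) (h' : PalAt s c d)
    (hac : a ≤ c) (hdb : d ≤ b) : PalAt s (a + b - d) (a + b - c) := by
  obtain ⟨h1, h2, h3, h4⟩ := h
  obtain ⟨g1, g2, g3, g4⟩ := h'
  refine ⟨by omega, by omega, by omega, fun k hk1 hk2 => ?_⟩
  rw [h4 k (by omega) (by omega), g4 (a + b - k) (by omega) (by omega),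
    h4 (c + d - (a + b - k)) (by omega) (by omega)]
  congr 1; omega

theorem PalAt.center {s : List (Fin σ)} {a b c d : ℕ} (h : PalAt s a b) (hac : a ≤ c)
    (hcd : c ≤ d) (hd : c + d = a + b) : PalAt s c d := by
  obtain ⟨h1, h2, h3, h4⟩ := h
  refine ⟨by omega, by omega, by omega, fun k hk1 hk2 => ?_⟩
  rw [h4 k (by omega) (by omega), hd]

/-- If `s[i'..k]` is a proper palindromic suffix of the palindrome `s[i..k]`, then every
proper palindromic prefix of `s[i'..k]` can be extended to the left to a longer palindrome:
either its union with its mirror image in `s[i..k]` is such an extension, or removing the period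
`i' - i` from both palindromes gives a smaller instance. -/
theorem PalAt.exists_extend_left {s : List (Fin σ)} {i i' j k : ℕ} (h : PalAt s i k)
    (h' : PalAt s i' k) (hj : PalAt s i' j) (hi : i < i') (hjk : j < k) :
    ∃ l, i ≤ l ∧ l < i' ∧ PalAt s l j := by
  induction k using Nat.strong_induction_on with
  | _ k ih =>
    have b1 := hj.1
    have b2 := hj.2.1
    have b3 := h.1
    by_cases hl : i + k - j < i'
    · exact ⟨i + k - j, by omega, hl, h.center (by omega) (by omega) (by omega)⟩
    · have hr : PalAt s i (i + k - i') := by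
        have := h.reflect h' hi.le le_rfl
        rwa [show i + k - k = i by omega] at this
      by_cases hjk' : j = i + k - i'
      · exact ⟨i, le_rfl, hi, hjk' ▸ hr⟩
      · exact ih (i + k - i') (by omega) hr (h.center (by omega) (by omega) (by omega)) (by omega)

theorem PalAt.exists_extend_right {s : List (Fin σ)} {l i j r : ℕ} (h : PalAt s l r)
    (h' : PalAt s l j) (hi : PalAt s i j) (hjr : j < r) (hli : l < i) :
    ∃ r', j < r' ∧ r' ≤ r ∧ PalAt s i r' := by
  induction hn : r - l using Nat.strong_induction_on generalizing l with
  | _ n ih =>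
    have b1 := hi.1
    have b2 := hi.2.1
    have b3 := h.1
    by_cases hl : j < l + r - i
    · exact ⟨l + r - i, hl, by omega, h.center (by omega) (by omega) (by omega)⟩
    · have hr : PalAt s (l + r - j) r := by
        have := h.reflect h' le_rfl hjr.le
        rwa [show l + r - l = r by omega] at this
      by_cases hjk' : i = l + r - j
      · exact ⟨r, hjr, le_rfl, hjk' ▸ hr⟩
      · exact ih (r - (l + r - j)) (by omega) hr (h.center (by omega) (by omega) (by omega))
          (by omega) rfl

/-! ### Longest palindromes at a position and surfaces -/

theorem prelen_spec {s : List (Fin σ)} {i : ℕ} (h1 : 1 ≤ i) (h2 : i ≤ s.length) :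
    1 ≤ prelen s i ∧ PalAt s i (i + prelen s i - 1) := by
  have hne : ((Finset.Icc 1 (s.length + 1 - i)).filter
      fun l => (sub s i (i + l - 1)).Palindrome).Nonempty := by
    refine ⟨1, Finset.mem_filter.2 ⟨Finset.mem_Icc.2 ⟨le_rfl, by omega⟩, ?_⟩⟩
    exact (palAt_iff.1 (PalAt.self h1 h2)).2
  obtain ⟨l, hl, hl'⟩ := Finset.exists_mem_eq_sup _ hne id
  have e : prelen s i = l := hl'
  rw [e]
  obtain ⟨ha, hb⟩ := Finset.mem_filter.1 hl
  have := Finset.mem_Icc.1 ha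
  exact ⟨this.1, palAt_iff.2 ⟨⟨h1, by omega, by omega⟩, hb⟩⟩

theorem PalAt.le_prelen {s : List (Fin σ)} {i j : ℕ} (h : PalAt s i j) :
    j + 1 ≤ i + prelen s i := by
  have h' := palAt_iff.1 h
  have : j + 1 - i ≤ prelen s i := by
    refine Finset.le_sup (f := id) (b := j + 1 - i) (Finset.mem_filter.2
      ⟨Finset.mem_Icc.2 ⟨by omega, by omega⟩, ?_⟩)
    rw [show i + (j + 1 - i) - 1 = j by omega]
    exact h'.2
  omega

theorem suflen_spec {s : List (Fin σ)} {j : ℕ} (h1 : 1 ≤ j) (h2 : j ≤ s.length) :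
    1 ≤ suflen s j ∧ suflen s j ≤ j ∧ PalAt s (j + 1 - suflen s j) j := by
  have hne : ((Finset.Icc 1 j).filter
      fun l => (sub s (j + 1 - l) j).Palindrome).Nonempty := by
    refine ⟨1, Finset.mem_filter.2 ⟨Finset.mem_Icc.2 ⟨le_rfl, by omega⟩, ?_⟩⟩
    exact (palAt_iff.1 (PalAt.self h1 h2)).2
  obtain ⟨l, hl, hl'⟩ := Finset.exists_mem_eq_sup _ hne id
  have e : suflen s j = l := hl'
  rw [e]
  obtain ⟨ha, hb⟩ := Finset.mem_filter.1 hl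
  have := Finset.mem_Icc.1 ha
  exact ⟨this.1, this.2, palAt_iff.2 ⟨⟨by omega, by omega, by omega⟩, hb⟩⟩

theorem PalAt.le_suflen {s : List (Fin σ)} {i j : ℕ} (h : PalAt s i j) :
    j + 1 ≤ i + suflen s j := by
  have h' := palAt_iff.1 h
  have : j + 1 - i ≤ suflen s j := by
    refine Finset.le_sup (f := id) (b := j + 1 - i) (Finset.mem_filter.2
      ⟨Finset.mem_Icc.2 ⟨by omega, by omega⟩, ?_⟩)
    rw [show j + 1 - (j + 1 - i) = i by omega]
    exact h'.2
  omega

theorem isSurface_iff {s : List (Fin σ)} {i j : ℕ} : IsSurface s i j ↔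
    PalAt s i j ∧ (∀ r, j < r → ¬ PalAt s i r) ∧ (∀ l, l < i → ¬ PalAt s l j) := by
  unfold IsSurface
  simp only [palAt_iff, Finset.mem_Icc]
  constructor
  · rintro ⟨h1, h2, h3, h4⟩
    exact ⟨⟨h1, h2⟩, fun r hr h => h3 r ⟨hr, h.1.2.2⟩ h.2, fun l hl h => h4 l ⟨h.1.1, by omega⟩ h.2⟩
  · rintro ⟨⟨h1, h2⟩, h3, h4⟩
    exact ⟨h1, h2, fun r hr h => h3 r (by omega) ⟨⟨by omega, by omega, by omega⟩, h⟩,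
      fun l hl h => h4 l (by omega) ⟨⟨by omega, by omega, by omega⟩, h⟩⟩

theorem IsSurface.palAt {s : List (Fin σ)} {i j : ℕ} (h : IsSurface s i j) : PalAt s i j :=
  (isSurface_iff.1 h).1

theorem IsSurface.eq_prelen {s : List (Fin σ)} {i j : ℕ} (h : IsSurface s i j) :
    j = i + prelen s i - 1 := by
  obtain ⟨h1, h2, h3⟩ := isSurface_iff.1 h
  have hp := prelen_spec h1.1 (h1.2.1.trans h1.2.2.1)
  have := h1.le_prelen
  by_contra hne
  exact h2 _ (by omega) hp.2

theorem IsSurface.eq_suflen {s : List (Fin σ)} {i j : ℕ} (h : IsSurface s i j) :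
    i = j + 1 - suflen s j := by
  obtain ⟨h1, h2, h3⟩ := isSurface_iff.1 h
  have hp := suflen_spec (h1.1.trans h1.2.1) (h1.2.2.1)
  have := h1.le_suflen
  by_contra hne
  exact h3 _ (by omega) hp.2.2

theorem presurf_of_isSurface {s : List (Fin σ)} {i j : ℕ} (h : IsSurface s i j) :
    presurf s i = sub s i j := by
  unfold presurf prepal
  rw [← h.eq_prelen, if_pos h]

theorem sufsurf_of_isSurface {s : List (Fin σ)} {i j : ℕ} (h : IsSurface s i j) :
    sufsurf s j = sub s i j := by
  unfold sufsurf sufpal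
  rw [← h.eq_suflen, if_pos h]

theorem presurf_of_forall {s : List (Fin σ)} {i : ℕ} (h : ∀ j, ¬ IsSurface s i j) :
    presurf s i = [] := if_neg (h _)

theorem sufsurf_of_forall {s : List (Fin σ)} {j : ℕ} (h : ∀ i, ¬ IsSurface s i j) :
    sufsurf s j = [] := if_neg (h _)

theorem isSurface_of_presurf_ne {s : List (Fin σ)} {i : ℕ} (h : presurf s i ≠ []) :
    IsSurface s i (i + (presurf s i).length - 1) := by
  by_cases hs : IsSurface s i (i + prelen s i - 1)
  · have hp := hs.palAt
    rw [presurf_of_isSurface hs, length_sub hp.1 hp.2.1 hp.2.2.1]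
    rwa [show i + (i + prelen s i - 1 + 1 - i) - 1 = i + prelen s i - 1 by have := hp.2.1; omega]
  · exact absurd (if_neg hs) h

theorem sufsurf_eq_nil_iff {s : List (Fin σ)} {j : ℕ} :
    sufsurf s j = [] ↔ ∀ i, ¬ IsSurface s i j := by
  refine ⟨fun h i hs => ?_, sufsurf_of_forall⟩
  rw [sufsurf_of_isSurface hs] at h
  exact sub_ne_nil hs.palAt.1 hs.palAt.2.1 hs.palAt.2.2.1 h

/-- The longest palindromic suffix is a surface. -/
theorem isSurface_suffix {s : List (Fin σ)} (h : s ≠ []) :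
    IsSurface s (s.length + 1 - suflen s s.length) s.length := by
  have hl : 1 ≤ s.length := List.length_pos_iff.2 h
  have hp := suflen_spec hl le_rfl
  refine isSurface_iff.2 ⟨hp.2.2, fun r hr h => ?_, fun l hl h => ?_⟩
  · have := h.2.2.1; omega
  · have := h.le_suflen; omega

theorem sufsurf_length {s : List (Fin σ)} : sufsurf s s.length = sufpal s s.length := by
  by_cases h : s = []
  · subst h; rfl
  · exact if_pos (isSurface_suffix h)

/-! ### Surfaces after appending a character -/

theorem sub_append {s : List (Fin σ)} {t : List (Fin σ)} {i j : ℕ} (hj : j ≤ s.length) :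
    sub (s ++ t) i j = sub s i j := by
  unfold sub
  by_cases h : 1 ≤ i ∧ i ≤ j ∧ j ≤ s.length
  · rw [if_pos h, if_pos ⟨h.1, h.2.1, by simp; omega⟩, List.take_append_of_le_length hj]
  · rw [if_neg h, if_neg (fun h' => h ⟨h'.1, h'.2.1, hj⟩)]

theorem palAt_append {s : List (Fin σ)} {c : Fin σ} {i j : ℕ} (hj : j ≤ s.length) :
    PalAt (s ++ [c]) i j ↔ PalAt s i j := by
  rw [palAt_iff, palAt_iff, sub_append hj]
  simp only [List.length_append, List.length_singleton]
  constructor <;> rintro ⟨h1, h2⟩ <;> exact ⟨⟨h1.1, h1.2.1, by omega⟩, h2⟩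

/-- The start position of the longest palindromic suffix. -/
def sufStart (s : List (Fin σ)) : ℕ := s.length + 1 - suflen s s.length

theorem isSurface_sufStart {s : List (Fin σ)} (h : s ≠ []) : IsSurface s (sufStart s) s.length :=
  isSurface_suffix h

theorem palAt_sufStart {s : List (Fin σ)} (h : s ≠ []) : PalAt s (sufStart s) s.length :=
  (isSurface_suffix h).palAt

/-- Appending a character destroys at most one surface, namely the one with the start position of
the new longest palindromic suffix, and the latter is the only new surface. -/
theorem isSurface_append_iff {s : List (Fin σ)} {c : Fin σ} {i j : ℕ} :
    IsSurface (s ++ [c]) i j ↔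
      (i = sufStart (s ++ [c]) ∧ j = s.length + 1) ∨
        (IsSurface s i j ∧ i ≠ sufStart (s ++ [c])) := by
  have hne : s ++ [c] ≠ [] := by simp
  have hlen : (s ++ [c]).length = s.length + 1 := by simp
  have hx := palAt_sufStart hne
  have hS : IsSurface (s ++ [c]) (sufStart (s ++ [c])) (s.length + 1) := by
    have := isSurface_sufStart hne; rwa [hlen] at this
  rw [hlen] at hx
  constructor
  · intro h
    have hp := h.palAt
    by_cases hj : j ≤ s.length
    · right
      obtain ⟨h1, h2, h3⟩ := isSurface_iff.1 h
      refine ⟨isSurface_iff.2 ⟨(palAt_append hj).1 h1, fun r hr hr' => ?_, fun l hl hl' => ?_⟩, ?_⟩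
      · exact h2 r hr ((palAt_append hr'.2.2.1).2 hr')
      · exact h3 l hl ((palAt_append hj).2 hl')
      · rintro rfl
        exact h2 _ (by omega) hx
    · left
      have hj' : j = s.length + 1 := by have := hp.2.2.1; omega
      subst hj'
      exact ⟨h.eq_suflen.trans hS.eq_suflen.symm, rfl⟩
  · rintro (⟨rfl, rfl⟩ | ⟨h, hi⟩)
    · exact hS
    · obtain ⟨h1, h2, h3⟩ := isSurface_iff.1 h
      have hj := h1.2.2.1
      have h1' : PalAt (s ++ [c]) i j := (palAt_append hj).2 h1
      refine isSurface_iff.2 ⟨h1', fun r hr hr' => ?_, fun l hl hl' => ?_⟩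
      · by_cases hrl : r ≤ s.length
        · exact h2 r hr ((palAt_append hrl).1 hr')
        · obtain rfl : r = s.length + 1 := by have := hr'.2.2.1; omega
          have hlt : sufStart (s ++ [c]) < i := by
            by_contra hge
            exact (isSurface_iff.1 hS).2.2 i (by omega) hr'
          obtain ⟨l, -, hl, hl'⟩ := hx.exists_extend_left hr' h1' hlt (by omega)
          exact h3 l hl ((palAt_append hj).1 hl')
      · exact h3 l hl ((palAt_append hj).1 hl')

/-- Conversely, when the last character is removed, the longest proper palindromic prefix `z` of
the longest palindromic suffix becomes a surface unless there is already a surface that ends where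
`z` ends. -/
theorem isSurface_sufStart_iff {s : List (Fin σ)} {c : Fin σ} {m j : ℕ}
    (hm : PalAt s (sufStart (s ++ [c])) m)
    (hmax : ∀ r, PalAt s (sufStart (s ++ [c])) r → r ≤ m) :
    IsSurface s (sufStart (s ++ [c])) j ↔ j = m ∧ ∀ i, ¬ IsSurface (s ++ [c]) i m := by
  have hne : s ++ [c] ≠ [] := by simp
  have hlen : (s ++ [c]).length = s.length + 1 := by simp
  have hx := palAt_sufStart hne
  have hS : IsSurface (s ++ [c]) (sufStart (s ++ [c])) (s.length + 1) := by
    have := isSurface_sufStart hne; rwa [hlen] at this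
  rw [hlen] at hx
  set i0 := sufStart (s ++ [c]) with hi0
  have hms := hm.2.2.1
  constructor
  · intro h
    have hjm : j = m := by
      have h1 := hmax j h.palAt
      by_contra hne
      exact (isSurface_iff.1 h).2.1 m (by omega) hm
    refine ⟨hjm, fun i hi => ?_⟩
    subst hjm
    rcases isSurface_append_iff.1 hi with ⟨_, h2⟩ | ⟨h1, h2⟩
    · omega
    · exact h2 (h1.eq_suflen.trans h.eq_suflen.symm)
  · rintro ⟨rfl, h⟩
    refine isSurface_iff.2 ⟨hm, fun r hr hr' => ?_, fun l hl hl' => ?_⟩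
    · have := hmax r hr'; omega
    · -- the longest palindrome ending at `j` would be a surface of `s ++ [c]`
      have hsp := suflen_spec (hm.1.trans hm.2.1) hms
      set l' := j + 1 - suflen s j with hl'def
      have hle : l' ≤ l := by have := hl'.le_suflen; have := hl'.1; omega
      have hp' : PalAt (s ++ [c]) l' j := (palAt_append hms).2 hsp.2.2
      refine h l' (isSurface_iff.2 ⟨hp', fun r hr hr' => ?_, fun q hq hq' => ?_⟩)
      · obtain ⟨r', h1, h2, h3⟩ :=
          hr'.exists_extend_right hp' ((palAt_append hms).2 hm) hr (by omega)
        by_cases hrl : r' ≤ s.length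
        · have := hmax r' ((palAt_append hrl).1 h3); omega
        · have : r' = s.length + 1 := by have := h3.2.2.1; omega
          have hr1 : r = s.length + 1 := by have := hr'.2.2.1; simp at this; omega
          subst hr1
          exact (isSurface_iff.1 hS).2.2 l' (by omega) hr'
      · have := ((palAt_append hms).1 hq').le_suflen
        have := hq'.1
        omega

/-! ### Reversal -/

theorem getElem?_reverse' {s : List (Fin σ)} {k : ℕ} (h1 : 1 ≤ k) (h2 : k ≤ s.length) :
    s.reverse[k - 1]? = s[s.length + 1 - k - 1]? := by
  rw [List.getElem?_reverse (by omega)]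
  congr 1; omega

theorem palAt_reverse {s : List (Fin σ)} {i j : ℕ} (h1 : 1 ≤ i) (h2 : i ≤ s.length)
    (h3 : 1 ≤ j) (h4 : j ≤ s.length) :
    PalAt s.reverse i j ↔ PalAt s (s.length + 1 - j) (s.length + 1 - i) := by
  unfold PalAt
  rw [List.length_reverse]
  constructor
  · rintro ⟨g1, g2, g3, g4⟩
    refine ⟨by omega, by omega, by omega, fun k hk1 hk2 => ?_⟩
    have := g4 (s.length + 1 - k) (by omega) (by omega)
    rw [getElem?_reverse' (by omega) (by omega), getElem?_reverse' (by omega) (by omega)] at this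
    rw [show k - 1 = s.length + 1 - (s.length + 1 - k) - 1 by omega, this]
    congr 1; omega
  · rintro ⟨g1, g2, g3, g4⟩
    refine ⟨by omega, by omega, by omega, fun k hk1 hk2 => ?_⟩
    have := g4 (s.length + 1 - k) (by omega) (by omega)
    rw [getElem?_reverse' (by omega) (by omega), getElem?_reverse' (by omega) (by omega), this]
    congr 1; omega

theorem sub_reverse {s : List (Fin σ)} {i j : ℕ} (h1 : 1 ≤ i) (h2 : i ≤ j)
    (h3 : j ≤ s.length) :
    sub s.reverse i j = (sub s (s.length + 1 - j) (s.length + 1 - i)).reverse := by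
  apply List.ext_getElem?
  intro k
  have hl := length_sub (s := s) (i := s.length + 1 - j) (j := s.length + 1 - i)
    (by omega) (by omega) (by omega)
  rw [getElem?_sub h1 h2 (by simpa using h3)]
  by_cases hk : k < j + 1 - i
  · rw [if_pos hk, getElem?_reverse' (by omega) (by omega), List.getElem?_reverse (by omega),
      getElem?_sub (by omega) (by omega) (by omega), if_pos (by omega)]
    congr 1; omega
  · rw [if_neg hk, List.getElem?_eq_none (by simp; omega)]

theorem isSurface_reverse {s : List (Fin σ)} {i j : ℕ} (h1 : 1 ≤ i) (h2 : i ≤ s.length)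
    (h3 : 1 ≤ j) (h4 : j ≤ s.length) :
    IsSurface s.reverse i j ↔ IsSurface s (s.length + 1 - j) (s.length + 1 - i) := by
  rw [isSurface_iff, isSurface_iff, palAt_reverse h1 h2 h3 h4]
  constructor
  · rintro ⟨g1, g2, g3⟩
    refine ⟨g1, fun r hr hr' => ?_, fun l hl hl' => ?_⟩
    · have hb := hr'.2.2.1
      refine g3 (s.length + 1 - r) (by omega) ((palAt_reverse (by omega) (by omega) h3 h4).2 ?_)
      rwa [show s.length + 1 - (s.length + 1 - r) = r by omega]
    · have hb := hl'.1
      refine g2 (s.length + 1 - l) (by omega) ((palAt_reverse h1 h2 (by omega) (by omega)).2 ?_)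
      rwa [show s.length + 1 - (s.length + 1 - l) = l by omega]
  · rintro ⟨g1, g2, g3⟩
    refine ⟨g1, fun r hr hr' => ?_, fun l hl hl' => ?_⟩
    · have hb := hr'.2.2.1
      rw [List.length_reverse] at hb
      exact g3 (s.length + 1 - r) (by omega) ((palAt_reverse h1 h2 (by omega) hb).1 hr')
    · have hb := hl'.1
      exact g2 (s.length + 1 - l) (by omega) ((palAt_reverse hb (by omega) h3 h4).1 hl')

theorem presurf_reverse {s : List (Fin σ)} {i : ℕ} (h1 : 1 ≤ i) (h2 : i ≤ s.length) :
    presurf s.reverse i = sufsurf s (s.length + 1 - i) := by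
  by_cases h : ∃ j, IsSurface s.reverse i j
  · obtain ⟨j, hj⟩ := h
    have hp := palAt_iff.1 hj.palAt
    have hjl : j ≤ s.length := by simpa using hp.1.2.2
    have hs := (isSurface_reverse h1 h2 (by omega) hjl).1 hj
    rw [presurf_of_isSurface hj, sufsurf_of_isSurface hs]
    rw [← hp.2.reverse_eq, sub_reverse h1 hp.1.2.1 hjl, List.reverse_reverse]
  · rw [not_exists] at h
    rw [presurf_of_forall h, sufsurf_of_forall]
    intro j hj
    have hb := hj.palAt
    refine h (s.length + 1 - j) ((isSurface_reverse h1 h2 (by have := hb.2.1; omega)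
      (by have := hb.1; omega)).2 ?_)
    rwa [show s.length + 1 - (s.length + 1 - j) = j by have := hb.2.1; have := hb.1; omega]

theorem sufsurf_reverse {s : List (Fin σ)} {i : ℕ} (h1 : 1 ≤ i) (h2 : i ≤ s.length) :
    sufsurf s.reverse i = presurf s (s.length + 1 - i) := by
  have := presurf_reverse (s := s.reverse) (i := s.length + 1 - i) (by omega) (by simp; omega)
  rw [List.reverse_reverse, List.length_reverse] at this
  rw [this]
  congr 1; omega

theorem suflen_reverse {s : List (Fin σ)} {i : ℕ} (h1 : 1 ≤ i) (h2 : i ≤ s.length) :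
    suflen s.reverse i = prelen s (s.length + 1 - i) := by
  unfold suflen prelen
  rw [show s.length + 1 - (s.length + 1 - i) = i by omega]
  congr 1
  refine Finset.filter_congr fun l hl => ?_
  obtain ⟨hl1, hl2⟩ := Finset.mem_Icc.1 hl
  rw [sub_reverse (by omega) (by omega) h2,
    show s.length + 1 - (i + 1 - l) = s.length + 1 - i + l - 1 by omega,
    List.Palindrome.iff_reverse_eq, List.Palindrome.iff_reverse_eq, List.reverse_reverse]
  exact eq_comm

theorem sufpal_reverse {s : List (Fin σ)} {i : ℕ} (h1 : 1 ≤ i) (h2 : i ≤ s.length) :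
    sufpal s.reverse i = prepal s (s.length + 1 - i) := by
  have hp := prelen_spec (s := s) (i := s.length + 1 - i) (by omega) (by omega)
  have hb := hp.2.2.2.1
  unfold sufpal prepal
  rw [suflen_reverse h1 h2, sub_reverse (by omega) (by omega) h2]
  rw [show s.length + 1 - (i + 1 - prelen s (s.length + 1 - i)) =
    s.length + 1 - i + prelen s (s.length + 1 - i) - 1 by omega]
  exact (palAt_iff.1 hp.2).2.reverse_eq

theorem sufcnt_reverse {s t : List (Fin σ)} : sufcnt s.reverse t = precnt s t := by
  unfold sufcnt precnt
  rw [List.length_reverse]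
  refine Finset.card_nbij' (fun i => s.length + 1 - i) (fun i => s.length + 1 - i) ?_ ?_ ?_ ?_
  · intro i hi
    simp only [Finset.coe_filter, Finset.mem_Icc, Set.mem_ofPred_eq] at hi ⊢
    rw [sufpal_reverse hi.1.1 hi.1.2] at hi
    exact ⟨by omega, hi.2⟩
  · intro i hi
    simp only [Finset.coe_filter, Finset.mem_Icc, Set.mem_ofPred_eq] at hi ⊢
    rw [sufpal_reverse (by omega) (by omega),
      show s.length + 1 - (s.length + 1 - i) = i by omega]
    exact ⟨by omega, hi.2⟩
  · intro i hi
    simp only [Finset.coe_filter, Finset.mem_Icc, Set.mem_ofPred_eq] at hi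
    dsimp only
    omega
  · intro i hi
    simp only [Finset.coe_filter, Finset.mem_Icc, Set.mem_ofPred_eq] at hi
    dsimp only
    omega

theorem precnt_reverse {s t : List (Fin σ)} : precnt s.reverse t = sufcnt s t := by
  rw [← sufcnt_reverse, List.reverse_reverse]

theorem palSubstrings_reverse {s : List (Fin σ)} : palSubstrings s.reverse = palSubstrings s := by
  ext t
  refine and_congr_right fun ht => ?_
  conv_lhs => rw [← ht.reverse_eq]
  exact List.reverse_infix

theorem prepal_one_reverse {s : List (Fin σ)} :
    prepal s.reverse 1 = sufpal s s.length := by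
  by_cases h : s = []
  · subst h; rfl
  · have hl : 1 ≤ s.length := List.length_pos_iff.2 h
    have := sufpal_reverse (s := s.reverse) (i := s.length) hl (by simp)
    rw [List.reverse_reverse, List.length_reverse] at this
    rw [this]
    congr 1; omega

/-! ### Occurrences and counters -/

theorem sub_infix (s : List (Fin σ)) (i j : ℕ) : sub s i j <:+: s := by
  unfold sub
  split_ifs
  · exact (List.drop_suffix _ _).isInfix.trans (List.take_prefix _ _).isInfix
  · exact List.nil_infix

theorem mem_occur {s t : List (Fin σ)} {i : ℕ} (ht : t ≠ []) :
    i ∈ occur s t ↔ sub s i (i + t.length - 1) = t := by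
  unfold occur
  rw [Finset.mem_filter, Finset.mem_Icc]
  refine ⟨fun h => h.2, fun h => ⟨?_, h⟩⟩
  have hl := List.length_pos_iff.2 ht
  have := of_sub_ne_nil (h.symm ▸ ht : sub s i (i + t.length - 1) ≠ [])
  omega

theorem bounds_of_mem_occur {s t : List (Fin σ)} {i : ℕ} (ht : t ≠ []) (h : i ∈ occur s t) :
    1 ≤ i ∧ i ≤ i + t.length - 1 ∧ i + t.length - 1 ≤ s.length :=
  of_sub_ne_nil (((mem_occur ht).1 h).symm ▸ ht)

theorem palAt_of_mem_occur {s t : List (Fin σ)} {i : ℕ} (ht : t ≠ []) (hp : t.Palindrome)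
    (h : i ∈ occur s t) : PalAt s i (i + t.length - 1) :=
  palAt_iff.2 ⟨bounds_of_mem_occur ht h, ((mem_occur ht).1 h).symm ▸ hp⟩

theorem infix_iff_occur {s t : List (Fin σ)} (ht : t ≠ []) : t <:+: s ↔ (occur s t).Nonempty := by
  constructor
  · rintro ⟨a, b, rfl⟩
    have hl := List.length_pos_iff.2 ht
    refine ⟨a.length + 1, (mem_occur ht).2 ?_⟩
    rw [sub_eq (by omega) (by omega) (by simp)]
    rw [List.take_append_of_le_length (by simp), List.take_of_length_le (by simp)]
    simp
  · rintro ⟨i, hi⟩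
    rw [← (mem_occur ht).1 hi]
    exact sub_infix _ _ _

/-- Substrings of a palindrome at positions that are reflected at its centre are reversals of each
other. -/
theorem PalAt.sub_reflect {s : List (Fin σ)} {a b c d : ℕ} (h : PalAt s a b) (hp : PalAt s c d)
    (hac : a ≤ c) (hdb : d ≤ b) : sub s (a + b - d) (a + b - c) = sub s c d := by
  have h' := h.reflect hp hac hdb
  have g1 := hp.2.1
  have g2 := hp.1
  have g3 := hp.2.2.1
  apply List.ext_getElem?
  intro k
  rw [getElem?_sub h'.1 h'.2.1 h'.2.2.1, getElem?_sub hp.1 hp.2.1 hp.2.2.1]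
  by_cases hk : k < d + 1 - c
  · rw [if_pos (by omega), if_pos hk, hp.2.2.2 (c + k) (by omega) (by omega),
      h.2.2.2 (c + d - (c + k)) (by omega) (by omega)]
    congr 1; omega
  · rw [if_neg (by omega), if_neg hk]

theorem sufpal_eq_iff {s t : List (Fin σ)} {j : ℕ} (ht : t ≠ []) (hp : t.Palindrome)
    (h1 : 1 ≤ j) (h2 : j ≤ s.length) : sufpal s j = t ↔ t.length ≤ j ∧
      j + 1 - t.length ∈ occur s t ∧ ∀ l, l < j + 1 - t.length → ¬ PalAt s l j := by
  have hs := suflen_spec h1 h2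
  have hl := List.length_pos_iff.2 ht
  constructor
  · intro h
    have hlen : t.length = suflen s j := by
      rw [← h]; unfold sufpal; rw [length_sub hs.2.2.1 hs.2.2.2.1 hs.2.2.2.2.1]; omega
    refine ⟨by omega, (mem_occur ht).2 ?_, fun l hl hl' => ?_⟩
    · rw [← h] at hlen ⊢
      rw [hlen]; unfold sufpal
      congr 1; omega
    · have := hl'.le_suflen; omega
  · rintro ⟨g1, g2, g3⟩
    have hpa := palAt_of_mem_occur ht hp g2
    rw [show j + 1 - t.length + t.length - 1 = j by omega] at hpa
    have h5 := hpa.le_suflen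
    have h6 : suflen s j = t.length := by
      by_contra hne
      exact g3 _ (by omega) hs.2.2
    have h7 := (mem_occur ht).1 g2
    rw [show j + 1 - t.length + t.length - 1 = j by omega] at h7
    unfold sufpal
    rw [h6, h7]

theorem prepal_eq_iff {s t : List (Fin σ)} {i : ℕ} (ht : t ≠ []) (hp : t.Palindrome)
    (h1 : 1 ≤ i) (h2 : i ≤ s.length) : prepal s i = t ↔
      i ∈ occur s t ∧ ∀ r, i + t.length - 1 < r → ¬ PalAt s i r := by
  have hs := prelen_spec h1 h2
  have hl := List.length_pos_iff.2 ht
  constructor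
  · intro h
    have hlen : t.length = prelen s i := by
      rw [← h]; unfold prepal; rw [length_sub hs.2.1 hs.2.2.1 hs.2.2.2.1]; omega
    refine ⟨(mem_occur ht).2 ?_, fun r hr hr' => ?_⟩
    · rw [← h] at hlen ⊢
      rw [hlen]; rfl
    · have := hr'.le_prelen; omega
  · rintro ⟨g2, g3⟩
    have hpa := palAt_of_mem_occur ht hp g2
    have h5 := hpa.le_prelen
    have h6 : prelen s i = t.length := by
      by_contra hne
      exact g3 _ (by omega) hs.2
    unfold prepal
    rw [h6, (mem_occur ht).1 g2]

open Classical in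
theorem sufcnt_eq_card {s t : List (Fin σ)} (ht : t ≠ []) (hp : t.Palindrome) :
    sufcnt s t = ((occur s t).filter
      fun i => ¬ ∃ l, l < i ∧ PalAt s l (i + t.length - 1)).card := by
  have hl := List.length_pos_iff.2 ht
  unfold sufcnt
  refine Finset.card_nbij' (fun j => j + 1 - t.length) (fun i => i + t.length - 1) ?_ ?_ ?_ ?_
  · intro j hj
    simp only [Finset.coe_filter, Finset.mem_Icc, Set.mem_ofPred_eq] at hj ⊢
    obtain ⟨⟨h1, h2⟩, h3⟩ := hj
    rw [sufpal_eq_iff ht hp h1 h2] at h3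
    refine ⟨h3.2.1, ?_⟩
    rintro ⟨l, hl1, hl2⟩
    rw [show j + 1 - t.length + t.length - 1 = j by omega] at hl2
    exact h3.2.2 l hl1 hl2
  · intro i hi
    simp only [Finset.coe_filter, Finset.mem_Icc, Set.mem_ofPred_eq] at hi ⊢
    have hb := bounds_of_mem_occur ht hi.1
    refine ⟨⟨by omega, hb.2.2⟩, (sufpal_eq_iff ht hp (by omega) hb.2.2).2 ?_⟩
    rw [show i + t.length - 1 + 1 - t.length = i by omega]
    exact ⟨by omega, hi.1, fun l hl hl' => hi.2 ⟨l, hl, hl'⟩⟩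
  · intro j hj
    simp only [Finset.coe_filter, Finset.mem_Icc, Set.mem_ofPred_eq] at hj
    obtain ⟨⟨h1, h2⟩, h3⟩ := hj
    rw [sufpal_eq_iff ht hp h1 h2] at h3
    dsimp only; omega
  · intro j hj
    dsimp only; omega

open Classical in
theorem precnt_eq_card {s t : List (Fin σ)} (ht : t ≠ []) (hp : t.Palindrome) :
    precnt s t = ((occur s t).filter
      fun i => ¬ ∃ r, i + t.length - 1 < r ∧ PalAt s i r).card := by
  unfold precnt
  congr 1
  ext i
  simp only [Finset.mem_filter, Finset.mem_Icc]
  constructor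
  · rintro ⟨⟨h1, h2⟩, h3⟩
    rw [prepal_eq_iff ht hp h1 h2] at h3
    exact ⟨h3.1, fun ⟨r, hr, hr'⟩ => h3.2 r hr hr'⟩
  · rintro ⟨h1, h2⟩
    have hb := bounds_of_mem_occur ht h1
    exact ⟨⟨hb.1, by omega⟩, (prepal_eq_iff ht hp hb.1 (by omega)).2
      ⟨h1, fun r hr hr' => h2 ⟨r, hr, hr'⟩⟩⟩

/-- An occurrence of `t` that is a proper prefix of a palindrome is mapped to its mirror image in
the shortest such palindrome; this is an injection into the occurrences that are proper suffixes
of palindromes. -/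
theorem sufcnt_le_precnt {s t : List (Fin σ)} (ht : t ≠ []) (hp : t.Palindrome) :
    sufcnt s t ≤ precnt s t := by
  classical
  have hl := List.length_pos_iff.2 ht
  rw [sufcnt_eq_card ht hp, precnt_eq_card ht hp]
  have e1 := Finset.card_filter_add_card_filter_not (s := occur s t)
    (fun i => ∃ l, l < i ∧ PalAt s l (i + t.length - 1))
  have e2 := Finset.card_filter_add_card_filter_not (s := occur s t)
    (fun i => ∃ r, i + t.length - 1 < r ∧ PalAt s i r)
  suffices h : ((occur s t).filter (fun i => ∃ r, i + t.length - 1 < r ∧ PalAt s i r)).card ≤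
      ((occur s t).filter (fun i => ∃ l, l < i ∧ PalAt s l (i + t.length - 1))).card by omega
  let R : ℕ → ℕ := fun i => sInf {r | i + t.length - 1 < r ∧ PalAt s i r}
  have hR : ∀ i, (∃ r, i + t.length - 1 < r ∧ PalAt s i r) →
      (i + t.length - 1 < R i ∧ PalAt s i (R i)) ∧
        ∀ r, i + t.length - 1 < r → PalAt s i r → R i ≤ r := by
    intro i hi
    exact ⟨Nat.sInf_mem (s := {r | i + t.length - 1 < r ∧ PalAt s i r}) hi,
      fun r h1 h2 => Nat.sInf_le ⟨h1, h2⟩⟩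
  refine Finset.card_le_card_of_injOn (fun i => R i + 1 - t.length) ?_ ?_
  · intro i hi
    simp only [Finset.coe_filter, Set.mem_ofPred_eq] at hi ⊢
    obtain ⟨⟨h1, h2⟩, -⟩ := hR i hi.2
    have hpa := palAt_of_mem_occur ht hp hi.1
    have hs := h2.sub_reflect hpa le_rfl h1.le
    have hb := bounds_of_mem_occur ht hi.1
    rw [(mem_occur ht).1 hi.1, show i + R i - i = R i by omega,
      show i + R i - (i + t.length - 1) = R i + 1 - t.length by omega] at hs
    have e : R i + 1 - t.length + t.length - 1 = R i := by omega
    refine ⟨(mem_occur ht).2 ?_, i, by omega, ?_⟩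
    · rw [e, hs]
    · rw [e]; exact h2
  · intro i hi i' hi' he
    simp only [Finset.coe_filter, Set.mem_ofPred_eq] at hi hi' he
    wlog hlt : i < i' generalizing i i'
    · rcases lt_or_eq_of_le (not_lt.1 hlt) with h | h
      · exact (this he.symm hi' hi h).symm
      · exact h.symm
    obtain ⟨⟨h1, h2⟩, h3⟩ := hR i hi.2
    obtain ⟨⟨h1', h2'⟩, -⟩ := hR i' hi'.2
    have hb := bounds_of_mem_occur ht hi.1
    have hee : R i = R i' := by omega
    rw [← hee] at h2' h1'
    have hr := h2.reflect h2' hlt.le le_rfl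
    rw [show i + R i - R i = i by omega] at hr
    have := h3 (i + R i - i') (by omega) hr
    omega

/-- Both directions share the counters of the nodes. -/
theorem precnt_eq_sufcnt {s t : List (Fin σ)} (ht : t ≠ []) (hp : t.Palindrome) :
    precnt s t = sufcnt s t := by
  refine le_antisymm ?_ (sufcnt_le_precnt ht hp)
  have := sufcnt_le_precnt (s := s.reverse) ht hp
  rwa [sufcnt_reverse, precnt_reverse] at this

/-! ### Longest palindromic suffixes and suffix links -/

/-- `x` is the longest palindromic suffix of `s`. -/
def IsLongestSuffix (s x : List (Fin σ)) : Prop :=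
  x.Palindrome ∧ x <:+ s ∧ ∀ y, y.Palindrome → y <:+ s → y.length ≤ x.length

theorem IsLongestSuffix.eq {s x y : List (Fin σ)} (hx : IsLongestSuffix s x)
    (hy : IsLongestSuffix s y) : x = y := by
  have h : x.length = y.length := le_antisymm (hy.2.2 x hx.1 hx.2.1) (hx.2.2 y hy.1 hy.2.1)
  rw [List.suffix_iff_eq_drop.1 hx.2.1, List.suffix_iff_eq_drop.1 hy.2.1, h]

theorem sub_suffix_eq {s y : List (Fin σ)} (hy : y ≠ []) (h : y <:+ s) :
    sub s (s.length + 1 - y.length) s.length = y := by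
  have hl := List.length_pos_iff.2 hy
  have := h.length_le
  rw [sub_eq (by omega) (by omega) le_rfl, List.take_length]
  conv_rhs => rw [List.suffix_iff_eq_drop.1 h]
  congr 1; omega

theorem palAt_suffix {s y : List (Fin σ)} (hy : y ≠ []) (hp : y.Palindrome) (h : y <:+ s) :
    PalAt s (s.length + 1 - y.length) s.length := by
  have hl := List.length_pos_iff.2 hy
  have := h.length_le
  exact palAt_iff.2 ⟨⟨by omega, by omega, le_rfl⟩, (sub_suffix_eq hy h).symm ▸ hp⟩

theorem isLongestSuffix_sufpal (s : List (Fin σ)) : IsLongestSuffix s (sufpal s s.length) := by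
  by_cases hs : s = []
  · subst hs
    refine ⟨List.Palindrome.nil, List.nil_suffix, fun y _ hy => ?_⟩
    have := hy.length_le
    simp at this
    simp [this]
  · have hl : 1 ≤ s.length := List.length_pos_iff.2 hs
    obtain ⟨h1, h2, h3⟩ := suflen_spec hl le_rfl
    refine ⟨(palAt_iff.1 h3).2, ?_, fun y hy hys => ?_⟩
    · unfold sufpal
      rw [sub_eq h3.1 h3.2.1 h3.2.2.1, List.take_length]
      exact List.drop_suffix _ _
    · by_cases hy0 : y = []
      · subst hy0; simp
      · have := (palAt_suffix hy0 hy hys).le_suflen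
        have hb := hys.length_le
        unfold sufpal
        rw [length_sub h3.1 h3.2.1 h3.2.2.1]
        omega

theorem IsLongestSuffix.sufpal_eq {s x : List (Fin σ)} (h : IsLongestSuffix s x) :
    sufpal s s.length = x := (isLongestSuffix_sufpal s).eq h

theorem IsLongestSuffix.ne_nil {s x : List (Fin σ)} (h : IsLongestSuffix s x) (hs : s ≠ []) :
    x ≠ [] := by
  rintro rfl
  have := h.2.2 [s.getLast hs] (List.Palindrome.singleton _)
    (List.suffix_iff_eq_append.2 (by simp))
  simp at this

theorem IsLongestSuffix.sufStart_eq {s x : List (Fin σ)} (h : IsLongestSuffix s x) (hs : s ≠ []) :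
    sufStart s = s.length + 1 - x.length := by
  have hl : 1 ≤ s.length := List.length_pos_iff.2 hs
  obtain ⟨h1, h2, h3⟩ := suflen_spec hl le_rfl
  have := length_sub h3.1 h3.2.1 h3.2.2.1
  unfold sufStart
  rw [← h.sufpal_eq]
  unfold sufpal
  rw [this]; omega

/-- The longest proper palindromic suffix of a non-empty string. -/
def linkStr (t : List (Fin σ)) : List (Fin σ) := t.drop (t.length - linkLen t)

theorem link_pal {t : List (Fin σ)} (ht : t ≠ []) : link (.pal t) = .pal (linkStr t) := if_neg ht

theorem linkStr_cons {a : Fin σ} {l z : List (Fin σ)} (h : IsLongestSuffix l z) :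
    linkStr (a :: l) = z := by
  have key : ∀ k, k ≤ l.length → (a :: l).drop ((a :: l).length - k) = l.drop (l.length - k) := by
    intro k hk
    rw [List.length_cons, Nat.succ_sub hk, List.drop_succ_cons]
  have hz := h.2.1.length_le
  have hlen : linkLen (a :: l) = z.length := by
    refine le_antisymm (Finset.sup_le fun k hk => ?_) ?_
    · simp only [Finset.mem_filter, Finset.mem_range, List.length_cons] at hk
      have hk1 : k ≤ l.length := by omega
      have := h.2.2 (l.drop (l.length - k))
        (by rw [← key k hk1]; exact hk.2) (List.drop_suffix _ _)
      rw [List.length_drop] at this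
      simp only [id]; omega
    · refine Finset.le_sup (f := id) (Finset.mem_filter.2
        ⟨Finset.mem_range.2 (by simp; omega), ?_⟩)
      rw [key _ hz, ← List.suffix_iff_eq_drop.1 h.2.1]
      exact h.1
  unfold linkStr
  rw [hlen, key _ hz, ← List.suffix_iff_eq_drop.1 h.2.1]

theorem linkStr_spec {t : List (Fin σ)} (ht : t ≠ []) :
    (linkStr t).Palindrome ∧ linkStr t <:+ t ∧ (linkStr t).length < t.length ∧
      ∀ y, y.Palindrome → y <:+ t → y.length < t.length → y.length ≤ (linkStr t).length := by
  obtain ⟨a, l, rfl⟩ := List.exists_cons_of_ne_nil ht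
  have h := isLongestSuffix_sufpal l
  rw [linkStr_cons h]
  refine ⟨h.1, h.2.1.trans (List.suffix_cons _ _), ?_, fun y h1 h2 h3 => h.2.2 y h1 ?_⟩
  · have := h.2.1.length_le; simp; omega
  · exact List.suffix_of_suffix_length_le h2 (List.suffix_cons _ _) (by
      simp at h3; omega)

theorem linkStr_ne_nil {t : List (Fin σ)} (ht : 2 ≤ t.length) : linkStr t ≠ [] := by
  match t, ht with
  | a :: b :: l, _ =>
    rw [linkStr_cons (isLongestSuffix_sufpal (b :: l))]
    exact (isLongestSuffix_sufpal (b :: l)).ne_nil (by simp)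

/-- A palindromic suffix of a palindrome is also a prefix. -/
theorem prefix_of_palindrome {t y : List (Fin σ)} (ht : t.Palindrome) (hy : y.Palindrome)
    (h : y <:+ t) : y <+: t := by
  rw [← ht.reverse_eq, ← hy.reverse_eq]
  exact List.reverse_prefix.2 h

/-- `o` is the longest palindromic suffix of `s` that is preceded by the character `c` in `s`,
or `none` if there is no such suffix (the empty one included). -/
def IsLongestBefore (s : List (Fin σ)) (c : Fin σ) : Option (List (Fin σ)) → Prop
  | none => ∀ y, y.Palindrome → ¬ (c :: y) <:+ s
  | some y => y.Palindrome ∧ (c :: y) <:+ s ∧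
      ∀ y', y'.Palindrome → (c :: y') <:+ s → y'.length ≤ y.length

/-- The node of an optional palindrome; `none` stands for the root `odd`. -/
def Node.ofOption : Option (List (Fin σ)) → Node σ
  | none => .odd
  | some y => .pal y

theorem palindrome_wrap {o : Option (List (Fin σ))} (ho : ∀ y ∈ o, y.Palindrome) (c : Fin σ) :
    ((Node.ofOption o).wrap c).Palindrome := by
  cases o with
  | none => exact List.Palindrome.singleton c
  | some y => exact List.Palindrome.cons_concat c (ho y rfl)

theorem IsLongestBefore.palindrome {s : List (Fin σ)} {c : Fin σ} {o : Option (List (Fin σ))}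
    (h : IsLongestBefore s c o) : ∀ y ∈ o, y.Palindrome := by
  rintro y rfl
  exact h.1

theorem suffix_append_palindrome {s y : List (Fin σ)} {c : Fin σ} (hp : y.Palindrome)
    (h : y <:+ s ++ [c]) (hy : y ≠ []) :
    y = [c] ∨ ∃ z, z.Palindrome ∧ y = c :: (z ++ [c]) ∧ (c :: z) <:+ s := by
  cases hp with
  | nil => exact absurd rfl hy
  | singleton x =>
    left
    rcases List.suffix_concat_iff.1 h with h | ⟨t, h1, _⟩
    · simp at h
    · cases t with
      | nil => simpa using h1
      | cons a t => simp at h1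
  | @cons_concat x l hl =>
    right
    rcases List.suffix_concat_iff.1 h with h | ⟨t, h1, h2⟩
    · simp at h
    · have h1' : (x :: l) ++ [x] = t ++ [c] := by simpa using h1
      obtain ⟨h3, h4⟩ := List.append_inj' h1' rfl
      obtain rfl : x = c := by simpa using h4
      exact ⟨l, hl, rfl, h3 ▸ h2⟩

/-- The longest palindromic suffix of `s c` arises from the longest palindromic suffix of `s`
preceded by `c`. -/
theorem isLongestSuffix_append {s : List (Fin σ)} {c : Fin σ} {o : Option (List (Fin σ))}
    (h : IsLongestBefore s c o) : IsLongestSuffix (s ++ [c]) ((Node.ofOption o).wrap c) := by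
  refine ⟨palindrome_wrap h.palindrome c, ?_, fun y hy hys => ?_⟩
  · cases o with
    | none => exact List.suffix_append s [c]
    | some y =>
      obtain ⟨a, ha⟩ := h.2.1
      exact ⟨a, by simp [Node.ofOption, Node.wrap, ← ha]⟩
  · by_cases hy0 : y = []
    · subst hy0; simp
    rcases suffix_append_palindrome hy hys hy0 with rfl | ⟨z, hz, rfl, hzs⟩
    · cases o <;> simp [Node.ofOption, Node.wrap]
    · cases o with
      | none => exact absurd hzs (h z hz)
      | some y =>
        have := h.2.2 z hz hzs
        simp [Node.ofOption, Node.wrap, this]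

/-- The suffix link of `c y c` arises in the same way from `y`. -/
theorem linkStr_wrap {y : List (Fin σ)} {c : Fin σ} {o : Option (List (Fin σ))}
    (h : IsLongestBefore y c o) :
    linkStr (c :: (y ++ [c])) = (Node.ofOption o).wrap c :=
  linkStr_cons (isLongestSuffix_append h)

theorem linkStr_singleton (c : Fin σ) : linkStr [c] = [] :=
  linkStr_cons ⟨List.Palindrome.nil, List.nil_suffix, fun _ _ h => h.length_le⟩

theorem IsLongestBefore.of_longestSuffix {s v : List (Fin σ)} {c : Fin σ}
    {o : Option (List (Fin σ))} (hv : IsLongestSuffix s v) (h : ¬ (c :: v) <:+ s)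
    (ho : IsLongestBefore v c o) : IsLongestBefore s c o := by
  have key : ∀ y : List (Fin σ), y.Palindrome → (c :: y) <:+ s → (c :: y) <:+ v := by
    intro y hy hys
    have h1 := hv.2.2 y hy ((List.suffix_cons _ _).trans hys)
    rcases lt_or_eq_of_le h1 with h2 | h2
    · exact List.suffix_of_suffix_length_le hys hv.2.1 (by simpa using h2)
    · refine absurd ?_ h
      have : y = v := by
        rw [List.suffix_iff_eq_drop.1 hv.2.1,
          List.suffix_iff_eq_drop.1 ((List.suffix_cons c y).trans hys), h2]
      rwa [← this]
  cases o with
  | none => exact fun y hy hys => ho y hy (key y hy hys)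
  | some y => exact ⟨ho.1, ho.2.1.trans hv.2.1, fun y' h1 h2 => ho.2.2 y' h1 (key y' h1 h2)⟩

theorem IsLongestBefore.self {s v : List (Fin σ)} {c : Fin σ}
    (hv : IsLongestSuffix s v) (h : (c :: v) <:+ s) : IsLongestBefore s c (some v) :=
  ⟨hv.1, h, fun y hy hys => hv.2.2 y hy ((List.suffix_cons _ _).trans hys)⟩

/-- The answers for a palindrome `x` agree with those for its suffix link `z`, except for the
character `b` that precedes `z`. -/
theorem isLongestBefore_of_link {x : List (Fin σ)} {b c : Fin σ} {o : Option (List (Fin σ))}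
    (hx : x ≠ []) (hb : (b :: linkStr x) <:+ x)
    (ho : IsLongestBefore (linkStr x) c o) :
    IsLongestBefore x c (if c = b then some (linkStr x) else o) := by
  obtain ⟨h1, h2, h3, h4⟩ := linkStr_spec hx
  have hlen : ∀ y : List (Fin σ), y.Palindrome → (c :: y) <:+ x →
      y.length ≤ (linkStr x).length := fun y hy hys =>
    h4 y hy ((List.suffix_cons _ _).trans hys) (by have := hys.length_le; simp at this; omega)
  split_ifs with hcb
  · subst hcb
    exact ⟨h1, hb, hlen⟩
  · have key : ∀ y : List (Fin σ), y.Palindrome → (c :: y) <:+ x → (c :: y) <:+ linkStr x := by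
      intro y hy hys
      rcases lt_or_eq_of_le (hlen y hy hys) with h | h
      · exact List.suffix_of_suffix_length_le hys h2 (by simpa using h)
      · have e : c :: y = b :: linkStr x := by
          rw [List.suffix_iff_eq_drop.1 hys, List.suffix_iff_eq_drop.1 hb]
          simp [h]
        exact absurd (List.cons.inj e).1 hcb
    cases o with
    | none => exact fun y hy hys => ho y hy (key y hy hys)
    | some y => exact ⟨ho.1, ho.2.1.trans h2, fun y' h1 h2 => ho.2.2 y' h1 (key y' h1 h2)⟩

/-! ### Distinct palindromic substrings and their counters -/

theorem finite_palSubstrings (s : List (Fin σ)) : (palSubstrings s).Finite := by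
  refine (List.finite_toSet s.sublists).subset fun t ht => ?_
  exact List.mem_sublists.2 ht.2.sublist

theorem nil_mem_palSubstrings (s : List (Fin σ)) : [] ∈ palSubstrings s :=
  ⟨List.Palindrome.nil, List.nil_infix⟩

theorem IsLongestSuffix.mem_palSubstrings {s x : List (Fin σ)} (h : IsLongestSuffix s x) :
    x ∈ palSubstrings s := ⟨h.1, h.2.1.isInfix⟩

/-- A proper palindromic suffix of the longest palindromic suffix `x` of `s c` is also a prefix
of `x`, so it occurs in `s`. -/
theorem mem_palSubstrings_of_proper {s x t : List (Fin σ)} {c : Fin σ}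
    (hx : IsLongestSuffix (s ++ [c]) x) (ht : t.Palindrome) (hts : t <:+ x)
    (hlt : t.length < x.length) : t ∈ palSubstrings s := by
  refine ⟨ht, ?_⟩
  obtain ⟨r, hr⟩ := prefix_of_palindrome hx.1 ht hts
  obtain ⟨a, ha⟩ := hx.2.1
  have hr0 : r ≠ [] := by rintro rfl; rw [← hr] at hlt; simp at hlt
  obtain ⟨r', d, rfl⟩ : ∃ r' d, r = r' ++ [d] := ⟨r.dropLast, r.getLast hr0,
    (List.dropLast_append_getLast hr0).symm⟩
  have : (a ++ t ++ r') ++ [d] = s ++ [c] := by rw [← ha, ← hr]; simp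
  obtain ⟨h1, -⟩ := List.append_inj' this rfl
  exact ⟨a, r', h1⟩

theorem palSubstrings_append {s x : List (Fin σ)} {c : Fin σ}
    (hx : IsLongestSuffix (s ++ [c]) x) :
    palSubstrings (s ++ [c]) = insert x (palSubstrings s) := by
  ext t
  constructor
  · rintro ⟨ht, hts⟩
    rcases List.infix_concat_iff.1 hts with h | h
    · rcases lt_or_eq_of_le (hx.2.2 t ht h) with hlt | he
      · exact Or.inr (mem_palSubstrings_of_proper hx ht
          (List.suffix_of_suffix_length_le h hx.2.1 hlt.le) hlt)
      · left
        rw [List.suffix_iff_eq_drop.1 h, List.suffix_iff_eq_drop.1 hx.2.1, he]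
    · exact Or.inr ⟨ht, h⟩
  · rintro (rfl | ⟨ht, hts⟩)
    · exact hx.mem_palSubstrings
    · exact ⟨ht, hts.trans (List.prefix_append _ _).isInfix⟩

/-- The number of non-empty palindromic substrings of `s` whose suffix link is `t`. -/
noncomputable def linkCount (s t : List (Fin σ)) : ℕ :=
  {u | u ∈ palSubstrings s ∧ u ≠ [] ∧ linkStr u = t}.ncard

theorem finite_linkCount (s t : List (Fin σ)) :
    {u | u ∈ palSubstrings s ∧ u ≠ [] ∧ linkStr u = t}.Finite :=
  (finite_palSubstrings s).subset fun _ h => h.1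

theorem linkCount_reverse (s t : List (Fin σ)) : linkCount s.reverse t = linkCount s t := by
  unfold linkCount; rw [palSubstrings_reverse]

theorem linkCount_append {s x : List (Fin σ)} {c : Fin σ}
    (hx : IsLongestSuffix (s ++ [c]) x) (hn : x ∉ palSubstrings s) (t : List (Fin σ)) :
    linkCount (s ++ [c]) t = linkCount s t + if t = linkStr x then 1 else 0 := by
  unfold linkCount
  rw [palSubstrings_append hx]
  have hx0 := hx.ne_nil (by simp)
  split_ifs with h
  · rw [← Set.ncard_insert_of_notMem (a := x) (fun h' => hn h'.1) (finite_linkCount s t)]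
    congr 1
    ext u
    simp only [Set.mem_insert_iff, Set.mem_ofPred_eq]
    constructor
    · rintro ⟨rfl | h1, h2⟩
      · exact Or.inl rfl
      · exact Or.inr ⟨h1, h2⟩
    · rintro (rfl | h1)
      · exact ⟨Or.inl rfl, hx0, h.symm⟩
      · exact ⟨Or.inr h1.1, h1.2⟩
  · congr 1
    ext u
    simp only [Set.mem_insert_iff, Set.mem_ofPred_eq]
    constructor
    · rintro ⟨rfl | h1, h2⟩
      · exact absurd h2.2.symm h
      · exact ⟨h1, h2⟩
    · exact fun h1 => ⟨Or.inr h1.1, h1.2⟩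

theorem palSubstrings_append_of_mem {s x : List (Fin σ)} {c : Fin σ}
    (hx : IsLongestSuffix (s ++ [c]) x) (hm : x ∈ palSubstrings s) :
    palSubstrings (s ++ [c]) = palSubstrings s := by
  rw [palSubstrings_append hx, Set.insert_eq_of_mem hm]

theorem linkCount_append_self {s x : List (Fin σ)} {c : Fin σ}
    (hx : IsLongestSuffix (s ++ [c]) x) : linkCount (s ++ [c]) x = linkCount s x := by
  by_cases h : x ∈ palSubstrings s
  · unfold linkCount; rw [palSubstrings_append_of_mem hx h]
  · rw [linkCount_append hx h, if_neg, add_zero]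
    intro he
    have := (linkStr_spec (hx.ne_nil (by simp))).2.2.1
    rw [← he] at this
    exact lt_irrefl _ this

theorem sufpal_append {s : List (Fin σ)} {c : Fin σ} {i : ℕ} (hi : i ≤ s.length) :
    sufpal (s ++ [c]) i = sufpal s i := by
  have : suflen (s ++ [c]) i = suflen s i := by
    unfold suflen
    congr 1
    exact Finset.filter_congr fun l _ => by rw [sub_append hi]
  unfold sufpal
  rw [this, sub_append hi]

theorem sufcnt_append {s x : List (Fin σ)} {c : Fin σ}
    (hx : IsLongestSuffix (s ++ [c]) x) (t : List (Fin σ)) :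
    sufcnt (s ++ [c]) t = sufcnt s t + if t = x then 1 else 0 := by
  unfold sufcnt
  have hl : (s ++ [c]).length = s.length + 1 := by simp
  have hi : Finset.Icc 1 (s.length + 1) = insert (s.length + 1) (Finset.Icc 1 s.length) := by
    ext i; simp only [Finset.mem_insert, Finset.mem_Icc]; omega
  have hlast : sufpal (s ++ [c]) (s.length + 1) = x := by rw [← hl]; exact hx.sufpal_eq
  have hc : (Finset.Icc 1 s.length).filter (fun i => sufpal (s ++ [c]) i = t) =
      (Finset.Icc 1 s.length).filter (fun i => sufpal s i = t) :=
    Finset.filter_congr fun i hi => by rw [sufpal_append (Finset.mem_Icc.1 hi).2]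
  rw [hl, hi, Finset.filter_insert, hc, hlast]
  split_ifs with h1 h2 h2
  · rw [Finset.card_insert_of_notMem (by simp)]
  · exact absurd h1.symm h2
  · exact absurd h2.symm h1
  · rfl

/-- The suffix link of a non-empty palindrome `t` counts some node if and only if some occurrence
of `t` is a proper suffix of a palindromic substring. -/
theorem linkCount_pos_iff {s t : List (Fin σ)} (ht : t ≠ []) (hp : t.Palindrome) :
    0 < linkCount s t ↔ ∃ i ∈ occur s t, ∃ l, l < i ∧ PalAt s l (i + t.length - 1) := by
  have hl := List.length_pos_iff.2 ht
  unfold linkCount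
  rw [Set.ncard_pos (finite_linkCount s t)]
  constructor
  · rintro ⟨u, hu, hu0, rfl⟩
    obtain ⟨h1, h2, h3, h4⟩ := linkStr_spec hu0
    obtain ⟨b, hb⟩ := (infix_iff_occur hu0).1 hu.2
    have hpb := palAt_of_mem_occur hu0 hu.1 hb
    have hbb := bounds_of_mem_occur hu0 hb
    have hsub := (mem_occur hu0).1 hb
    refine ⟨b + u.length - (linkStr u).length, (mem_occur ht).2 ?_, b, by omega, ?_⟩
    · rw [show b + u.length - (linkStr u).length + (linkStr u).length - 1 = b + u.length - 1
        by omega]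
      have hsuf : sub s (b + u.length - (linkStr u).length) (b + u.length - 1) <:+ u := by
        conv_rhs => rw [← hsub]
        rw [sub_eq hbb.1 hbb.2.1 hbb.2.2, sub_eq (by omega) (by omega) hbb.2.2]
        have e : b + u.length - (linkStr u).length - 1 =
            (b - 1) + (u.length - (linkStr u).length) := by omega
        rw [e, ← List.drop_drop]
        exact List.drop_suffix _ _
      rw [List.suffix_iff_eq_drop.1 hsuf, length_sub (by omega) (by omega) hbb.2.2]
      conv_rhs => rw [List.suffix_iff_eq_drop.1 h2]
      congr 1; omega
    · rw [show b + u.length - (linkStr u).length + (linkStr u).length - 1 = b + u.length - 1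
        by omega]
      exact hpb
  · rintro ⟨i, hi, hex⟩
    -- the shortest palindrome of which the occurrence of `t` is a proper suffix
    have hb := bounds_of_mem_occur ht hi
    set j := i + t.length - 1 with hj
    obtain ⟨l, ⟨hli, hlj⟩, hmin⟩ : ∃ l, (l < i ∧ PalAt s l j) ∧
        ∀ l', l < l' → l' < i → ¬ PalAt s l' j := by
      classical
      obtain ⟨l, hl⟩ := hex
      have hne : ((Finset.range i).filter fun l => PalAt s l j).Nonempty :=
        ⟨l, Finset.mem_filter.2 ⟨Finset.mem_range.2 hl.1, hl.2⟩⟩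
      have hm := Finset.max'_mem _ hne
      rw [Finset.mem_filter, Finset.mem_range] at hm
      refine ⟨_, hm, fun l' h1 h2 h3 => ?_⟩
      have := Finset.le_max' ((Finset.range i).filter fun l => PalAt s l j) l'
        (Finset.mem_filter.2 ⟨Finset.mem_range.2 h2, h3⟩)
      omega
    have hlb := hlj.1
    set u := sub s l j with hu
    have hul : u.length = j + 1 - l := length_sub hlj.1 hlj.2.1 hlj.2.2.1
    have hu0 : u ≠ [] := sub_ne_nil hlj.1 hlj.2.1 hlj.2.2.1
    have hdrop : ∀ k, l ≤ k → k ≤ j → sub s k j = u.drop (k - l) := by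
      intro k hk hkj
      rw [hu, sub_eq hlj.1 hlj.2.1 hlj.2.2.1, sub_eq (by omega) hkj hlj.2.2.1, List.drop_drop]
      congr 1; omega
    refine ⟨u, ⟨(palAt_iff.1 hlj).2, sub_infix _ _ _⟩, hu0, ?_⟩
    have htu : t = u.drop (i - l) := by
      rw [← hdrop i hli.le (by omega)]; exact ((mem_occur ht).1 hi).symm
    obtain ⟨h1, h2, h3, h4⟩ := linkStr_spec hu0
    have h5 := h4 t hp (by rw [htu]; exact List.drop_suffix _ _) (by omega)
    have h6 : t.length = (linkStr u).length := by
      by_contra hne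
      have e : linkStr u = u.drop (j + 1 - (linkStr u).length - l) := by
        conv_lhs => rw [List.suffix_iff_eq_drop.1 h2, hul]
        congr 1; omega
      refine hmin (j + 1 - (linkStr u).length) (by omega) (by omega)
        (palAt_iff.2 ⟨⟨by omega, by omega, hlj.2.2.1⟩, ?_⟩)
      rw [hdrop _ (by omega) (by omega), ← e]
      exact h1
    rw [List.suffix_iff_eq_drop.1 h2, htu, ← h6, hul]
    congr 1; omega

/-- An occurrence of `t` either ends at a position where `t` is the longest palindrome, or it is a
proper suffix of a palindrome, in which case some node has the suffix link `t`. -/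
theorem exists_card_occur {s t : List (Fin σ)} (ht : t ≠ []) (hp : t.Palindrome) :
    ∃ k, (occur s t).card = k + sufcnt s t ∧ (0 < k ↔ 0 < linkCount s t) := by
  classical
  refine ⟨((occur s t).filter fun i => ∃ l, l < i ∧ PalAt s l (i + t.length - 1)).card, ?_, ?_⟩
  · rw [sufcnt_eq_card ht hp, Finset.card_filter_add_card_filter_not]
  · rw [linkCount_pos_iff ht hp, Finset.card_pos, Finset.filter_nonempty_iff]

/-- The counters of a node tell whether its palindrome occurs in the string. -/
theorem mem_palSubstrings_iff {s t : List (Fin σ)} (ht : t ≠ []) (hp : t.Palindrome) :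
    t ∈ palSubstrings s ↔ 0 < sufcnt s t + linkCount s t := by
  have h1 : t ∈ palSubstrings s ↔ 0 < (occur s t).card := by
    rw [Finset.card_pos, ← infix_iff_occur ht]
    exact ⟨fun h => h.2, fun h => ⟨hp, h⟩⟩
  obtain ⟨k, h2, h3⟩ := exists_card_occur (s := s) ht hp
  rw [h1, h2]
  omega

theorem isUnique_iff {s t : List (Fin σ)} (ht : t ≠ []) (hp : t.Palindrome)
    (h : 0 < sufcnt s t) : IsUnique s t ↔ sufcnt s t + linkCount s t = 1 := by
  obtain ⟨k, h2, h3⟩ := exists_card_occur (s := s) ht hp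
  unfold IsUnique
  rw [h2]
  omega

theorem sufcnt_pos_of_suffix {s x : List (Fin σ)} (hs : s ≠ []) (h : IsLongestSuffix s x) :
    0 < sufcnt s x := by
  refine Finset.card_pos.2 ⟨s.length, Finset.mem_filter.2 ⟨Finset.mem_Icc.2 ?_, h.sufpal_eq⟩⟩
  have : 1 ≤ s.length := List.length_pos_iff.2 hs
  omega

end Eertree

namespace WordRAM

/-! ### Determinism of the word RAM -/

theorem Exec.deterministic {w : ℕ} {P : Prog} {κ κ₁ : Config} {t₁ : ℕ} (h₁ : Exec w P κ t₁ κ₁) :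
    ∀ {t₂ : ℕ} {κ₂ : Config}, Exec w P κ t₂ κ₂ → t₁ = t₂ ∧ κ₁ = κ₂ := by
  induction h₁ with
  | skip | const | move | add | sub | load | store => intro _ _ h₂; cases h₂; exact ⟨rfl, rfl⟩
  | seq _ _ ih₁ ih₂ =>
    intro _ _ h₂
    cases h₂ with
    | seq g₁ g₂ =>
      obtain ⟨rfl, rfl⟩ := ih₁ g₁
      obtain ⟨rfl, rfl⟩ := ih₂ g₂
      exact ⟨rfl, rfl⟩
  | ite_true hT _ ih =>
    intro _ _ h₂
    cases h₂ with
    | ite_true _ g => obtain ⟨rfl, rfl⟩ := ih g; exact ⟨rfl, rfl⟩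
    | ite_false hF _ => exact absurd hT hF
  | ite_false hF _ ih =>
    intro _ _ h₂
    cases h₂ with
    | ite_false _ g => obtain ⟨rfl, rfl⟩ := ih g; exact ⟨rfl, rfl⟩
    | ite_true hT _ => exact absurd hT hF
  | loop_true hT _ _ ih₁ ih₂ =>
    intro _ _ h₂
    cases h₂ with
    | loop_true _ g₁ g₂ =>
      obtain ⟨rfl, rfl⟩ := ih₁ g₁
      obtain ⟨rfl, rfl⟩ := ih₂ g₂
      exact ⟨rfl, rfl⟩
    | loop_false hF => exact absurd hT hF
  | loop_false hF =>
    intro _ _ h₂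
    cases h₂ with
    | loop_true hT _ _ => exact absurd hT hF
    | loop_false _ => exact ⟨rfl, rfl⟩

theorem Runs.deterministic {w : ℕ} {P : Prog} {args : List ℕ} {m m₁ m₂ : Memory}
    {t₁ t₂ r₁ r₂ : ℕ} (h₁ : Runs w P args m t₁ r₁ m₁) (h₂ : Runs w P args m t₂ r₂ m₂) :
    t₁ = t₂ ∧ r₁ = r₂ ∧ m₁ = m₂ := by
  obtain ⟨R₁, h₁, rfl⟩ := h₁
  obtain ⟨R₂, h₂, rfl⟩ := h₂
  obtain ⟨h, h'⟩ := h₁.deterministic h₂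
  injection h' with h3 h4
  subst h3
  exact ⟨h, rfl, h4⟩

/-! ### A structured language over the integers -/

/-- The word that represents the integer `x` modulo `2 ^ w`. -/
def word (w : ℕ) (x : ℤ) : ℕ := (x % 2 ^ w).toNat

theorem cast_word (w : ℕ) (x : ℤ) : (word w x : ℤ) = x % 2 ^ w :=
  Int.toNat_of_nonneg (Int.emod_nonneg _ (by positivity))

theorem word_lt (w : ℕ) (x : ℤ) : word w x < 2 ^ w := by
  have := Int.emod_lt_of_pos x (b := 2 ^ w) (by positivity)
  rw [← cast_word] at this
  exact_mod_cast this

theorem word_of_lt {w : ℕ} {x : ℤ} (h0 : 0 ≤ x) (h1 : x < 2 ^ w) : (word w x : ℤ) = x := by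
  rw [cast_word, Int.emod_eq_of_lt h0 h1]

theorem word_natCast (w k : ℕ) : word w k = k % 2 ^ w := by
  have h := cast_word w k
  exact_mod_cast h

theorem word_natCast_of_lt {w k : ℕ} (h : k < 2 ^ w) : word w k = k := by
  rw [word_natCast, Nat.mod_eq_of_lt h]

theorem word_add (w : ℕ) (x y : ℤ) : (word w x + word w y) % 2 ^ w = word w (x + y) := by
  have : (((word w x + word w y) % 2 ^ w : ℕ) : ℤ) = (word w (x + y) : ℤ) := by
    push_cast
    rw [cast_word, cast_word, cast_word, ← Int.add_emod]
  exact_mod_cast this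

theorem word_sub (w : ℕ) (x y : ℤ) :
    (word w x + (2 ^ w - word w y)) % 2 ^ w = word w (x - y) := by
  have hy := (word_lt w y).le
  have : (((word w x + (2 ^ w - word w y)) % 2 ^ w : ℕ) : ℤ) = (word w (x - y) : ℤ) := by
    push_cast [Nat.cast_sub hy]
    rw [cast_word, cast_word, cast_word]
    rw [show x % 2 ^ w + (2 ^ w - y % 2 ^ w) = (x % 2 ^ w - y % 2 ^ w) + 2 ^ w by ring,
      Int.add_emod_right, ← Int.sub_emod]
  exact_mod_cast this

/-- Programs of a small language on top of the word RAM.  Its registers and cells hold integers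
(represented modulo `2 ^ w`).  The memory is divided into blocks of `32` cells: the field `f` of
the block `k` is the cell `32 k + f`.  The fields `6, …, 11` of all blocks hold three arrays that
are indexed by integers (positions), see `posAddr`. -/
inductive Code where
  | skip
  /-- `R[d] ← k` -/
  | const (d k : ℕ)
  /-- `R[d] ← R[a]` -/
  | move (d a : ℕ)
  /-- `R[d] ← R[a] + R[b]` -/
  | add (d a b : ℕ)
  /-- `R[d] ← R[a] - R[b]` -/
  | sub (d a b : ℕ)
  /-- `R[d] ←` field `f` of the block `R[a]` -/
  | ld (f d a : ℕ)
  /-- field `f` of the block `R[a]` `← R[b]` -/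
  | st (f a b : ℕ)
  /-- `R[d] ←` entry of the array `f` at the position `R[a]`, or `1 - R[a]` if `v` is true -/
  | pld (f : ℕ) (v : Bool) (d a : ℕ)
  /-- entry of the array `f` at the position `R[a]`, or `1 - R[a]` if `v` is true, `← R[b]` -/
  | pst (f : ℕ) (v : Bool) (a b : ℕ)
  /-- access the last cell of the block `R[a]` -/
  | touch (a : ℕ)
  | seq (P Q : Code)
  | ite (T : Test) (P Q : Code)
  /-- repeat `P` exactly `R[a]` times -/
  | iter (a : ℕ) (P : Code)

/-- A state of the structured language; `lo` is a number such that all cells of the first `lo`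
blocks count as used. -/
structure St where
  reg : ℕ → ℤ
  fld : ℕ → ℤ → ℤ
  pos : ℕ → ℤ → ℤ
  lo : ℤ

/-- The fields of a block that are not used by the position arrays. -/
def IsField (f : ℕ) : Prop := f < 6 ∨ (12 ≤ f ∧ f < 31)

instance (f : ℕ) : Decidable (IsField f) := by unfold IsField; infer_instance

/-- The reflection `p ↦ 1 - p` of the positions if `v` is true. -/
def view (v : Bool) (p : ℤ) : ℤ := if v then 1 - p else p

namespace St

/-- Assign a register. -/
def setReg (s : St) (d : ℕ) (x : ℤ) : St := { s with reg := Function.update s.reg d x }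

/-- Assign a field of a block. -/
def setFld (s : St) (f : ℕ) (k x : ℤ) : St :=
  { s with fld := Function.update s.fld f (Function.update (s.fld f) k x) }

/-- Assign an entry of a position array. -/
def setPos (s : St) (f : ℕ) (p x : ℤ) : St :=
  { s with pos := Function.update s.pos f (Function.update (s.pos f) p x) }

/-- Make the first `k` blocks used. -/
def setLo (s : St) (k : ℤ) : St := { s with lo := max s.lo k }

end St

namespace Code

/-- Weakest precondition of `P` for the postcondition `Q`, where `w` is the word size, `B` is a
bound for the addresses of the blocks and `K` is the number of iterations of all loops. -/
def wp (w B K : ℕ) : Code → (St → Prop) → St → Prop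
  | skip, Q, s => Q s
  | const d k, Q, s => Q (s.setReg d k)
  | move d a, Q, s => Q (s.setReg d (s.reg a))
  | add d a b, Q, s => Q (s.setReg d (s.reg a + s.reg b))
  | sub d a b, Q, s => Q (s.setReg d (s.reg a - s.reg b))
  | ld f d a, Q, s => IsField f ∧ (0 ≤ s.reg a ∧ s.reg a < B) ∧ Q (s.setReg d (s.fld f (s.reg a)))
  | st f a b, Q, s => IsField f ∧ (0 ≤ s.reg a ∧ s.reg a < B) ∧ Q (s.setFld f (s.reg a) (s.reg b))
  | pld f v d a, Q, s => f < 3 ∧ (1 - (B : ℤ) < s.reg a ∧ s.reg a < B) ∧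
      Q (s.setReg d (s.pos f (view v (s.reg a))))
  | pst f v a b, Q, s => f < 3 ∧ (1 - (B : ℤ) < s.reg a ∧ s.reg a < B) ∧
      Q (s.setPos f (view v (s.reg a)) (s.reg b))
  | touch a, Q, s => (0 ≤ s.reg a ∧ s.reg a < B) ∧ Q (s.setLo (s.reg a + 1))
  | seq P P', Q, s => wp w B K P (wp w B K P' Q) s
  | ite (.lt a b) P P', Q, s => (0 ≤ s.reg a ∧ s.reg a < 2 ^ w) ∧ (0 ≤ s.reg b ∧ s.reg b < 2 ^ w) ∧
      (s.reg a < s.reg b → wp w B K P Q s) ∧ (¬ s.reg a < s.reg b → wp w B K P' Q s)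
  | ite (.eq a b) P P', Q, s => (0 ≤ s.reg a ∧ s.reg a < 2 ^ w) ∧ (0 ≤ s.reg b ∧ s.reg b < 2 ^ w) ∧
      (s.reg a = s.reg b → wp w B K P Q s) ∧ (¬ s.reg a = s.reg b → wp w B K P' Q s)
  | iter a P, Q, s => s.reg a = K ∧ (wp w B K P)^[K] Q s

/-- Code without loops. -/
def flat : Code → Bool
  | seq P Q => P.flat && Q.flat
  | ite _ P Q => P.flat && Q.flat
  | iter _ _ => false
  | _ => true

/-- Code without nested loops. -/
def wf : Code → Bool
  | seq P Q => P.wf && Q.wf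
  | ite _ P Q => P.wf && Q.wf
  | iter _ P => P.flat
  | _ => true

/-- Code that does not write into the memory. -/
def readOnly : Code → Bool
  | seq P Q => P.readOnly && Q.readOnly
  | ite _ P Q => P.readOnly && Q.readOnly
  | iter _ P => P.readOnly
  | st _ _ _ => false
  | pst _ _ _ _ => false
  | touch _ => false
  | _ => true

/-- An upper bound for the running time if every loop takes `K` iterations. -/
def cost (K : ℕ) : Code → ℕ
  | seq P Q => P.cost K + Q.cost K
  | ite _ P Q => P.cost K + Q.cost K + 1
  | iter _ P => K * (P.cost K + 2) + 4
  | _ => 14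

/-- Compute the address of the field `f` of the block `R[a]` in register `1`. -/
def addr (f a : ℕ) : Prog :=
  .seq (.add 1 a a) (.seq (.add 1 1 1) (.seq (.add 1 1 1) (.seq (.add 1 1 1)
    (.seq (.add 1 1 1) (.seq (.const 2 f) (.add 1 1 2))))))

/-- The field of a block that holds the array `f` for the positive positions (`v = false`) or
for the others (`v = true`). -/
def posFld (f : ℕ) (v : Bool) : ℕ := 6 + 2 * f + v.toNat

/-- Compute the address of an entry of a position array in register `1`. -/
def paddr (f : ℕ) (v : Bool) (a : ℕ) : Prog :=
  .seq (.const 0 0) (.seq (.sub 0 0 a) (.ite (.lt a 0) (addr (posFld f v) a)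
    (.seq (.const 1 1) (.seq (.add 0 0 1) (addr (posFld f !v) 0)))))

/-- Translation to the word RAM: the register `r` becomes register `r + 8`. -/
def compile : Code → Prog
  | skip => .skip
  | const d k => .const (d + 8) k
  | move d a => .move (d + 8) (a + 8)
  | add d a b => .add (d + 8) (a + 8) (b + 8)
  | sub d a b => .sub (d + 8) (a + 8) (b + 8)
  | ld f d a => .seq (addr f (a + 8)) (.load (d + 8) 1)
  | st f a b => .seq (addr f (a + 8)) (.store 1 (b + 8))
  | pld f v d a => .seq (paddr f v (a + 8)) (.load (d + 8) 1)
  | pst f v a b => .seq (paddr f v (a + 8)) (.store 1 (b + 8))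
  | touch a => .seq (addr 31 (a + 8)) (.store 1 1)
  | seq P Q => .seq P.compile Q.compile
  | ite (.lt a b) P Q => .ite (.lt (a + 8) (b + 8)) P.compile Q.compile
  | ite (.eq a b) P Q => .ite (.eq (a + 8) (b + 8)) P.compile Q.compile
  | iter a P => .seq (.const 3 0) (.seq (.move 4 (a + 8)) (.seq (.const 5 1)
      (.loop (.lt 3 4) (.seq P.compile (.add 3 3 5)))))

/-- A callable program: pass two arguments and return the result. -/
def call (P : Code) : Prog :=
  .seq (.move 8 0) (.seq (.move 9 1) (.seq P.compile (.move 0 8)))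

end Code

/-- The address of the entry of the array `f` at position `p`. -/
def posAddr (f : ℕ) (p : ℤ) : ℕ :=
  if 1 ≤ p then 32 * p.toNat + (6 + 2 * f) else 32 * (1 - p).toNat + (7 + 2 * f)

/-- The memory represents the given fields and position arrays. -/
structure MemRel (w : ℕ) (m : Memory) (fld : ℕ → ℤ → ℤ) (pos : ℕ → ℤ → ℤ) (lo : ℤ) : Prop where
  fld : ∀ f, IsField f → ∀ k : ℕ, m.cell (32 * k + f) = word w (fld f k)
  pos : ∀ f < 3, ∀ p, m.cell (posAddr f p) = word w (pos f p)
  lo : 32 * lo ≤ m.used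

/-- The configuration represents the state. -/
structure Rel (w : ℕ) (κ : Config) (s : St) : Prop where
  reg : ∀ r, κ.reg (r + 8) = word w (s.reg r)
  mem : MemRel w κ.mem s.fld s.pos s.lo

theorem Rel.setReg {w : ℕ} {κ κ' : Config} {s : St} (h : Rel w κ s) {d : ℕ} {x : ℤ}
    (hd : κ'.reg (d + 8) = word w x) (hr : ∀ r, r ≠ d → κ'.reg (r + 8) = κ.reg (r + 8))
    (hc : κ'.mem.cell = κ.mem.cell) (hu : κ.mem.used ≤ κ'.mem.used) : Rel w κ' (s.setReg d x) := by
  refine ⟨fun r => ?_, fun f hf k => ?_, fun f hf p => ?_, ?_⟩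
  · by_cases hrd : r = d
    · subst hrd; simp [St.setReg, hd]
    · rw [hr r hrd, h.reg]; simp [St.setReg, hrd]
  · rw [hc]; exact h.mem.fld f hf k
  · rw [hc]; exact h.mem.pos f hf p
  · exact h.mem.lo.trans (by exact_mod_cast hu)

theorem posAddr_mod {f : ℕ} (hf : f < 3) (p : ℤ) :
    6 ≤ posAddr f p % 32 ∧ posAddr f p % 32 < 12 := by
  unfold posAddr; split_ifs <;> omega

theorem posAddr_inj {f f' : ℕ} (hf : f < 3) (hf' : f' < 3) {p p' : ℤ}
    (h : posAddr f p = posAddr f' p') : f = f' ∧ p = p' := by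
  unfold posAddr at h; split_ifs at h <;> omega

theorem Rel.setFld {w : ℕ} {κ κ' : Config} {s : St} (h : Rel w κ s) {f k : ℕ} {x : ℤ}
    (hf : IsField f) (hr : ∀ r, κ'.reg (r + 8) = κ.reg (r + 8))
    (hc : κ'.mem.cell = Function.update κ.mem.cell (32 * k + f) (word w x))
    (hu : κ.mem.used ≤ κ'.mem.used) : Rel w κ' (s.setFld f k x) := by
  refine ⟨fun r => ?_, fun f' hf' k' => ?_, fun f' hf' p => ?_, ?_⟩
  · rw [hr r, h.reg]; rfl
  · rw [hc]
    unfold IsField at hf hf'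
    by_cases hff : f' = f
    · subst hff
      by_cases hkk : k' = k
      · subst hkk; simp [St.setFld]
      · have hkk' : (k' : ℤ) ≠ k := by exact_mod_cast hkk
        rw [Function.update_of_ne (by omega), h.mem.fld f' hf' k']
        simp [St.setFld, hkk']
    · rw [Function.update_of_ne (by omega), h.mem.fld f' hf' k']
      simp [St.setFld, hff]
  · unfold IsField at hf
    have := posAddr_mod hf' p
    rw [hc, Function.update_of_ne (by omega)]
    exact h.mem.pos f' hf' p
  · exact h.mem.lo.trans (by exact_mod_cast hu)

theorem Rel.setPos {w : ℕ} {κ κ' : Config} {s : St} (h : Rel w κ s) {f : ℕ} {p x : ℤ}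
    (hf : f < 3) (hr : ∀ r, κ'.reg (r + 8) = κ.reg (r + 8))
    (hc : κ'.mem.cell = Function.update κ.mem.cell (posAddr f p) (word w x))
    (hu : κ.mem.used ≤ κ'.mem.used) : Rel w κ' (s.setPos f p x) := by
  refine ⟨fun r => ?_, fun f' hf' k' => ?_, fun f' hf' p' => ?_, ?_⟩
  · rw [hr r, h.reg]; rfl
  · unfold IsField at hf'
    have := posAddr_mod hf p
    rw [hc, Function.update_of_ne (by omega)]
    exact h.mem.fld f' hf' k'
  · rw [hc]
    by_cases hff : f' = f
    · subst hff
      by_cases hpp : p' = p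
      · subst hpp; simp [St.setPos]
      · rw [Function.update_of_ne (fun he => hpp (posAddr_inj hf hf he).2), h.mem.pos f' hf' p']
        simp [St.setPos, hpp]
    · rw [Function.update_of_ne (fun he => hff (posAddr_inj hf' hf he).1), h.mem.pos f' hf' p']
      simp [St.setPos, hff]
  · exact h.mem.lo.trans (by exact_mod_cast hu)

namespace Code

theorem exec_addr {w f a : ℕ} {κ : Config} (h : 32 * κ.reg a + f < 2 ^ w) :
    ∃ R, Exec w (addr f a) κ 7 ⟨R, κ.mem⟩ ∧ R 1 = 32 * κ.reg a + f ∧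
      ∀ r, 3 ≤ r → R r = κ.reg r := by
  have hm : ∀ x, x < 2 ^ w → x % 2 ^ w = x := fun x hx => Nat.mod_eq_of_lt hx
  have dbl : ∀ x, 2 * x < 2 ^ w → (x + x) % 2 ^ w = 2 * x := fun x hx => by
    rw [← two_mul, hm _ hx]
  refine ⟨_, .seq (.add _ _ _ _) (.seq (.add _ _ _ _) (.seq (.add _ _ _ _) (.seq (.add _ _ _ _)
    (.seq (.add _ _ _ _) (.seq (.const _ _ _) (.add _ _ _ _)))))), ?_, ?_⟩
  · simp only [Config.setReg, Function.update_self, ne_eq, OfNat.one_ne_ofNat,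
      not_false_eq_true, Function.update_of_ne]
    rw [hm f (by omega), dbl (κ.reg a) (by omega), dbl (2 * κ.reg a) (by omega),
      dbl (2 * (2 * κ.reg a)) (by omega), dbl (2 * (2 * (2 * κ.reg a))) (by omega),
      dbl (2 * (2 * (2 * (2 * κ.reg a)))) (by omega), hm _ (by omega)]
    omega
  · intro r hr
    simp only [Config.setReg]
    rw [Function.update_of_ne (by omega), Function.update_of_ne (by omega),
      Function.update_of_ne (by omega), Function.update_of_ne (by omega),
      Function.update_of_ne (by omega), Function.update_of_ne (by omega),
      Function.update_of_ne (by omega)]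

theorem exec_addr_word {w B f a : ℕ} {κ : Config} (hB : 32 * B ≤ 2 ^ w) (hf : f < 32)
    {x : ℤ} (hx : κ.reg a = word w x) (h0 : 0 ≤ x) (h1 : x < B) :
    ∃ R, Exec w (addr f a) κ 7 ⟨R, κ.mem⟩ ∧ R 1 = 32 * x.toNat + f ∧
      ∀ r, 3 ≤ r → R r = κ.reg r := by
  have hw : (word w x : ℤ) = x := word_of_lt h0 (by
    have : (32 * B : ℤ) ≤ 2 ^ w := by exact_mod_cast hB
    omega)
  have hk : κ.reg a = x.toNat := by omega
  obtain ⟨R, h1, h2, h3⟩ := exec_addr (w := w) (f := f) (κ := κ) (by rw [hk]; omega)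
  exact ⟨R, h1, hk ▸ h2, h3⟩

theorem exec_paddr {w B f a : ℕ} {v : Bool} {κ : Config} (hB : 32 * B ≤ 2 ^ w) (hf : f < 3)
    (ha : 3 ≤ a) {x : ℤ} (hx : κ.reg a = word w x) (h0 : 1 - (B : ℤ) < x) (h1 : x < B) :
    ∃ R t, Exec w (paddr f v a) κ t ⟨R, κ.mem⟩ ∧ t ≤ 12 ∧ R 1 = posAddr f (view v x) ∧
      ∀ r, 3 ≤ r → R r = κ.reg r := by
  have hBw : (32 * B : ℤ) ≤ 2 ^ w := by exact_mod_cast hB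
  -- the registers after the computation of `-x`
  set κ1 : Config := (κ.setReg 0 (0 % 2 ^ w)).setReg 0
    ((0 % 2 ^ w + (2 ^ w - κ.reg a)) % 2 ^ w) with hκ1
  have e0 : κ1.reg 0 = word w (-x) := by
    have : (0 % 2 ^ w) = word w 0 := (word_natCast w 0).symm
    rw [hκ1]; simp only [Config.setReg, Function.update_self]
    rw [this, hx, word_sub, zero_sub]
  have e1 : ∀ r, 3 ≤ r → κ1.reg r = κ.reg r := by
    intro r hr
    rw [hκ1]; simp only [Config.setReg]
    rw [Function.update_of_ne (by omega), Function.update_of_ne (by omega)]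
  have hpre : ∀ {P : Prog} {t : ℕ} {κ' : Config}, Exec w P κ1 t κ' →
      Exec w (.seq (.const 0 0) (.seq (.sub 0 0 a) P)) κ (1 + (1 + t)) κ' := by
    intro P t κ' h
    refine .seq (.const _ _ _) (.seq (.sub _ _ _ _) ?_)
    have : (κ.setReg 0 (0 % 2 ^ w)).reg a = κ.reg a := by
      simp only [Config.setReg]; rw [Function.update_of_ne (by omega)]
    have h00 : (κ.setReg 0 (0 % 2 ^ w)).reg 0 = 0 % 2 ^ w := by simp [Config.setReg]
    rw [this, h00]
    exact h
  have hxa : (κ1.reg a : ℤ) = x % 2 ^ w := by rw [e1 a ha, hx, cast_word]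
  have hx0 : (κ1.reg 0 : ℤ) = (-x) % 2 ^ w := by rw [e0, cast_word]
  by_cases hpos : 1 ≤ x
  · have hT : (Test.lt a 0).Holds κ1.reg := by
      show κ1.reg a < κ1.reg 0
      have a1 : x % 2 ^ w = x := Int.emod_eq_of_lt (by omega) (by omega)
      have a2 : (-x) % 2 ^ w = 2 ^ w - x := by
        rw [← Int.add_emod_right, Int.emod_eq_of_lt (by omega) (by omega)]; ring
      omega
    obtain ⟨R, g1, g2, g3⟩ := exec_addr_word (w := w) (f := posFld f v) (κ := κ1) (a := a) hB
      (by unfold posFld; have := v.toNat_le; omega) ((e1 a ha).trans hx) (by omega) h1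
    refine ⟨R, _, hpre (.ite_true hT g1), by omega, ?_, fun r hr => (g3 r hr).trans (e1 r hr)⟩
    rw [g2]
    unfold posAddr view posFld
    cases v <;> simp only [Bool.toNat_false, Bool.toNat_true, if_true, Bool.false_eq_true, if_false]
    · rw [if_pos hpos]; omega
    · rw [if_neg (by omega)]
      rw [show 1 - (1 - x) = x by ring]; omega
  · have hT : ¬ (Test.lt a 0).Holds κ1.reg := by
      show ¬ κ1.reg a < κ1.reg 0
      have a1 : (-x) % 2 ^ w = -x := Int.emod_eq_of_lt (by omega) (by omega)
      by_cases hx00 : x = 0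
      · subst hx00
        simp only [neg_zero] at hx0
        omega
      · have a2 : x % 2 ^ w = 2 ^ w + x := by
          rw [← Int.add_emod_right, Int.emod_eq_of_lt (by omega) (by omega)]; ring
        omega
    set κ2 : Config := (κ1.setReg 1 (1 % 2 ^ w)).setReg 0
      ((κ1.reg 0 + 1 % 2 ^ w) % 2 ^ w) with hκ2
    have f0 : κ2.reg 0 = word w (1 - x) := by
      have : (1 % 2 ^ w) = word w 1 := (word_natCast w 1).symm
      rw [hκ2]; simp only [Config.setReg, Function.update_self]
      rw [this, e0, word_add]
      congr 1; ring
    have f1 : ∀ r, 3 ≤ r → κ2.reg r = κ.reg r := by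
      intro r hr
      rw [hκ2]; simp only [Config.setReg]
      rw [Function.update_of_ne (by omega), Function.update_of_ne (by omega), e1 r hr]
    obtain ⟨R, g1, g2, g3⟩ := exec_addr_word (w := w) (f := posFld f !v) (κ := κ2) (a := 0) hB
      (by unfold posFld; have := (!v).toNat_le; omega) f0 (by omega) (by omega)
    have hex : Exec w (.seq (.const 1 1) (.seq (.add 0 0 1) (addr (posFld f !v) 0))) κ1
        (1 + (1 + 7)) ⟨R, κ2.mem⟩ := by
      refine .seq (.const _ _ _) (.seq (.add _ _ _ _) ?_)
      have h0 : (κ1.setReg 1 (1 % 2 ^ w)).reg 0 = κ1.reg 0 := by simp [Config.setReg]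
      have h1 : (κ1.setReg 1 (1 % 2 ^ w)).reg 1 = 1 % 2 ^ w := by simp [Config.setReg]
      rw [h0, h1]
      exact g1
    refine ⟨R, _, hpre (.ite_false hT hex), by omega, ?_, fun r hr => (g3 r hr).trans (f1 r hr)⟩
    rw [g2]
    unfold posAddr view posFld
    cases v <;> simp only [Bool.toNat_false, Bool.toNat_true, if_true, Bool.false_eq_true, if_false,
      Bool.not_false, Bool.not_true]
    · rw [if_neg hpos]; omega
    · rw [if_pos (by omega)]; omega

/-- The outcome of an execution of the compiled code in the configuration `κ` that satisfies the
postcondition `Q`. -/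
def Result (w B K : ℕ) (P : Code) (Q : St → Prop) (κ : Config) : Prop :=
  ∃ t κ' s', Exec w P.compile κ t κ' ∧ t ≤ P.cost K ∧ Rel w κ' s' ∧ Q s' ∧
    κ.mem.used ≤ κ'.mem.used ∧ κ'.mem.used ≤ max κ.mem.used (32 * B) ∧
    (P.readOnly = true → κ'.mem.cell = κ.mem.cell) ∧
    (P.flat = true → ∀ r, 3 ≤ r → r < 8 → κ'.reg r = κ.reg r)

theorem posAddr_lt {B f : ℕ} {p : ℤ} {v : Bool} (hf : f < 3) (h0 : 1 - (B : ℤ) < p)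
    (h1 : p < B) : posAddr f (view v p) + 1 ≤ 32 * B := by
  unfold posAddr view
  cases v <;> simp only [if_true, Bool.false_eq_true, if_false] <;> split_ifs <;> omega

/-- Soundness of the weakest preconditions. -/
theorem result_of_wp {w B K : ℕ} (hB : 32 * B ≤ 2 ^ w) (hK : K < 2 ^ w) (P : Code) :
    ∀ (Q : St → Prop) (s : St) (κ : Config), P.wf = true → Rel w κ s → P.wp w B K Q s →
      Result w B K P Q κ := by
  have reg_mod : ∀ {κ : Config} {s : St}, Rel w κ s → ∀ r, 0 ≤ s.reg r → s.reg r < 2 ^ w →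
      (κ.reg (r + 8) : ℤ) = s.reg r := fun h r h0 h1 => by rw [h.reg, word_of_lt h0 h1]
  have one : ∀ {d : ℕ} {κ : Config} {y : ℕ} {x : ℤ} {s : St}, Rel w κ s → y = word w x →
      Rel w (κ.setReg (d + 8) y) (s.setReg d x) := by
    intro d κ y x s h hy
    refine h.setReg (by simp [Config.setReg, hy]) (fun r hr => ?_) rfl le_rfl
    simp [Config.setReg, hr]
  have temps : ∀ (κ : Config) (d y r : ℕ), r < 8 → (κ.setReg (d + 8) y).reg r = κ.reg r := by
    intro κ d y r hr
    simp only [Config.setReg]; rw [Function.update_of_ne (by omega)]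
  induction P with
  | skip =>
    intro Q s κ _ h hQ
    exact ⟨1, κ, s, .skip κ, by simp [cost], h, hQ, le_rfl, le_max_left _ _, fun _ => rfl,
      fun _ _ _ _ => rfl⟩
  | const d k =>
    intro Q s κ _ h hQ
    exact ⟨1, _, _, .const _ _ κ, by simp [cost], one h (word_natCast w k).symm, hQ, le_rfl,
      le_max_left _ _, fun _ => rfl, fun _ r _ h8 => temps _ _ _ r h8⟩
  | move d a =>
    intro Q s κ _ h hQ
    exact ⟨1, _, _, .move _ _ κ, by simp [cost], one h (h.reg a), hQ, le_rfl,
      le_max_left _ _, fun _ => rfl, fun _ r _ h8 => temps _ _ _ r h8⟩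
  | add d a b =>
    intro Q s κ _ h hQ
    exact ⟨1, _, _, .add _ _ _ κ, by simp [cost], one h (by rw [h.reg, h.reg, word_add]), hQ,
      le_rfl, le_max_left _ _, fun _ => rfl, fun _ r _ h8 => temps _ _ _ r h8⟩
  | sub d a b =>
    intro Q s κ _ h hQ
    exact ⟨1, _, _, .sub _ _ _ κ, by simp [cost], one h (by rw [h.reg, h.reg, word_sub]), hQ,
      le_rfl, le_max_left _ _, fun _ => rfl, fun _ r _ h8 => temps _ _ _ r h8⟩
  | ld f d a =>
    rintro Q s κ - h ⟨hf, ⟨h0, h1⟩, hQ⟩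
    have hf32 : f < 32 := by unfold IsField at hf; omega
    obtain ⟨R, g1, g2, g3⟩ := exec_addr_word (κ := κ) hB hf32
      (h.reg a) h0 h1
    refine ⟨8, _, _, .seq g1 (.load (d + 8) 1 ⟨R, κ.mem⟩), by simp [cost], h.setReg ?_ ?_ rfl
      (le_max_left _ _), hQ, le_max_left _ _, ?_, fun _ => rfl, fun _ r h3 h8 => ?_⟩
    · simp only [Function.update_self]
      rw [g2, h.mem.fld f hf, Int.toNat_of_nonneg h0]
    · intro r hr
      show Function.update R _ _ _ = _
      rw [Function.update_of_ne (by omega), g3 _ (by omega)]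
    · simp only [Memory.touch, g2]; omega
    · show Function.update R _ _ _ = _
      rw [Function.update_of_ne (by omega), g3 _ h3]
  | st f a b =>
    rintro Q s κ - h ⟨hf, ⟨h0, h1⟩, hQ⟩
    have hf32 : f < 32 := by unfold IsField at hf; omega
    obtain ⟨R, g1, g2, g3⟩ := exec_addr_word (κ := κ) hB hf32
      (h.reg a) h0 h1
    refine ⟨8, _, _, .seq g1 (.store 1 (b + 8) ⟨R, κ.mem⟩), by simp [cost],
      ?_, hQ, le_max_left _ _, ?_, fun hr => by simp [readOnly] at hr, fun _ r h3 h8 => g3 r h3⟩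
    · have := h.setFld (κ' := ⟨R, κ.mem.write (R 1) (R (b + 8))⟩) (f := f) (k := (s.reg a).toNat)
        (x := s.reg b) hf (fun r => g3 _ (by omega))
        (by simp only [Memory.write, g2]; rw [g3 _ (by omega), h.reg]) (le_max_left _ _)
      rwa [Int.toNat_of_nonneg h0] at this
    · simp only [Memory.write, g2]; omega
  | pld f v d a =>
    rintro Q s κ - h ⟨hf, ⟨h0, h1⟩, hQ⟩
    obtain ⟨R, t, g1, gt, g2, g3⟩ := exec_paddr (v := v) (κ := κ) hB hf (by omega : 3 ≤ a + 8)
      (h.reg a) h0 h1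
    refine ⟨t + 1, _, _, .seq g1 (.load (d + 8) 1 ⟨R, κ.mem⟩), by simp [cost]; omega,
      h.setReg ?_ ?_ rfl (le_max_left _ _), hQ, le_max_left _ _, ?_, fun _ => rfl,
      fun _ r h3 h8 => ?_⟩
    · simp only [Function.update_self]
      rw [g2, h.mem.pos f hf]
    · intro r hr
      show Function.update R _ _ _ = _
      rw [Function.update_of_ne (by omega), g3 _ (by omega)]
    · have := posAddr_lt (v := v) hf h0 h1
      simp only [Memory.touch, g2]; omega
    · show Function.update R _ _ _ = _
      rw [Function.update_of_ne (by omega), g3 _ h3]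
  | pst f v a b =>
    rintro Q s κ - h ⟨hf, ⟨h0, h1⟩, hQ⟩
    obtain ⟨R, t, g1, gt, g2, g3⟩ := exec_paddr (v := v) (κ := κ) hB hf (by omega : 3 ≤ a + 8)
      (h.reg a) h0 h1
    refine ⟨t + 1, _, _, .seq g1 (.store 1 (b + 8) ⟨R, κ.mem⟩), by simp [cost]; omega,
      h.setPos hf (fun r => g3 _ (by omega)) ?_ (le_max_left _ _), hQ, le_max_left _ _, ?_,
      fun hr => by simp [readOnly] at hr, fun _ r h3 h8 => g3 r h3⟩
    · simp only [Memory.write, g2]; rw [g3 _ (by omega), h.reg]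
    · have := posAddr_lt (v := v) hf h0 h1
      simp only [Memory.write, g2]; omega
  | touch a =>
    rintro Q s κ - h ⟨⟨h0, h1⟩, hQ⟩
    obtain ⟨R, g1, g2, g3⟩ := exec_addr_word (κ := κ) hB (by omega : 31 < 32)
      (h.reg a) h0 h1
    refine ⟨8, _, _, .seq g1 (.store 1 1 ⟨R, κ.mem⟩), by simp [cost],
      ⟨fun r => ?_, fun f hf k => ?_, fun f hf p => ?_, ?_⟩, hQ, le_max_left _ _, ?_,
      fun hr => by simp [readOnly] at hr, fun _ r h3 h8 => g3 r h3⟩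
    · exact (g3 _ (by omega)).trans (h.reg r)
    · simp only [Memory.write, g2]
      unfold IsField at hf
      rw [Function.update_of_ne (by omega)]
      exact h.mem.fld f hf k
    · simp only [Memory.write, g2]
      have := posAddr_mod hf p
      rw [Function.update_of_ne (by omega)]
      exact h.mem.pos f hf p
    · have := h.mem.lo
      simp only [Memory.write, g2, St.setLo]
      push_cast
      omega
    · simp only [Memory.write, g2]; omega
  | seq P P' ih ih' =>
    intro Q s κ hwf h hQ
    simp only [wf, Bool.and_eq_true] at hwf
    obtain ⟨t, κ1, s1, e1, c1, r1, q1, u1, v1, p1, f1⟩ := ih _ s κ hwf.1 h hQ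
    obtain ⟨t', κ2, s2, e2, c2, r2, q2, u2, v2, p2, f2⟩ := ih' Q s1 κ1 hwf.2 r1 q1
    refine ⟨t + t', κ2, s2, .seq e1 e2, Nat.add_le_add c1 c2, r2, q2, u1.trans u2,
      by omega, fun hr => ?_, fun hr r h3 h8 => ?_⟩
    · simp only [readOnly, Bool.and_eq_true] at hr
      rw [p2 hr.2, p1 hr.1]
    · simp only [flat, Bool.and_eq_true] at hr
      rw [f2 hr.2 r h3 h8, f1 hr.1 r h3 h8]
  | ite T P P' ih ih' =>
    intro Q s κ hwf h hQ
    simp only [wf, Bool.and_eq_true] at hwf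
    have fin : ∀ b : Bool, Result w B K (if b then P else P') Q κ →
        (∀ t κ', Exec w (if b then P else P').compile κ t κ' →
          Exec w (ite T P P').compile κ (t + 1) κ') → Result w B K (ite T P P') Q κ := by
      rintro b ⟨t, κ1, s1, e1, c1, r1, q1, u1, v1, p1, f1⟩ hex
      refine ⟨t + 1, κ1, s1, hex _ _ e1, ?_, r1, q1, u1, v1, fun hr => p1 ?_, fun hr => f1 ?_⟩
      · cases b <;> simp [cost] at c1 ⊢ <;> omega
      · simp only [readOnly, Bool.and_eq_true] at hr
        cases b <;> simp [hr]
      · simp only [flat, Bool.and_eq_true] at hr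
        cases b <;> simp [hr]
    cases T with
    | lt a b =>
      obtain ⟨⟨a0, a1⟩, ⟨b0, b1⟩, ht, hf⟩ := hQ
      have ea := reg_mod h a a0 a1
      have eb := reg_mod h b b0 b1
      by_cases hab : s.reg a < s.reg b
      · refine fin true (ih Q s κ hwf.1 h (ht hab)) fun t κ' e => .ite_true ?_ e
        show κ.reg (a + 8) < κ.reg (b + 8)
        omega
      · refine fin false (ih' Q s κ hwf.2 h (hf hab)) fun t κ' e => .ite_false ?_ e
        show ¬ κ.reg (a + 8) < κ.reg (b + 8)
        omega
    | eq a b =>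
      obtain ⟨⟨a0, a1⟩, ⟨b0, b1⟩, ht, hf⟩ := hQ
      have ea := reg_mod h a a0 a1
      have eb := reg_mod h b b0 b1
      by_cases hab : s.reg a = s.reg b
      · refine fin true (ih Q s κ hwf.1 h (ht hab)) fun t κ' e => .ite_true ?_ e
        show κ.reg (a + 8) = κ.reg (b + 8)
        omega
      · refine fin false (ih' Q s κ hwf.2 h (hf hab)) fun t κ' e => .ite_false ?_ e
        show ¬ κ.reg (a + 8) = κ.reg (b + 8)
        omega
  | iter a P ih =>
    rintro Q s κ hwf h ⟨ha, hQ⟩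
    have hfl : P.flat = true := hwf
    have hwf' : P.wf = true := by
      clear ih hQ hwf
      induction P with
      | seq P P' i i' => simp only [flat, wf, Bool.and_eq_true] at hfl ⊢; exact ⟨i hfl.1, i' hfl.2⟩
      | ite T P P' i i' =>
        simp only [flat, wf, Bool.and_eq_true] at hfl ⊢; exact ⟨i hfl.1, i' hfl.2⟩
      | iter => simp [flat] at hfl
      | _ => rfl
    have h1w : 1 < 2 ^ w ∨ K = 0 := by omega
    have loop : ∀ n ≤ K, ∀ s κ, Rel w κ s → (wp w B K P)^[n] Q s → κ.reg 3 = K - n →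
        κ.reg 4 = K → κ.reg 5 = 1 % 2 ^ w →
        ∃ t κ' s', Exec w (.loop (.lt 3 4) (.seq P.compile (.add 3 3 5))) κ t κ' ∧
          t ≤ n * (P.cost K + 2) + 1 ∧ Rel w κ' s' ∧ Q s' ∧
          κ.mem.used ≤ κ'.mem.used ∧ κ'.mem.used ≤ max κ.mem.used (32 * B) ∧
          (P.readOnly = true → κ'.mem.cell = κ.mem.cell) := by
      intro n
      induction n with
      | zero =>
        intro _ s κ h hQ h3 h4 h5
        exact ⟨1, κ, s, .loop_false (by show ¬ κ.reg 3 < κ.reg 4; omega), by omega, h, hQ, le_rfl,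
          le_max_left _ _, fun _ => rfl⟩
      | succ n ihn =>
        intro hn s κ h hQ h3 h4 h5
        rw [Function.iterate_succ_apply'] at hQ
        obtain ⟨t, κ1, s1, e1, c1, r1, q1, u1, v1, p1, f1⟩ := ih _ s κ hwf' h hQ
        have f3 := f1 hfl 3 (by omega) (by omega)
        have f4 := f1 hfl 4 (by omega) (by omega)
        have f5 := f1 hfl 5 (by omega) (by omega)
        have hw1 : 1 % 2 ^ w = 1 := Nat.mod_eq_of_lt (by omega)
        set κ2 := κ1.setReg 3 ((κ1.reg 3 + κ1.reg 5) % 2 ^ w) with hκ2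
        have r2 : Rel w κ2 s1 := by
          refine ⟨fun r => ?_, r1.mem⟩
          rw [← r1.reg r, hκ2]
          simp only [Config.setReg]; rw [Function.update_of_ne (by omega)]
        have g3 : κ2.reg 3 = K - n := by
          rw [hκ2]; simp only [Config.setReg, Function.update_self]
          rw [f3, f5, h3, h5, hw1, Nat.mod_eq_of_lt (by omega)]; omega
        have g4 : κ2.reg 4 = K := by rw [hκ2, ← h4, ← f4]; simp [Config.setReg]
        have g5 : κ2.reg 5 = 1 % 2 ^ w := by rw [hκ2, ← h5, ← f5]; simp [Config.setReg]
        obtain ⟨t', κ', s', e', c', r', q', u', v', p'⟩ := ihn (by omega) s1 κ2 r2 q1 g3 g4 g5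
        refine ⟨(t + 1) + t' + 1, κ', s', .loop_true ?_ (.seq e1 (.add _ _ _ _)) e', ?_, r', q',
          u1.trans u', ?_, fun hr => (p' hr).trans (p1 hr)⟩
        · show κ.reg 3 < κ.reg 4; omega
        · rw [Nat.succ_mul]; omega
        · have : κ2.mem.used = κ1.mem.used := rfl
          omega
    set κ1 := ((κ.setReg 3 (0 % 2 ^ w)).setReg 4 (κ.reg (a + 8))).setReg 5 (1 % 2 ^ w) with hκ1
    have r1 : Rel w κ1 s := by
      refine ⟨fun r => ?_, h.mem⟩
      rw [← h.reg r, hκ1]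
      simp only [Config.setReg]
      rw [Function.update_of_ne (by omega), Function.update_of_ne (by omega),
        Function.update_of_ne (by omega)]
    have hreg : κ.reg (a + 8) = K := by rw [h.reg, ha, word_natCast_of_lt hK]
    obtain ⟨t, κ', s', e, c, r, q, u, v, p⟩ := loop K le_rfl s κ1 r1 hQ
      (by simp [hκ1, Config.setReg]) (by simp [hκ1, Config.setReg, hreg])
      (by simp [hκ1, Config.setReg])
    refine ⟨1 + (1 + (1 + t)), κ', s', .seq (.const _ _ _) (.seq (.move _ _ _)
      (.seq (.const _ _ _) ?_)), by simp only [cost]; omega, r, q, u, v, p,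
      fun hr => by simp [flat] at hr⟩
    have : (κ.setReg 3 (0 % 2 ^ w)).reg (a + 8) = κ.reg (a + 8) := by
      simp only [Config.setReg]; rw [Function.update_of_ne (by omega)]
    rw [this]
    exact e

/-! ### Proof rules -/

theorem wp_mono {w B K : ℕ} (P : Code) : ∀ {Q Q' : St → Prop} {s : St}, P.wp w B K Q s →
    (∀ s', Q s' → Q' s') → P.wp w B K Q' s := by
  induction P with
  | skip | const | move | add | sub => intro Q Q' s h hQ; exact hQ _ h
  | ld | st | pld | pst => rintro Q Q' s ⟨h1, h2, h3⟩ hQ; exact ⟨h1, h2, hQ _ h3⟩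
  | touch => rintro Q Q' s ⟨h1, h2⟩ hQ; exact ⟨h1, hQ _ h2⟩
  | seq P P' ih ih' => intro Q Q' s h hQ; exact ih h fun s' h' => ih' h' hQ
  | ite T P P' ih ih' =>
    intro Q Q' s h hQ
    cases T <;> exact ⟨h.1, h.2.1, fun h' => ih (h.2.2.1 h') hQ, fun h' => ih' (h.2.2.2 h') hQ⟩
  | iter a P ih =>
    rintro Q Q' s ⟨h1, h2⟩ hQ
    refine ⟨h1, ?_⟩
    have : ∀ n s, (wp w B K P)^[n] Q s → (wp w B K P)^[n] Q' s := by
      intro n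
      induction n with
      | zero => exact fun s h => hQ s h
      | succ n ihn =>
        intro s h
        rw [Function.iterate_succ_apply'] at h ⊢
        exact ih h ihn
    exact this K s h2

/-- A loop with the invariant `I`, which depends on the number of remaining iterations. -/
theorem wp_iter {w B K a : ℕ} {P : Code} {Q : St → Prop} {s : St} (I : ℕ → St → Prop)
    (ha : s.reg a = K) (h0 : I K s) (hI : ∀ n s, I (n + 1) s → P.wp w B K (I n) s)
    (hQ : ∀ s, I 0 s → Q s) : (iter a P).wp w B K Q s := by
  refine ⟨ha, ?_⟩
  have : ∀ n s, I n s → (wp w B K P)^[n] Q s := by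
    intro n
    induction n with
    | zero => exact hQ
    | succ n ih =>
      intro s h
      rw [Function.iterate_succ_apply']
      exact P.wp_mono (hI n s h) ih
  exact this K s h0

/-- The initial state of a call. -/
def start (args : List ℕ) (fld pos : ℕ → ℤ → ℤ) (lo : ℤ) : St :=
  ⟨fun r => args.getD r 0, fld, pos, lo⟩

theorem runs_call {w B K : ℕ} (hB : 32 * B ≤ 2 ^ w) (hK : K < 2 ^ w) {P : Code}
    (hwf : P.wf = true) {args : List ℕ} (hargs : args.length ≤ 2) (hlt : ∀ x ∈ args, x < 2 ^ w)
    {m : Memory} {fld pos : ℕ → ℤ → ℤ} {lo : ℤ} (hm : MemRel w m fld pos lo) {Q : St → Prop}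
    (h : P.wp w B K Q (start args fld pos lo)) :
    ∃ t m' s', Runs w P.call args m t (word w (s'.reg 0)) m' ∧ t ≤ P.cost K + 3 ∧
      MemRel w m' s'.fld s'.pos s'.lo ∧ Q s' ∧ m.used ≤ m'.used ∧
      m'.used ≤ max m.used (32 * B) ∧ (P.readOnly = true → m'.cell = m.cell) := by
  set κ : Config := ⟨fun r => args.getD r 0, m⟩ with hκ
  set κ1 := (κ.setReg 8 (κ.reg 0)).setReg 9 (κ.reg 1) with hκ1
  have hw : ∀ r, word w ((args.getD r 0 : ℕ) : ℤ) = args.getD r 0 := by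
    intro r
    refine word_natCast_of_lt ?_
    by_cases hr : r < args.length
    · rw [List.getD_eq_getElem _ _ hr]; exact hlt _ (List.getElem_mem hr)
    · rw [List.getD_eq_default _ _ (by omega)]; positivity
  have hrel : Rel w κ1 (start args fld pos lo) := by
    refine ⟨fun r => ?_, hm⟩
    show κ1.reg (r + 8) = word w ((args.getD r 0 : ℕ) : ℤ)
    rw [hw, hκ1]
    rcases r with _ | _ | r
    · rfl
    · rfl
    · simp only [Config.setReg]
      rw [Function.update_of_ne (by omega), Function.update_of_ne (by omega), hκ]
      show args.getD _ 0 = args.getD _ 0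
      rw [List.getD_eq_default _ _ (by omega), List.getD_eq_default _ _ (by omega)]
  obtain ⟨t, κ', s', e, c, r, q, u, v, p, -⟩ := result_of_wp hB hK P Q _ κ1 hwf hrel h
  refine ⟨1 + (1 + (t + 1)), κ'.mem, s', ⟨_, .seq (.move _ _ _) (.seq (.move _ _ _)
    (.seq ?_ (.move 0 8 κ'))), ?_⟩, by omega, r.mem, q, u, v, p⟩
  · exact e
  · simp [r.reg 0]

theorem answers_call {w B K : ℕ} (hB : 32 * B ≤ 2 ^ w) (hK : K < 2 ^ w) {P : Code}
    (hwf : P.wf = true) (hro : P.readOnly = true)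
    {args : List ℕ} (hargs : args.length ≤ 2) (hlt : ∀ x ∈ args, x < 2 ^ w)
    {m : Memory} {fld pos : ℕ → ℤ → ℤ} {lo : ℤ} (hm : MemRel w m fld pos lo)
    (hBm : 32 * B ≤ m.used) {T res : ℕ} (hT : P.cost K + 3 ≤ T)
    (h : P.wp w B K (fun s => word w (s.reg 0) = res) (start args fld pos lo)) :
    Answers w P.call args m T res := by
  obtain ⟨t, m', s', e, c, -, q, u, v, p⟩ := runs_call hB hK hwf hargs hlt hm h
  refine ⟨t, c.trans hT, ?_⟩
  have : m' = m := by
    cases m; cases m'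
    simp only [Memory.mk.injEq]
    exact ⟨p hro, by simp only at u v hBm; omega⟩
  rw [this, q] at e
  exact e

end Code

namespace St

variable (s : St) (d f : ℕ) (k x : ℤ)

@[simp] theorem setReg_reg : (s.setReg d x).reg = Function.update s.reg d x := rfl
@[simp] theorem setReg_fld : (s.setReg d x).fld = s.fld := rfl
@[simp] theorem setReg_pos : (s.setReg d x).pos = s.pos := rfl
@[simp] theorem setReg_lo : (s.setReg d x).lo = s.lo := rfl
@[simp] theorem setFld_reg : (s.setFld f k x).reg = s.reg := rfl
@[simp] theorem setFld_fld :
    (s.setFld f k x).fld = Function.update s.fld f (Function.update (s.fld f) k x) := rfl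
@[simp] theorem setFld_pos : (s.setFld f k x).pos = s.pos := rfl
@[simp] theorem setFld_lo : (s.setFld f k x).lo = s.lo := rfl
@[simp] theorem setPos_reg : (s.setPos f k x).reg = s.reg := rfl
@[simp] theorem setPos_fld : (s.setPos f k x).fld = s.fld := rfl
@[simp] theorem setPos_pos :
    (s.setPos f k x).pos = Function.update s.pos f (Function.update (s.pos f) k x) := rfl
@[simp] theorem setPos_lo : (s.setPos f k x).lo = s.lo := rfl
@[simp] theorem setLo_reg : (s.setLo k).reg = s.reg := rfl
@[simp] theorem setLo_fld : (s.setLo k).fld = s.fld := rfl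
@[simp] theorem setLo_pos : (s.setLo k).pos = s.pos := rfl
@[simp] theorem setLo_lo : (s.setLo k).lo = max s.lo k := rfl

end St

namespace Code

section

variable {w B K : ℕ} {P P' : Code} {Q : St → Prop} {s : St} {d a b f k : ℕ} {v : Bool}

theorem wp_seq : wp w B K (.seq P P') Q s ↔ wp w B K P (wp w B K P' Q) s := Iff.rfl

@[simp] theorem wp_skip : wp w B K .skip Q s ↔ Q s := Iff.rfl
@[simp] theorem wp_const : wp w B K (.const d k) Q s ↔ Q (s.setReg d k) := Iff.rfl
@[simp] theorem wp_move : wp w B K (.move d a) Q s ↔ Q (s.setReg d (s.reg a)) := Iff.rfl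
@[simp] theorem wp_ld : wp w B K (.ld f d a) Q s ↔ IsField f ∧
    (0 ≤ s.reg a ∧ s.reg a < B) ∧ Q (s.setReg d (s.fld f (s.reg a))) := Iff.rfl
@[simp] theorem wp_st : wp w B K (.st f a b) Q s ↔ IsField f ∧
    (0 ≤ s.reg a ∧ s.reg a < B) ∧ Q (s.setFld f (s.reg a) (s.reg b)) := Iff.rfl
@[simp] theorem wp_pld : wp w B K (.pld f v d a) Q s ↔ f < 3 ∧
    (1 - (B : ℤ) < s.reg a ∧ s.reg a < B) ∧ Q (s.setReg d (s.pos f (view v (s.reg a)))) := Iff.rfl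
@[simp] theorem wp_pst : wp w B K (.pst f v a b) Q s ↔ f < 3 ∧
    (1 - (B : ℤ) < s.reg a ∧ s.reg a < B) ∧ Q (s.setPos f (view v (s.reg a)) (s.reg b)) := Iff.rfl
@[simp] theorem wp_touch : wp w B K (.touch a) Q s ↔
    (0 ≤ s.reg a ∧ s.reg a < B) ∧ Q (s.setLo (s.reg a + 1)) := Iff.rfl
@[simp] theorem wp_lt : wp w B K (.ite (.lt a b) P P') Q s ↔
    (0 ≤ s.reg a ∧ s.reg a < 2 ^ w) ∧ (0 ≤ s.reg b ∧ s.reg b < 2 ^ w) ∧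
      (s.reg a < s.reg b → wp w B K P Q s) ∧ (¬ s.reg a < s.reg b → wp w B K P' Q s) := Iff.rfl
@[simp] theorem wp_eq : wp w B K (.ite (.eq a b) P P') Q s ↔
    (0 ≤ s.reg a ∧ s.reg a < 2 ^ w) ∧ (0 ≤ s.reg b ∧ s.reg b < 2 ^ w) ∧
      (s.reg a = s.reg b → wp w B K P Q s) ∧ (¬ s.reg a = s.reg b → wp w B K P' Q s) := Iff.rfl

@[simp] theorem wp_seq_const :
    wp w B K (.seq (.const d k) P) Q s ↔ wp w B K P Q (s.setReg d k) := Iff.rfl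
@[simp] theorem wp_seq_move :
    wp w B K (.seq (.move d a) P) Q s ↔ wp w B K P Q (s.setReg d (s.reg a)) := Iff.rfl
@[simp] theorem wp_seq_add : wp w B K (.seq (.add d a b) P) Q s ↔
    wp w B K P Q (s.setReg d (s.reg a + s.reg b)) := Iff.rfl
@[simp] theorem wp_seq_sub : wp w B K (.seq (.sub d a b) P) Q s ↔
    wp w B K P Q (s.setReg d (s.reg a - s.reg b)) := Iff.rfl
@[simp] theorem wp_seq_ld : wp w B K (.seq (.ld f d a) P) Q s ↔ IsField f ∧
    (0 ≤ s.reg a ∧ s.reg a < B) ∧ wp w B K P Q (s.setReg d (s.fld f (s.reg a))) := Iff.rfl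
@[simp] theorem wp_seq_st : wp w B K (.seq (.st f a b) P) Q s ↔ IsField f ∧
    (0 ≤ s.reg a ∧ s.reg a < B) ∧ wp w B K P Q (s.setFld f (s.reg a) (s.reg b)) := Iff.rfl
@[simp] theorem wp_seq_pld : wp w B K (.seq (.pld f v d a) P) Q s ↔ f < 3 ∧
    (1 - (B : ℤ) < s.reg a ∧ s.reg a < B) ∧
      wp w B K P Q (s.setReg d (s.pos f (view v (s.reg a)))) := Iff.rfl
@[simp] theorem wp_seq_pst : wp w B K (.seq (.pst f v a b) P) Q s ↔ f < 3 ∧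
    (1 - (B : ℤ) < s.reg a ∧ s.reg a < B) ∧
      wp w B K P Q (s.setPos f (view v (s.reg a)) (s.reg b)) := Iff.rfl

@[simp] theorem wp_seq_touch : wp w B K (.seq (.touch a) P) Q s ↔
    (0 ≤ s.reg a ∧ s.reg a < B) ∧ wp w B K P Q (s.setLo (s.reg a + 1)) := Iff.rfl

theorem wp_seq_lt {P'' : Code} : wp w B K (.seq (.ite (.lt a b) P P') P'') Q s ↔
    (0 ≤ s.reg a ∧ s.reg a < 2 ^ w) ∧ (0 ≤ s.reg b ∧ s.reg b < 2 ^ w) ∧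
      (s.reg a < s.reg b → wp w B K P (wp w B K P'' Q) s) ∧
      (¬ s.reg a < s.reg b → wp w B K P' (wp w B K P'' Q) s) := Iff.rfl

theorem wp_seq_eq {P'' : Code} : wp w B K (.seq (.ite (.eq a b) P P') P'') Q s ↔
    (0 ≤ s.reg a ∧ s.reg a < 2 ^ w) ∧ (0 ≤ s.reg b ∧ s.reg b < 2 ^ w) ∧
      (s.reg a = s.reg b → wp w B K P (wp w B K P'' Q) s) ∧
      (¬ s.reg a = s.reg b → wp w B K P' (wp w B K P'' Q) s) := Iff.rfl

end

@[simp] theorem isField_of_lt {f : ℕ} (h : f < 6) : IsField f := Or.inl h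
@[simp] theorem isField_of_le {f : ℕ} (h : 12 ≤ f) (h' : f < 31) : IsField f := Or.inr ⟨h, h'⟩

end Code

/-! ### Persistent binary tries -/

/-- The node that is reached from the node `A` of a binary trie with the child pointers `L` and `R`
by the `k` leading bits of `c`, where `M` is a power of two that exceeds `c`. -/
def look (L R : ℤ → ℤ) (M : ℤ) : ℕ → ℤ → ℤ → ℤ
  | 0, A, _ => A
  | k + 1, A, c => if c + c < M then look L R M k (L A) (c + c) else look L R M k (R A) (c + c - M)

/-- The value of the key `c` in the trie of height `k` with the root `A`; the leaves store it in
the place of the left child. -/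
def find (L R : ℤ → ℤ) (M : ℤ) (k : ℕ) (A c : ℤ) : ℤ := L (look L R M k A c)

/-- All child pointers of the nodes below `B` point to nodes below `B`. -/
def Closed (L R : ℤ → ℤ) (B : ℤ) : Prop :=
  ∀ k, 0 ≤ k → k < B → (0 ≤ L k ∧ L k < B) ∧ (0 ≤ R k ∧ R k < B)

theorem look_congr {L R L' R' : ℤ → ℤ} {M B : ℤ} (hc : Closed L R B)
    (hL : ∀ k, 0 ≤ k → k < B → L' k = L k ∧ R' k = R k) (n : ℕ) :
    ∀ {A c : ℤ}, 0 ≤ A → A < B → look L' R' M n A c = look L R M n A c ∧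
      0 ≤ look L R M n A c ∧ look L R M n A c < B := by
  induction n with
  | zero => intro A c h0 h1; exact ⟨rfl, h0, h1⟩
  | succ n ih =>
    intro A c h0 h1
    have h := hc A h0 h1
    have h' := hL A h0 h1
    unfold look
    rw [h'.1, h'.2]
    split_ifs
    · exact ih h.1.1 h.1.2
    · exact ih h.2.1 h.2.2

theorem find_congr {L R L' R' : ℤ → ℤ} {M B : ℤ} (hc : Closed L R B)
    (hL : ∀ k, 0 ≤ k → k < B → L' k = L k ∧ R' k = R k) (n : ℕ) {A c : ℤ} (h0 : 0 ≤ A)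
    (h1 : A < B) : find L' R' M n A c = find L R M n A c := by
  obtain ⟨e, h2, h3⟩ := look_congr (M := M) (c := c) hc hL n h0 h1
  unfold find
  rw [e, (hL _ h2 h3).1]

theorem find_zero {L R : ℤ → ℤ} {M : ℤ} (hL : L 0 = 0) (hR : R 0 = 0) (n : ℕ) (c : ℤ) :
    find L R M n 0 c = 0 := by
  have : look L R M n 0 c = 0 := by
    induction n generalizing c with
    | zero => rfl
    | succ n ih => unfold look; rw [hL, hR]; split_ifs <;> apply ih
  unfold find
  rw [this, hL]

namespace Code

/-- One step of the descent in a trie: doubling the key shifts its leading bit out. -/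
def searchStep : Code :=
  .seq (.add 21 21 21) (.ite (.lt 21 22) (.ld 18 20 20) (.seq (.sub 21 21 22) (.ld 19 20 20)))

/-- `R[20] ←` the value of the key `R[21]` in the trie with the root `R[20]`. -/
def search : Code :=
  .seq (.const 24 0) (.seq (.ld 5 22 24) (.seq (.ld 4 23 24) (.seq (.iter 23 searchStep)
    (.ld 18 20 20))))

/-- One step of the insertion into a trie: the current node is copied to the block `R[26]`, and the
child on the search path is replaced by the next block. -/
def insertStep : Code :=
  .seq (.add 21 21 21) (.seq (.ld 18 29 20) (.seq (.ld 19 30 20) (.seq (.add 31 26 28)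
    (.seq (.ite (.lt 21 22) (.seq (.st 18 26 31) (.seq (.st 19 26 30) (.move 20 29)))
      (.seq (.sub 21 21 22) (.seq (.st 18 26 29) (.seq (.st 19 26 31) (.move 20 30)))))
      (.move 26 31)))))

/-- `R[27] ←` the root of a new trie that differs from the trie with the root `R[20]` in the value
of the key `R[21]`, which is `R[25]`.  Only the search path is copied. -/
def insert : Code :=
  .seq (.const 24 0) (.seq (.const 28 1) (.seq (.ld 5 22 24) (.seq (.ld 4 23 24)
    (.seq (.ld 3 26 24) (.seq (.move 27 26) (.seq (.iter 23 insertStep) (.seq (.st 18 26 25)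
      (.seq (.st 19 26 24) (.seq (.add 26 26 28) (.st 3 24 26))))))))))

theorem wp_search {w B K : ℕ} {Q : St → Prop} {s : St} {M B' : ℤ} (hB0 : 0 < B)
    (hK : s.fld 4 0 = K) (hM : s.fld 5 0 = M) (hMw : M + M ≤ 2 ^ w)
    (hc : Closed (s.fld 18) (s.fld 19) B') (hB : B' ≤ B) (h0 : 0 ≤ s.reg 20) (h1 : s.reg 20 < B')
    (c0 : 0 ≤ s.reg 21) (c1 : s.reg 21 < M)
    (hQ : ∀ reg : ℕ → ℤ, (∀ r, r < 20 → reg r = s.reg r) →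
      reg 20 = find (s.fld 18) (s.fld 19) M K (s.reg 20) (s.reg 21) →
      Q { s with reg := reg }) :
    search.wp w B K Q s := by
  have hB0' : (0 : ℤ) < B := by exact_mod_cast hB0
  simp only [search, wp_seq_const, wp_seq_ld, isField_of_lt, St.setReg_reg, St.setReg_fld,
    Function.update_self, Nat.cast_zero, le_refl, Nat.reduceLT, true_and, hB0', ne_eq,
    Nat.reduceEqDiff, not_false_eq_true, Function.update_of_ne]
  refine wp_seq.2 (wp_iter (fun n t => (∀ r, r < 20 → t.reg r = s.reg r) ∧
    t.fld = s.fld ∧ t.pos = s.pos ∧ t.lo = s.lo ∧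
    (0 ≤ t.reg 20 ∧ t.reg 20 < B') ∧ (0 ≤ t.reg 21 ∧ t.reg 21 < M) ∧
    t.reg 22 = M ∧ look (s.fld 18) (s.fld 19) M n (t.reg 20) (t.reg 21) =
      look (s.fld 18) (s.fld 19) M K (s.reg 20) (s.reg 21)) ?_ ?_ ?_ ?_)
  · simp [hK]
  · refine ⟨fun r hr => ?_, rfl, rfl, rfl, by simp [h0, h1], by simp [c0, c1], by simp [hM],
      by simp⟩
    simp only [St.setReg_reg]
    repeat rw [Function.update_of_ne (by omega)]
  · rintro n t ⟨hr, hf, hp, hlo, ⟨a0, a1⟩, ⟨b0, b1⟩, m, hl⟩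
    have hcl := hc _ a0 a1
    rw [look] at hl
    simp [searchStep, m, hf]
    refine ⟨⟨by omega, by omega⟩, ⟨by omega, by omega⟩, fun hlt => ⟨⟨a0, by omega⟩,
      fun r hr' => ?_, hp, hlo, hcl.1, ⟨by omega, hlt⟩, ?_⟩, fun hlt => ⟨⟨a0, by omega⟩,
      fun r hr' => ?_, hp, hlo, hcl.2, ⟨by omega, by omega⟩, ?_⟩⟩
    · repeat rw [Function.update_of_ne (by omega)]
      exact hr r hr'
    · rwa [if_pos hlt] at hl
    · repeat rw [Function.update_of_ne (by omega)]
      exact hr r hr'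
    · rwa [if_neg (by omega)] at hl
  · rintro ⟨reg, fld, pos, lo⟩ ⟨hr, rfl, rfl, rfl, ⟨a0, a1⟩, ⟨b0, b1⟩, m, hl⟩
    simp
    refine ⟨⟨a0, by simp only at a1; omega⟩, hQ _ (fun r hr' => ?_) ?_⟩
    · rw [Function.update_of_ne (by omega)]
      exact hr r hr'
    · simp only [Function.update_self]
      unfold find
      rw [← hl]
      rfl

/-- The specification of the insertion for a subtrie of height `n`: keys with the same leading bits
as `c` differ from `c` by a multiple of `M / 2 ^ n` after the shifts. -/
def InsertSpec (L R L' R' : ℤ → ℤ) (M v : ℤ) (n : ℕ) (A A' c : ℤ) : Prop :=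
  ∀ c', 0 ≤ c' → c' < M → (c' = c ∨ M ≤ |c' - c| * 2 ^ n) →
    find L' R' M n A' c' = if c' = c then v else find L R M n A c'

theorem InsertSpec.step {L R L' R' : ℤ → ℤ} {M v P A A' A₁ c : ℤ} {n : ℕ}
    (hc : Closed L R P) (hL : ∀ k, 0 ≤ k → k < P → L' k = L k ∧ R' k = R k)
    (h0 : 0 ≤ A) (h1 : A < P) (c0 : 0 ≤ c) (c1 : c < M)
    (hl : c + c < M → L' A' = A₁ ∧ R' A' = R A)
    (hr : ¬ c + c < M → L' A' = L A ∧ R' A' = A₁)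
    (h : InsertSpec L R L' R' M v n (if c + c < M then L A else R A) A₁
      (if c + c < M then c + c else c + c - M)) :
    InsertSpec L R L' R' M v (n + 1) A A' c := by
  intro c' d0 d1 hcc
  have hcl := hc A h0 h1
  have e : ∀ (L R : ℤ → ℤ) (A c : ℤ), find L R M (n + 1) A c =
      if c + c < M then find L R M n (L A) (c + c) else find L R M n (R A) (c + c - M) := by
    intro L R A c
    unfold find
    rw [look]
    split_ifs <;> rfl
  have habs : ∀ x y : ℤ, x = 2 * y → |x| * 2 ^ n = |y| * 2 ^ (n + 1) := by
    rintro x y rfl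
    rw [abs_mul, abs_two, pow_succ]; ring
  rw [e, e]
  by_cases hb : c + c < M
  · obtain ⟨g1, g2⟩ := hl hb
    rw [if_pos hb, if_pos hb] at h
    by_cases hb' : c' + c' < M
    · rw [if_pos hb', if_pos hb', g1, h (c' + c') (by omega) hb' ?_]
      · by_cases hcc' : c' = c
        · rw [if_pos hcc', if_pos (by omega)]
        · rw [if_neg hcc', if_neg (by omega)]
      · rcases hcc with rfl | hcc
        · exact Or.inl rfl
        · right; rwa [habs _ (c' - c) (by ring)]
    · rw [if_neg hb', if_neg hb', if_neg (by rintro rfl; exact hb' hb), g2,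
        find_congr hc hL n hcl.2.1 hcl.2.2]
  · obtain ⟨g1, g2⟩ := hr hb
    rw [if_neg hb, if_neg hb] at h
    by_cases hb' : c' + c' < M
    · rw [if_pos hb', if_pos hb', if_neg (by rintro rfl; exact hb hb'), g1,
        find_congr hc hL n hcl.1.1 hcl.1.2]
    · rw [if_neg hb', if_neg hb', g2, h (c' + c' - M) (by omega) (by omega) ?_]
      · by_cases hcc' : c' = c
        · rw [if_pos hcc', if_pos (by omega)]
        · rw [if_neg hcc', if_neg (by omega)]
      · rcases hcc with rfl | hcc
        · exact Or.inl rfl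
        · right; rwa [habs _ (c' - c) (by ring)]

theorem wp_insert {w B K : ℕ} {Q : St → Prop} {s : St} {M P : ℤ} (hP0 : 0 < P)
    (hPB : P + K < B) (hK : s.fld 4 0 = K) (hM : s.fld 5 0 = M) (hP : s.fld 3 0 = P)
    (hMK : M = 2 ^ K) (hMw : M + M ≤ 2 ^ w)
    (hc : Closed (s.fld 18) (s.fld 19) P) (h0 : 0 ≤ s.reg 20) (h1 : s.reg 20 < P)
    (c0 : 0 ≤ s.reg 21) (c1 : s.reg 21 < M) (v0 : 0 ≤ s.reg 25) (v1 : s.reg 25 < P)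
    (hQ : ∀ s' : St, (∀ r, r < 20 → s'.reg r = s.reg r) → s'.reg 27 = P → s'.pos = s.pos →
      s'.lo = s.lo → (∀ f, f ≠ 18 → f ≠ 19 → f ≠ 3 → s'.fld f = s.fld f) → s'.fld 3 0 = P + K + 1 →
      (∀ k, k < P → s'.fld 18 k = s.fld 18 k ∧ s'.fld 19 k = s.fld 19 k) →
      Closed (s'.fld 18) (s'.fld 19) (P + K + 1) →
      (∀ c, 0 ≤ c → c < M → find (s'.fld 18) (s'.fld 19) M K P c =
        if c = s.reg 21 then s.reg 25 else find (s.fld 18) (s.fld 19) M K (s.reg 20) c) →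
      Q s') :
    insert.wp w B K Q s := by
  have hB0' : (0 : ℤ) < B := by omega
  simp only [insert, wp_seq_const, wp_seq_ld, wp_seq_move, isField_of_lt, St.setReg_reg,
    St.setReg_fld, Function.update_self, Nat.cast_zero, le_refl, Nat.reduceLT, true_and, hB0',
    ne_eq, Nat.reduceEqDiff, not_false_eq_true, Function.update_of_ne, Nat.cast_one, hM, hP, hK]
  refine wp_seq.2 (wp_iter (fun n t => n ≤ K ∧ (∀ r, r < 20 → t.reg r = s.reg r) ∧
    (t.reg 22 = M ∧ t.reg 24 = 0 ∧ t.reg 25 = s.reg 25 ∧ t.reg 26 = P + K - n ∧ t.reg 27 = P ∧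
      t.reg 28 = 1) ∧
    (0 ≤ t.reg 20 ∧ t.reg 20 < P) ∧ (0 ≤ t.reg 21 ∧ t.reg 21 < M) ∧ t.pos = s.pos ∧ t.lo = s.lo ∧
    (∀ f, f ≠ 18 → f ≠ 19 → t.fld f = s.fld f) ∧
    (∀ k, k < P → t.fld 18 k = s.fld 18 k ∧ t.fld 19 k = s.fld 19 k) ∧
    (∀ k, P ≤ k → k < P + K - n → (0 ≤ t.fld 18 k ∧ t.fld 18 k < P + K + 1) ∧
      (0 ≤ t.fld 19 k ∧ t.fld 19 k < P + K + 1)) ∧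
    ∀ L' R' : ℤ → ℤ, (∀ k, k < P + K - n → L' k = t.fld 18 k ∧ R' k = t.fld 19 k) →
      InsertSpec (s.fld 18) (s.fld 19) L' R' M (s.reg 25) n (t.reg 20) (t.reg 26) (t.reg 21) →
      InsertSpec (s.fld 18) (s.fld 19) L' R' M (s.reg 25) K (s.reg 20) P (s.reg 21)) ?_ ?_ ?_ ?_)
  · simp
  · refine ⟨le_rfl, fun r hr => ?_, ?_, ?_, ?_, rfl, rfl, fun _ _ _ => rfl, fun _ _ => ⟨rfl, rfl⟩,
      fun k hk hk' => by omega, fun L' R' hL h => ?_⟩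
    · simp only [St.setReg_reg]
      repeat rw [Function.update_of_ne (by omega)]
    · simp
    · simpa using ⟨h0, h1⟩
    · simpa using ⟨c0, c1⟩
    · simpa using h
  · rintro n t ⟨hn, hr, ⟨r22, r24, r25, r26, r27, r28⟩, ⟨a0, a1⟩, ⟨b0, b1⟩, hpos, hlo, hf, hP', hcl,
      hS⟩
    push_cast at r26 hcl hS
    have hcA := hc _ a0 a1
    obtain ⟨p18, p19⟩ := hP' _ a1
    simp [insertStep, wp_seq_lt, r22, r24, r25, r26, r27, r28, p18, p19]
    refine ⟨⟨a0, by omega⟩, ⟨b0, by omega⟩, ⟨by omega, by omega⟩, fun hlt =>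
      ⟨⟨by omega, by omega⟩, by omega, fun r hr' => ?_, by omega, hcA.1, ⟨b0, hlt⟩, hpos, hlo,
      fun f h18 h19 => ?_, fun k hk => ?_, fun k hk hk' => ?_, fun L' R' hL hI => ?_⟩,
      fun hlt => ⟨⟨by omega, by omega⟩, by omega,
      fun r hr' => ?_, by omega, hcA.2, ⟨hlt, by omega⟩, hpos, hlo, fun f h18 h19 => ?_,
      fun k hk => ?_, fun k hk hk' => ?_, fun L' R' hL hI => ?_⟩⟩
    · repeat rw [Function.update_of_ne (by omega)]
      exact hr r hr'
    · rw [Function.update_of_ne h19, Function.update_of_ne h18, hf f h18 h19]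
    · rw [Function.update_of_ne (by omega), Function.update_of_ne (by omega)]
      exact hP' k hk
    · by_cases hkk : k = P + K - (n + 1)
      · subst hkk; simp only [Function.update_self]; omega
      · rw [Function.update_of_ne hkk, Function.update_of_ne hkk]
        have := hcl k hk (by omega)
        omega
    · refine hS L' R' (fun k hk => ?_) (InsertSpec.step (P := P) hc (fun k k0 k1 => ?_) a0 a1 b0 b1
        (A₁ := P + K - (n + 1) + 1) (fun _ => ?_) (fun h => absurd hlt h) ?_)
      · have := hL k (by omega)
        rwa [Function.update_of_ne (by omega), Function.update_of_ne (by omega)] at this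
      · have := hL k (by omega)
        rw [Function.update_of_ne (by omega), Function.update_of_ne (by omega)] at this
        have := hP' k k1
        omega
      · have := hL (P + K - (n + 1)) (by omega)
        rw [r26]
        simpa only [Function.update_self] using this
      · rw [if_pos hlt, if_pos hlt]
        exact hI
    · repeat rw [Function.update_of_ne (by omega)]
      exact hr r hr'
    · rw [Function.update_of_ne h19, Function.update_of_ne h18, hf f h18 h19]
    · rw [Function.update_of_ne (by omega), Function.update_of_ne (by omega)]
      exact hP' k hk
    · by_cases hkk : k = P + K - (n + 1)
      · subst hkk; simp only [Function.update_self]; omega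
      · rw [Function.update_of_ne hkk, Function.update_of_ne hkk]
        have := hcl k hk (by omega)
        omega
    · refine hS L' R' (fun k hk => ?_) (InsertSpec.step (P := P) hc (fun k k0 k1 => ?_) a0 a1 b0 b1
        (A₁ := P + K - (n + 1) + 1) (fun h => absurd h (not_lt.2 hlt)) (fun _ => ?_) ?_)
      · have := hL k (by omega)
        rwa [Function.update_of_ne (by omega), Function.update_of_ne (by omega)] at this
      · have := hL k (by omega)
        rw [Function.update_of_ne (by omega), Function.update_of_ne (by omega)] at this
        have := hP' k k1
        omega
      · have := hL (P + K - (n + 1)) (by omega)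
        rw [r26]
        simpa only [Function.update_self] using this
      · rw [if_neg (not_lt.2 hlt), if_neg (not_lt.2 hlt)]
        exact hI
  · rintro t ⟨-, hr, ⟨r22, r24, r25, r26, r27, r28⟩, ⟨a0, a1⟩, ⟨b0, b1⟩, hpos, hlo, hf, hP', hcl,
      hS⟩
    simp only [Nat.cast_zero, sub_zero] at r26 hcl hS
    simp [r24, r25, r26, r28]
    refine ⟨by omega, by omega, hQ _ (fun r hr' => ?_) ?_ hpos hlo
      (fun f h18 h19 h3 => ?_) ?_ (fun k hk => ?_) (fun k k0 k1 => ?_) fun c d0 d1 => ?_⟩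
    · simp only [St.setFld_reg, St.setReg_reg]
      rw [Function.update_of_ne (by omega)]
      exact hr r hr'
    · simp [r27]
    · simp only [St.setFld_fld, St.setReg_fld]
      rw [Function.update_of_ne h3, Function.update_of_ne h19, Function.update_of_ne h18,
          hf f h18 h19]
    · simp
    · simp only [St.setFld_fld, St.setReg_fld, Function.update_self, ne_eq,
         Nat.reduceEqDiff, not_false_eq_true, Function.update_of_ne]
      rw [Function.update_of_ne (by omega), Function.update_of_ne (by omega)]
      exact hP' k hk
    · simp only [St.setFld_fld, St.setReg_fld, Function.update_self, ne_eq,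
         Nat.reduceEqDiff, not_false_eq_true, Function.update_of_ne]
      by_cases hkk : k = P + K
      · subst hkk; simp only [Function.update_self]; omega
      · rw [Function.update_of_ne hkk, Function.update_of_ne hkk]
        by_cases hkP : k < P
        · have := hP' k hkP
          have := hc k k0 hkP
          omega
        · exact hcl k (by omega) (by omega)
    · simp only [St.setFld_fld, St.setReg_fld, Function.update_self, ne_eq,
         Nat.reduceEqDiff, not_false_eq_true, Function.update_of_ne]
      refine hS _ _ (fun k hk => ?_) (fun c' e0 e1 he => ?_) c d0 d1 ?_
      · rw [Function.update_of_ne (by omega), Function.update_of_ne (by omega)]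
        exact ⟨rfl, rfl⟩
      · rcases he with rfl | he
        · simp [find, look, r26]
        · rw [pow_zero, mul_one] at he
          have := abs_lt.2 (⟨by omega, by omega⟩ : -M < c' - t.reg 21 ∧ c' - t.reg 21 < M)
          omega
      · by_cases hcc : c = s.reg 21
        · exact Or.inl hcc
        · right
          have h1 : 1 ≤ |c - s.reg 21| := Int.one_le_abs (by omega)
          rw [hMK]
          exact le_mul_of_one_le_left (by positivity) h1

end Code

end WordRAM

namespace Eertree

open WordRAM WordRAM.Code

variable {σ : ℕ}

/-! ### The representation of the eertree in the memory -/

/-- The nodes of the palindromes in `X` and the root `odd`. -/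
def nodeSet (X : Set (List (Fin σ))) : Set (Node σ) := {v | v = .odd ∨ ∃ t ∈ X, v = .pal t}

theorem odd_mem_nodeSet (X : Set (List (Fin σ))) : Node.odd ∈ nodeSet X := Or.inl rfl

theorem pal_mem_nodeSet {X : Set (List (Fin σ))} {t : List (Fin σ)} (h : t ∈ X) :
    Node.pal t ∈ nodeSet X := Or.inr ⟨t, h, rfl⟩

theorem ofOption_mem_nodeSet {X : Set (List (Fin σ))} {o : Option (List (Fin σ))}
    (h : ∀ y ∈ o, y ∈ X) : Node.ofOption o ∈ nodeSet X := by
  cases o with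
  | none => exact odd_mem_nodeSet X
  | some y => exact pal_mem_nodeSet (h y rfl)

theorem nodeSet_mono {X Y : Set (List (Fin σ))} (h : X ⊆ Y) : nodeSet X ⊆ nodeSet Y := by
  rintro v (rfl | ⟨t, ht, rfl⟩)
  · exact odd_mem_nodeSet Y
  · exact pal_mem_nodeSet (h ht)

theorem wrap_ne_nil (v : Node σ) (c : Fin σ) : v.wrap c ≠ [] := by cases v <;> simp [Node.wrap]

theorem wrap_injective {v v' : Node σ} {c c' : Fin σ} (h : v.wrap c = v'.wrap c') :
    v = v' ∧ c = c' := by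
  cases v <;> cases v' <;> simp [Node.wrap] at h ⊢
  · exact h
  · exact ⟨h.2.1, h.1⟩

theorem length_wrap (v : Node σ) (c : Fin σ) : ((v.wrap c).length : ℤ) = v.len + 2 := by
  cases v with
  | odd => rfl
  | pal t => simp [Node.wrap, Node.len]; omega

/-- The fields `12, …, 15` of the block `h v` hold the length and the suffix link of the node `v`,
the root of the trie of its edges, and the root of the trie that maps a character `c` to the
longest palindromic suffix preceded by `c`.  Nodes are never deleted; `X` is the set of all
palindromes for which a node has been created.  The field `3` of the block `0` is the number of
blocks in use. -/
structure Heap (K : ℕ) (fld : ℕ → ℤ → ℤ) (h : Node σ → ℤ) (X : Set (List (Fin σ))) : Prop where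
  height : fld 4 0 = K
  width : fld 5 0 = 2 ^ K
  alphabet : σ ≤ 2 ^ K
  blocks : 3 ≤ fld 3 0
  nil_mem : [] ∈ X
  palindrome : ∀ t ∈ X, t.Palindrome
  link_mem : ∀ t ∈ X, t ≠ [] → linkStr t ∈ X
  inner_mem : ∀ t c, c :: (t ++ [c]) ∈ X → t ∈ X
  even : h (.pal []) = 1
  odd : h .odd = 2
  inj : Set.InjOn h (nodeSet X)
  bound : ∀ v ∈ nodeSet X, 1 ≤ h v ∧ h v < fld 3 0
  len : ∀ v ∈ nodeSet X, fld 12 (h v) = v.len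
  link : ∀ v ∈ nodeSet X, fld 13 (h v) = h (link v)
  nextRoot : ∀ v ∈ nodeSet X, 0 ≤ fld 14 (h v) ∧ fld 14 (h v) < fld 3 0
  beforeRoot : ∀ v ∈ nodeSet X, 0 ≤ fld 15 (h v) ∧ fld 15 (h v) < fld 3 0
  next : ∀ v ∈ nodeSet X, ∀ c : Fin σ, (v.wrap c ∈ X →
    find (fld 18) (fld 19) (2 ^ K) K (fld 14 (h v)) (c : ℕ) = h (.pal (v.wrap c))) ∧
    (v.wrap c ∉ X → find (fld 18) (fld 19) (2 ^ K) K (fld 14 (h v)) (c : ℕ) = 0)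
  before : ∀ t ∈ X, ∀ c : Fin σ, ∃ o, IsLongestBefore t c o ∧ (∀ y ∈ o, y ∈ X) ∧
    find (fld 18) (fld 19) (2 ^ K) K (fld 15 (h (.pal t))) (c : ℕ) = o.elim 0 fun y => h (.pal y)
  closed : Closed (fld 18) (fld 19) (fld 3 0)
  null : fld 18 0 = 0 ∧ fld 19 0 = 0

theorem link_mem_nodeSet {X : Set (List (Fin σ))} (hX : ∀ t ∈ X, t ≠ [] → linkStr t ∈ X)
    {v : Node σ} (hv : v ∈ nodeSet X) : link v ∈ nodeSet X := by
  rcases hv with rfl | ⟨t, ht, rfl⟩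
  · exact odd_mem_nodeSet X
  · by_cases h0 : t = []
    · subst h0; exact odd_mem_nodeSet X
    · rw [link_pal h0]; exact pal_mem_nodeSet (hX t ht h0)

theorem Heap.natCast_lt {K : ℕ} {fld : ℕ → ℤ → ℤ} {h : Node σ → ℤ} {X : Set (List (Fin σ))}
    (H : Heap K fld h X) (c : Fin σ) : ((c : ℕ) : ℤ) < 2 ^ K := by
  have h1 := c.isLt
  have h2 := H.alphabet
  exact_mod_cast h1.trans_le h2

/-- Allocating blocks and extending the tries does not affect the heap. -/
theorem Heap.congr {K : ℕ} {fld fld' : ℕ → ℤ → ℤ} {h : Node σ → ℤ} {X : Set (List (Fin σ))}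
    (H : Heap K fld h X) (h3 : fld 3 0 ≤ fld' 3 0) (h4 : fld' 4 0 = fld 4 0)
    (h5 : fld' 5 0 = fld 5 0)
    (hn : ∀ f, 12 ≤ f → f ≤ 15 → ∀ k, k < fld 3 0 → fld' f k = fld f k)
    (ht : ∀ k, k < fld 3 0 → fld' 18 k = fld 18 k ∧ fld' 19 k = fld 19 k)
    (hc : Closed (fld' 18) (fld' 19) (fld' 3 0)) : Heap K fld' h X := by
  have hb := H.bound
  have e : ∀ v ∈ nodeSet X, fld' 12 (h v) = fld 12 (h v) ∧ fld' 13 (h v) = fld 13 (h v) ∧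
      fld' 14 (h v) = fld 14 (h v) ∧ fld' 15 (h v) = fld 15 (h v) := fun v hv =>
    ⟨hn 12 (by omega) (by omega) _ (hb v hv).2, hn 13 (by omega) (by omega) _ (hb v hv).2,
      hn 14 (by omega) (by omega) _ (hb v hv).2, hn 15 (by omega) (by omega) _ (hb v hv).2⟩
  have hf : ∀ r c, 0 ≤ r → r < fld 3 0 →
      find (fld' 18) (fld' 19) (2 ^ K) K r c = find (fld 18) (fld 19) (2 ^ K) K r c :=
    fun r c h0 h1 => find_congr H.closed (fun k _ hk => ht k hk) K h0 h1
  refine ⟨h4.trans H.height, h5.trans H.width, H.alphabet, H.blocks.trans h3, H.nil_mem,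
    H.palindrome, H.link_mem, H.inner_mem, H.even, H.odd, H.inj,
    fun v hv => ⟨(hb v hv).1, (hb v hv).2.trans_le h3⟩,
    fun v hv => (e v hv).1.trans (H.len v hv), fun v hv => (e v hv).2.1.trans (H.link v hv),
    fun v hv => ?_, fun v hv => ?_, fun v hv c => ?_, fun t ht c => ?_, hc, ?_⟩
  · rw [(e v hv).2.2.1]
    exact ⟨(H.nextRoot v hv).1, (H.nextRoot v hv).2.trans_le h3⟩
  · rw [(e v hv).2.2.2]
    exact ⟨(H.beforeRoot v hv).1, (H.beforeRoot v hv).2.trans_le h3⟩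
  · rw [(e v hv).2.2.1, hf _ _ (H.nextRoot v hv).1 (H.nextRoot v hv).2]
    exact H.next v hv c
  · have hv := pal_mem_nodeSet ht
    rw [(e _ hv).2.2.2, hf _ _ (H.beforeRoot _ hv).1 (H.beforeRoot _ hv).2]
    exact H.before t ht c
  · have h0 := ht 0 (by have := H.blocks; omega)
    exact ⟨h0.1.trans H.null.1, h0.2.trans H.null.2⟩

open Classical in
/-- The heap after the creation of a node `x = c u c` in the block `q`. -/
theorem Heap.insert {K : ℕ} {fld fld' : ℕ → ℤ → ℤ} {h : Node σ → ℤ} {X : Set (List (Fin σ))}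
    (H : Heap K fld h X) {o : Option (List (Fin σ))} (ho : ∀ y ∈ o, y ∈ X) {c b : Fin σ} {q : ℤ}
    {x : List (Fin σ)} (hx : x = (Node.ofOption o).wrap c) (hxX : x ∉ X) (hz : linkStr x ∈ X)
    (hb : (b :: linkStr x) <:+ x) (hq : fld 3 0 ≤ q) (hq' : q < fld' 3 0)
    (h4 : fld' 4 0 = fld 4 0) (h5 : fld' 5 0 = fld 5 0)
    (h12 : ∀ k, k < fld 3 0 → fld' 12 k = fld 12 k) (h13 : ∀ k, k < fld 3 0 → fld' 13 k = fld 13 k)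
    (h15 : ∀ k, k < fld 3 0 → fld' 15 k = fld 15 k)
    (h14 : ∀ k, k < fld 3 0 → k ≠ h (Node.ofOption o) → fld' 14 k = fld 14 k)
    (ht : ∀ k, k < fld 3 0 → fld' 18 k = fld 18 k ∧ fld' 19 k = fld 19 k)
    (hc : Closed (fld' 18) (fld' 19) (fld' 3 0))
    (q12 : fld' 12 q = x.length) (q13 : fld' 13 q = h (.pal (linkStr x))) (q14 : fld' 14 q = 0)
    (q15 : 0 ≤ fld' 15 q ∧ fld' 15 q < fld' 3 0)
    (u14 : 0 ≤ fld' 14 (h (Node.ofOption o)) ∧ fld' 14 (h (Node.ofOption o)) < fld' 3 0)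
    (hbefore : ∀ a : Fin σ, find (fld' 18) (fld' 19) (2 ^ K) K (fld' 15 q) (a : ℕ) =
      if a = b then h (.pal (linkStr x)) else
        find (fld 18) (fld 19) (2 ^ K) K (fld 15 (h (.pal (linkStr x)))) (a : ℕ))
    (hnext : ∀ a : Fin σ,
      find (fld' 18) (fld' 19) (2 ^ K) K (fld' 14 (h (Node.ofOption o))) (a : ℕ) =
        if a = c then q else
          find (fld 18) (fld 19) (2 ^ K) K (fld 14 (h (Node.ofOption o))) (a : ℕ)) :
    Heap K fld' (Function.update h (.pal x) q) (insert x X) := by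
  have hx0 : x ≠ [] := by rw [hx]; exact wrap_ne_nil _ _
  have hxp : x.Palindrome := by
    rw [hx]; exact palindrome_wrap (fun y hy => H.palindrome y (ho y hy)) c
  have hold : ∀ v ∈ nodeSet X, Function.update h (.pal x) q v = h v := by
    intro v hv
    refine Function.update_of_ne ?_ _ _
    rintro rfl
    rcases hv with hv | ⟨t, ht, hv⟩
    · cases hv
    · cases hv; exact hxX ht
  have hnew : Function.update h (.pal x) q (.pal x) = q := Function.update_self _ _ _
  have hmem : ∀ v ∈ nodeSet (Insert.insert x X), v = .pal x ∨ v ∈ nodeSet X := by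
    rintro v (rfl | ⟨t, rfl | ht, rfl⟩)
    · exact Or.inr (odd_mem_nodeSet X)
    · exact Or.inl rfl
    · exact Or.inr (pal_mem_nodeSet ht)
  have hu := ofOption_mem_nodeSet ho
  have hB := H.bound
  have h33 : fld 3 0 ≤ fld' 3 0 := hq.trans hq'.le
  have hf : ∀ r a, 0 ≤ r → r < fld 3 0 →
      find (fld' 18) (fld' 19) (2 ^ K) K r a = find (fld 18) (fld 19) (2 ^ K) K r a :=
    fun r a h0 h1 => find_congr H.closed (fun k _ hk => ht k hk) K h0 h1
  have null : fld' 18 0 = 0 ∧ fld' 19 0 = 0 := by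
    have h0 := ht 0 (by have := H.blocks; omega)
    exact ⟨h0.1.trans H.null.1, h0.2.trans H.null.2⟩
  have hlm : ∀ t ∈ Insert.insert x X, t ≠ [] → linkStr t ∈ Insert.insert x X := by
    rintro t (rfl | ht) h0
    · exact Or.inr hz
    · exact Or.inr (H.link_mem t ht h0)
  have hwu : ∀ v ∈ nodeSet X, v ≠ Node.ofOption o → ∀ a, v.wrap a ≠ x := by
    intro v _ hne a he
    exact hne (wrap_injective (he.trans hx)).1
  refine ⟨h4.trans H.height, h5.trans H.width, H.alphabet, H.blocks.trans h33, Or.inr H.nil_mem,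
    ?_, hlm, ?_, ?_, ?_, ?_, fun v hv => ?_, fun v hv => ?_, fun v hv => ?_, fun v hv => ?_,
    fun v hv => ?_, fun v hv a => ?_, fun t ht' a => ?_, hc, null⟩
  · rintro t (rfl | ht)
    · exact hxp
    · exact H.palindrome t ht
  · rintro t a (he | ht)
    · have : (Node.pal t).wrap a = (Node.ofOption o).wrap c := he.trans hx
      obtain ⟨h1, -⟩ := wrap_injective this
      cases o with
      | none => cases h1
      | some y => cases h1; exact Or.inr (ho _ rfl)
    · exact Or.inr (H.inner_mem t a ht)
  · rw [hold _ (pal_mem_nodeSet H.nil_mem), H.even]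
  · rw [hold _ (odd_mem_nodeSet X), H.odd]
  · intro v hv v' hv' he
    rcases hmem v hv with rfl | h1 <;> rcases hmem v' hv' with rfl | h2
    · rfl
    · rw [hnew, hold _ h2] at he; have := (hB _ h2).2; omega
    · rw [hnew, hold _ h1] at he; have := (hB _ h1).2; omega
    · rw [hold _ h1, hold _ h2] at he; exact H.inj h1 h2 he
  · rcases hmem v hv with rfl | h1
    · rw [hnew]; have := H.blocks; omega
    · rw [hold v h1]; exact ⟨(hB v h1).1, (hB v h1).2.trans_le h33⟩
  · rcases hmem v hv with rfl | h1
    · rw [hnew, q12]; rfl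
    · rw [hold v h1, h12 _ (hB v h1).2, H.len v h1]
  · rcases hmem v hv with rfl | h1
    · rw [hnew, q13, link_pal hx0, hold _ (pal_mem_nodeSet hz)]
    · rw [hold v h1, h13 _ (hB v h1).2, H.link v h1, hold _ (link_mem_nodeSet H.link_mem h1)]
  · rcases hmem v hv with rfl | h1
    · rw [hnew, q14]; have := H.blocks; omega
    · rw [hold v h1]
      by_cases hvu : v = Node.ofOption o
      · rw [hvu]; exact u14
      · rw [h14 _ (hB v h1).2 fun he => hvu (H.inj h1 hu he)]
        exact ⟨(H.nextRoot v h1).1, (H.nextRoot v h1).2.trans_le h33⟩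
  · rcases hmem v hv with rfl | h1
    · rw [hnew]; exact q15
    · rw [hold v h1, h15 _ (hB v h1).2]
      exact ⟨(H.beforeRoot v h1).1, (H.beforeRoot v h1).2.trans_le h33⟩
  · rcases hmem v hv with rfl | h1
    · rw [hnew, q14, find_zero null.1 null.2]
      refine ⟨fun hm => ?_, fun _ => rfl⟩
      exfalso
      rcases hm with he | hm
      · have := length_wrap (.pal x) a
        rw [he] at this
        simp only [Node.len] at this
        omega
      · exact hxX (H.inner_mem x a hm)
    · rw [hold v h1]
      by_cases hvu : v = Node.ofOption o
      · subst hvu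
        rw [hnext a]
        by_cases hac : a = c
        · subst hac
          rw [if_pos rfl, ← hx, hnew]
          exact ⟨fun _ => rfl, fun hn => absurd (Or.inl rfl) hn⟩
        · rw [if_neg hac]
          have hne : (Node.ofOption o).wrap a ≠ x := fun he =>
            hac (wrap_injective (he.trans hx)).2
          refine ⟨fun hm => ?_, fun hm => ?_⟩
          · have hm' : (Node.ofOption o).wrap a ∈ X := hm.resolve_left hne
            rw [(H.next _ h1 a).1 hm', hold _ (pal_mem_nodeSet hm')]
          · exact (H.next _ h1 a).2 fun hm' => hm (Or.inr hm')
      · rw [h14 _ (hB v h1).2 fun he => hvu (H.inj h1 hu he),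
          hf _ _ (H.nextRoot v h1).1 (H.nextRoot v h1).2]
        refine ⟨fun hm => ?_, fun hm => ?_⟩
        · have hm' : v.wrap a ∈ X := hm.resolve_left (hwu v h1 hvu a)
          rw [(H.next _ h1 a).1 hm', hold _ (pal_mem_nodeSet hm')]
        · exact (H.next _ h1 a).2 fun hm' => hm (Or.inr hm')
  · rcases ht' with rfl | ht'
    · rw [hnew, hbefore a]
      obtain ⟨o', g1, g2, g3⟩ := H.before _ hz a
      refine ⟨if a = b then some (linkStr t) else o', isLongestBefore_of_link hx0 hb g1, ?_, ?_⟩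
      · split_ifs
        · rintro y hy; cases hy; exact Or.inr hz
        · exact fun y hy => Or.inr (g2 y hy)
      · split_ifs
        · simp [hold _ (pal_mem_nodeSet hz)]
        · rw [g3]
          cases o' with
          | none => rfl
          | some y => simp [hold _ (pal_mem_nodeSet (g2 y rfl))]
    · have hv := pal_mem_nodeSet ht'
      obtain ⟨o', g1, g2, g3⟩ := H.before _ ht' a
      refine ⟨o', g1, fun y hy => Or.inr (g2 y hy), ?_⟩
      rw [hold _ hv, h15 _ (hB _ hv).2, hf _ _ (H.beforeRoot _ hv).1 (H.beforeRoot _ hv).2, g3]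
      cases o' with
      | none => rfl
      | some y => simp [hold _ (pal_mem_nodeSet (g2 y rfl))]

/-- The fields `16` and `17` of the block of the palindrome `t` count the positions at which `t` is
the longest palindrome and the nodes with the suffix link `t`; the field `2` of the block `0` is
the number of palindromic substrings. -/
structure Counts (fld : ℕ → ℤ → ℤ) (h : Node σ → ℤ) (X : Set (List (Fin σ)))
    (s : List (Fin σ)) : Prop where
  subset : palSubstrings s ⊆ X
  cnt : ∀ t ∈ X, t ≠ [] → fld 16 (h (.pal t)) = sufcnt s t
  linkCount : ∀ t ∈ X, t ≠ [] → fld 17 (h (.pal t)) = linkCount s t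
  count : fld 2 0 = (palSubstrings s).ncard

/-- The field of the block `0` that holds the last position of the string, in the direction `v`. -/
def endFld (v : Bool) : ℕ := v.toNat

/-- The array of the surfaces at their start positions, in the direction `v`; the array at their
end positions is `startArr !v`. -/
def startArr (v : Bool) : ℕ := 1 + v.toNat

section

variable {v : Bool} {f : ℕ}

theorem endFld_le : endFld v ≤ 1 := v.toNat_le

@[simp] theorem isField_endFld : IsField (endFld v) := Or.inl (by have := @endFld_le v; omega)

@[simp] theorem endFld_not_ne : endFld (!v) ≠ endFld v := by cases v <;> simp [endFld]

@[simp] theorem endFld_ne (h : 2 ≤ f) : endFld v ≠ f := by have := @endFld_le v; omega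

@[simp] theorem ne_endFld (h : 2 ≤ f) : f ≠ endFld v := by have := @endFld_le v; omega

@[simp] theorem startArr_lt : startArr v < 3 := by cases v <;> simp [startArr]

@[simp] theorem startArr_ne_zero : startArr v ≠ 0 := by cases v <;> simp [startArr]

@[simp] theorem zero_ne_startArr : 0 ≠ startArr v := by cases v <;> simp [startArr]

@[simp] theorem startArr_not_ne : startArr (!v) ≠ startArr v := by cases v <;> simp [startArr]

@[simp] theorem startArr_ne_not : startArr v ≠ startArr (!v) := by cases v <;> simp [startArr]

@[simp] theorem view_inj {p q : ℤ} : view v p = view v q ↔ p = q := by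
  cases v <;> simp [view]

end

/-- The string `s` and its surfaces are stored in the position arrays: in the direction `v` the
`i`-th character has position `i - e`, where `e` is the last position in the reverse direction.
The start and end positions of the surfaces are given by the functions `S` and `T`, whose values
are the empty string where there is no surface. -/
structure Arrays (v : Bool) (fld pos : ℕ → ℤ → ℤ) (h : Node σ → ℤ) (s : List (Fin σ))
    (S T : ℕ → List (Fin σ)) : Prop where
  length : fld (endFld v) 0 + fld (endFld !v) 0 = s.length
  char : ∀ i : ℕ, ∀ c : Fin σ, 1 ≤ i → s[i - 1]? = some c →
    pos 0 (view v (i - fld (endFld !v) 0)) = (c : ℕ)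
  start : ∀ i : ℕ, 1 ≤ i → i ≤ s.length →
    pos (startArr v) (view v (i - fld (endFld !v) 0)) = h (.pal (S i))
  finish : ∀ i : ℕ, 1 ≤ i → i ≤ s.length →
    pos (startArr !v) (view v (i - fld (endFld !v) 0)) = h (.pal (T i))

theorem Arrays.reverse {v : Bool} {fld pos : ℕ → ℤ → ℤ} {h : Node σ → ℤ} {s : List (Fin σ)}
    (A : Arrays v fld pos h s (presurf s) (sufsurf s)) :
    Arrays (!v) fld pos h s.reverse (presurf s.reverse) (sufsurf s.reverse) := by
  have hlen := A.length
  have key : ∀ i : ℕ, 1 ≤ i → i ≤ s.length → view (!v) (i - fld (endFld !!v) 0) =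
      view v ((s.length + 1 - i : ℕ) - fld (endFld !v) 0) := by
    intro i h1 h2
    rw [Bool.not_not]
    have : view (!v) (i - fld (endFld v) 0) = view v (1 - (i - fld (endFld v) 0)) := by
      cases v <;> simp [view]
    rw [this]
    congr 1
    push_cast [Nat.cast_sub (by omega : i ≤ s.length + 1)]
    omega
  refine ⟨?_, fun i c h1 hc => ?_, fun i h1 h2 => ?_, fun i h1 h2 => ?_⟩
  · rw [Bool.not_not, List.length_reverse]; omega
  · have h2 : i ≤ s.length := by
      by_contra hc'
      rw [List.getElem?_eq_none (by simp; omega)] at hc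
      cases hc
    rw [key i h1 h2]
    refine A.char _ c (by omega) ?_
    rwa [← getElem?_reverse' h1 h2]
  · rw [List.length_reverse] at h2
    rw [key i h1 h2, presurf_reverse h1 h2]
    exact A.finish _ (by omega) (by omega)
  · rw [List.length_reverse] at h2
    rw [key i h1 h2, sufsurf_reverse h1 h2, Bool.not_not]
    exact A.start _ (by omega) (by omega)

theorem Counts.reverse {fld : ℕ → ℤ → ℤ} {h : Node σ → ℤ} {X : Set (List (Fin σ))}
    {s : List (Fin σ)} (hX : ∀ t ∈ X, t.Palindrome) (C : Counts fld h X s) :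
    Counts fld h X s.reverse := by
  refine ⟨?_, fun t ht h0 => ?_, fun t ht h0 => ?_, ?_⟩
  · rw [palSubstrings_reverse]; exact C.subset
  · rw [sufcnt_reverse, precnt_eq_sufcnt h0 (hX t ht)]; exact C.cnt t ht h0
  · rw [linkCount_reverse]; exact C.linkCount t ht h0
  · rw [palSubstrings_reverse]; exact C.count

/-- The memory holds the double-ended eertree of `s`, viewed in the direction `v`. -/
structure Inv (K : ℕ) (v : Bool) (fld pos : ℕ → ℤ → ℤ) (h : Node σ → ℤ) (X : Set (List (Fin σ)))
    (s : List (Fin σ)) : Prop where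
  heap : Heap K fld h X
  counts : Counts fld h X s
  arrays : Arrays v fld pos h s (presurf s) (sufsurf s)
  end_lt : ∀ v, fld (endFld v) 0 < fld 3 0

/-- The operations at the front are those at the back for this view of the memory. -/
theorem Inv.reverse {K : ℕ} {v : Bool} {fld pos : ℕ → ℤ → ℤ} {h : Node σ → ℤ}
    {X : Set (List (Fin σ))} {s : List (Fin σ)} (I : Inv K v fld pos h X s) :
    Inv K (!v) fld pos h X s.reverse :=
  ⟨I.heap, I.counts.reverse I.heap.palindrome, I.arrays.reverse, I.end_lt⟩

/-! ### Appending a character -/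

/-- The registers `0`, …, `3` hold the character to be appended and small constants. -/
structure Consts (reg : ℕ → ℤ) (c : Fin σ) : Prop where
  char : reg 0 = (c : ℕ)
  zero : reg 1 = 0
  one : reg 2 = 1
  two : reg 3 = 2

/-- The addresses of all blocks below `B` and the doubled keys of the tries fit into words. -/
structure Fits (w B K : ℕ) : Prop where
  blocks : 32 * B ≤ 2 ^ w
  keys : (2 : ℤ) ^ K + 2 ^ K ≤ 2 ^ w

theorem Consts.congr {reg reg' : ℕ → ℤ} {c : Fin σ} (h : Consts reg c)
    (e : ∀ r, r < 4 → reg' r = reg r) : Consts reg' c :=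
  ⟨(e 0 (by omega)).trans h.char, (e 1 (by omega)).trans h.zero, (e 2 (by omega)).trans h.one,
    (e 3 (by omega)).trans h.two⟩

/-- `R[1], R[2], R[3] ← 0, 1, 2`, `R[4] ←` the last position of the string, `R[6] ←` its length,
`R[7] ←` the node of its longest palindromic suffix. -/
def loadSuffix (v : Bool) : Code :=
  .seq (.const 1 0) (.seq (.const 2 1) (.seq (.const 3 2) (.seq (.ld (endFld v) 4 1)
  (.seq (.ld (endFld !v) 5 1) (.seq (.add 6 4 5) (.seq (.move 7 2)
  (.ite (.eq 6 1) .skip (.pld (startArr !v) v 7 4))))))))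

/-- `R[10] ←` the node of the longest palindromic suffix of the string of the node `R[7]` that is
preceded by the character `R[0]`, or `odd`. -/
def findShorter : Code :=
  .seq (.ld 15 20 7) (.seq (.move 21 0) (.seq search (.ite (.eq 20 1) (.move 10 3) (.move 10 20))))

/-- `R[10] ←` the node of the longest palindromic suffix that is preceded by the character `R[0]`,
or `odd`. -/
def findInner (v : Bool) : Code :=
  .seq (loadSuffix v) (.seq (.ld 12 8 7) (.seq (.sub 9 4 8) (.seq (.move 10 1)
  (.seq (.ite (.lt 8 6) (.seq (.pld 0 v 11 9) (.ite (.eq 11 0) (.move 10 7) .skip)) .skip)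
  (.ite (.eq 10 1) findShorter .skip)))))

theorem cons_suffix_iff {s y : List (Fin σ)} {c : Fin σ} (hy : y <:+ s) :
    (c :: y) <:+ s ↔ y.length < s.length ∧ s[s.length - y.length - 1]? = some c := by
  obtain ⟨a, rfl⟩ := hy
  rcases List.eq_nil_or_concat a with rfl | ⟨a, d, rfl⟩
  · simp only [List.nil_append, lt_self_iff_false, false_and, iff_false]
    intro h
    have := h.length_le
    simp at this
  · have e : (a ++ d :: y)[a.length + (y.length + 1) - y.length - 1]? = some d := by
      rw [show a.length + (y.length + 1) - y.length - 1 = a.length by omega]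
      simp
    simp only [List.concat_eq_append, List.append_assoc, List.cons_append, List.nil_append,
      List.length_append, List.length_cons, e, Option.some.injEq]
    constructor
    · intro h
      have h1 : (d :: y) <:+ a ++ d :: y := List.suffix_append _ _
      have := (List.suffix_of_suffix_length_le h h1 (by simp)).eq_of_length (by simp)
      simp at this
      exact ⟨by omega, this.symm⟩
    · rintro ⟨-, rfl⟩
      exact List.suffix_append _ _

theorem Inv.end_bounds {K : ℕ} {v : Bool} {fld pos : ℕ → ℤ → ℤ} {h : Node σ → ℤ}
    {X : Set (List (Fin σ))} {s : List (Fin σ)} (I : Inv K v fld pos h X s) :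
    fld (endFld v) 0 + fld (endFld !v) 0 = s.length ∧ fld (endFld v) 0 < fld 3 0 ∧
      fld (endFld !v) 0 < fld 3 0 :=
  ⟨I.arrays.length, I.end_lt v, I.end_lt _⟩

theorem wp_loadSuffix {w B K : ℕ} {v : Bool} {Q : St → Prop} {t : St} {h : Node σ → ℤ}
    {X : Set (List (Fin σ))} {s : List (Fin σ)} (F : Fits w B K)
    (I : Inv K v t.fld t.pos h X s) (hPB : t.fld 3 0 ≤ B)
    (hQ : ∀ reg : ℕ → ℤ, reg 0 = t.reg 0 → reg 1 = 0 → reg 2 = 1 → reg 3 = 2 →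
      reg 4 = t.fld (endFld v) 0 → reg 6 = s.length → reg 7 = h (.pal (sufpal s s.length)) →
      Q { t with reg := reg }) :
    (loadSuffix v).wp w B K Q t := by
  have hw : (32 : ℤ) * B ≤ 2 ^ w := by exact_mod_cast F.blocks
  have hP3 := I.heap.blocks
  obtain ⟨hE, hE1, hE2⟩ := I.end_bounds
  simp [loadSuffix, hE]
  refine ⟨by omega, by omega, fun h0 => hQ _ ?_ ?_ ?_ ?_ ?_ ?_ ?_,
    fun h0 => ⟨by have := List.length_pos_iff.2 h0; omega, hQ _ ?_ ?_ ?_ ?_ ?_ ?_ ?_⟩⟩ <;> simp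
  · subst h0; exact I.heap.even.symm
  · have := I.arrays.finish s.length (by have := List.length_pos_iff.2 h0; omega) le_rfl
    rwa [sufsurf_length, show (s.length : ℤ) - t.fld (endFld !v) 0 = t.fld (endFld v) 0 by omega]
      at this

theorem wp_findInner {w B K : ℕ} {v : Bool} {Q : St → Prop} {t : St} {h : Node σ → ℤ}
    {X : Set (List (Fin σ))} {s : List (Fin σ)} {c : Fin σ} (F : Fits w B K)
    (I : Inv K v t.fld t.pos h X s) (hPB : t.fld 3 0 ≤ B) (hc : t.reg 0 = (c : ℕ))
    (hQ : ∀ (reg : ℕ → ℤ) (o : Option (List (Fin σ))), Consts reg c → IsLongestBefore s c o →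
      (∀ y ∈ o, y ∈ X) → reg 4 = t.fld (endFld v) 0 → reg 10 = h (.ofOption o) →
        Q { t with reg := reg }) :
    (findInner v).wp w B K Q t := by
  have hw : (32 : ℤ) * B ≤ 2 ^ w := by exact_mod_cast F.blocks
  have hP3 := I.heap.blocks
  obtain ⟨hE, hE1, hE2⟩ := I.end_bounds
  have hx := isLongestSuffix_sufpal s
  refine wp_seq.2 (wp_loadSuffix F I hPB fun reg r0 r1 r2 r3 r4 r6 r7 => ?_)
  rw [hc] at r0
  set y := sufpal s s.length
  have hyX : y ∈ X := I.counts.subset hx.mem_palSubstrings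
  have hyl := hx.2.1.length_le
  have hb := I.heap.bound _ (pal_mem_nodeSet hyX)
  have hcl := I.heap.natCast_lt c
  have hl12 := I.heap.len _ (pal_mem_nodeSet hyX)
  simp only [Node.len] at hl12
  have hM := F.keys
  -- the search for shorter suffixes
  have hlook : ¬ (c :: y) <:+ s → ∀ reg : ℕ → ℤ, reg 0 = (c : ℕ) → reg 1 = 0 → reg 2 = 1 →
      reg 3 = 2 → reg 4 = t.fld (endFld v) 0 → reg 7 = h (.pal y) →
      findShorter.wp w B K Q { t with reg := reg } := by
    intro hn reg r0 r1 r2 r3 r4 r7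
    have hroot := I.heap.beforeRoot _ (pal_mem_nodeSet hyX)
    simp [findShorter, r7]
    refine ⟨by omega, wp_seq.2 (wp_search (by omega) I.heap.height I.heap.width F.keys
      I.heap.closed hPB (by simpa using hroot.1) (by simpa using hroot.2) (by simp [r0])
      (by simp [r0, hcl]) fun reg' e e20 => ?_)⟩
    simp [r0] at e20
    have e' : ∀ r, r < 20 → reg' r = reg r := fun r hr => by
      rw [e r hr]
      simp only [St.setReg_reg]
      rw [Function.update_of_ne (by omega), Function.update_of_ne (by omega)]
    obtain ⟨o, ho1, ho2, ho3⟩ := I.heap.before y hyX c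
    rw [ho3] at e20
    have hlb := IsLongestBefore.of_longestSuffix hx hn ho1
    have r1' : reg' 1 = 0 := by rw [e' 1 (by omega), r1]
    have hon : 0 ≤ reg' 20 ∧ reg' 20 < 2 ^ w ∧
        (reg' 20 = 0 → o = none) ∧ (reg' 20 ≠ 0 → h (.ofOption o) = reg' 20) := by
      rw [e20]
      cases o with
      | none => simp
      | some z =>
        have := I.heap.bound _ (pal_mem_nodeSet (ho2 z rfl))
        simp [Node.ofOption]
        omega
    have hC : ∀ x, Consts (Function.update reg' 10 x) c := by
      intro x
      refine ⟨?_, ?_, ?_, ?_⟩ <;> rw [Function.update_of_ne (by omega), e' _ (by omega)] <;>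
        assumption
    simp [r1']
    refine ⟨⟨hon.1, hon.2.1⟩, fun h0 => ?_, fun h0 => ?_⟩
    · refine hQ _ o (hC _) hlb ho2 ?_ ?_
      · simp [e', r4]
      · rw [hon.2.2.1 h0]
        simpa [e', r3, Node.ofOption] using I.heap.odd.symm
    · refine hQ _ o (hC _) hlb ho2 ?_ ?_
      · simp [e', r4]
      · simp [hon.2.2.2 h0]
  simp [r7, r4, r1, r6, hl12, wp_seq_lt]
  refine ⟨by omega, by omega, by omega, fun hlt => ⟨by omega, ?_⟩, fun hlt => ?_⟩
  · obtain ⟨d, hd⟩ : ∃ d, s[s.length - y.length - 1]? = some d :=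
      ⟨_, List.getElem?_eq_getElem (by omega)⟩
    have hpos := I.arrays.char (s.length - y.length) d (by omega) hd
    have hdl := I.heap.natCast_lt d
    rw [show ((s.length - y.length : ℕ) : ℤ) - t.fld (endFld !v) 0 =
      t.fld (endFld v) 0 - y.length by omega] at hpos
    rw [hpos]
    simp [r0]
    refine ⟨by omega, by omega, fun hdc => ?_, fun hdc => ?_⟩
    · have : d = c := Fin.ext (by exact_mod_cast hdc)
      subst this
      refine ⟨by omega, fun h0 => by omega, fun h0 => hQ _ (some y) ?_
        (IsLongestBefore.self hx ((cons_suffix_iff hx.2.1).2 ⟨hlt, hd⟩)) ?_ ?_ ?_⟩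
      · exact ⟨by simp [r0], by simp [r1], by simp [r2], by simp [r3]⟩
      · rintro z hz; cases hz; exact hyX
      · simp [r4]
      · simp [Node.ofOption]
    · refine hlook (fun h => hdc ?_) _ ?_ ?_ ?_ ?_ ?_ ?_
      · have := ((cons_suffix_iff hx.2.1).1 h).2
        rw [hd] at this
        cases this
        rfl
      all_goals simp [*]
  · refine hlook (fun h => ?_) _ ?_ ?_ ?_ ?_ ?_ ?_
    · have := ((cons_suffix_iff hx.2.1).1 h).1
      omega
    all_goals simp [*]

/-- `R[4] ←` the new last position; the character `R[0]` is stored there, without a surface. -/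
def appendChar (v : Bool) : Code :=
  .seq (.add 4 4 2) (.seq (.pst 0 v 4 0) (.seq (.st (endFld v) 1 4)
    (.seq (.pst (startArr v) v 4 2) (.pst (startArr !v) v 4 2))))

/-- The memory while the character `c` is appended: the arrays represent the string `s`, with the
surfaces given by `S` and `T`, and the counters refer to the string `u`. -/
structure Stage (K : ℕ) (v : Bool) (t : St) (h : Node σ → ℤ) (X : Set (List (Fin σ)))
    (c : Fin σ) (s u : List (Fin σ)) (S T : ℕ → List (Fin σ)) : Prop where
  heap : Heap K t.fld h X
  counts : Counts t.fld h X u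
  arrays : Arrays v t.fld t.pos h s S T
  end_le : ∀ v, t.fld (endFld v) 0 ≤ t.fld 3 0
  consts : Consts t.reg c
  last : t.reg 4 = t.fld (endFld v) 0

theorem Counts.congr {K : ℕ} {fld fld' : ℕ → ℤ → ℤ} {h : Node σ → ℤ} {X : Set (List (Fin σ))}
    {s : List (Fin σ)} (C : Counts fld h X s) (H : Heap K fld h X) (h2 : fld' 2 0 = fld 2 0)
    (hn : ∀ k, k < fld 3 0 → fld' 16 k = fld 16 k ∧ fld' 17 k = fld 17 k) :
    Counts fld' h X s := by
  have hb := fun t ht => hn _ (H.bound _ (pal_mem_nodeSet (t := t) ht)).2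
  exact ⟨C.subset, fun t ht h0 => (hb t ht).1.trans (C.cnt t ht h0),
    fun t ht h0 => (hb t ht).2.trans (C.linkCount t ht h0), h2.trans C.count⟩

theorem presurf_of_length_lt {s : List (Fin σ)} {i : ℕ} (hi : s.length < i) : presurf s i = [] :=
  presurf_of_forall fun _ h => by have := h.palAt.2.1; have := h.palAt.2.2.1; omega

theorem sufsurf_of_length_lt {s : List (Fin σ)} {i : ℕ} (hi : s.length < i) : sufsurf s i = [] :=
  sufsurf_of_forall fun _ h => by have := h.palAt.2.2.1; omega

theorem wp_appendChar {w B K : ℕ} {v : Bool} {Q : St → Prop} {t : St} {h : Node σ → ℤ}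
    {X : Set (List (Fin σ))} {s : List (Fin σ)} {c : Fin σ}
    (I : Inv K v t.fld t.pos h X s) (hPB : t.fld 3 0 < B) (hc : Consts t.reg c)
    (h4 : t.reg 4 = t.fld (endFld v) 0)
    (hQ : ∀ t' : St, Stage K v t' h X c (s ++ [c]) s (presurf s) (sufsurf s) →
      t'.fld 3 0 = t.fld 3 0 → t'.reg 10 = t.reg 10 → t'.lo = t.lo → Q t') :
    (appendChar v).wp w B K Q t := by
  have hP3 := I.heap.blocks
  obtain ⟨hE, hE1, hE2⟩ := I.end_bounds
  obtain ⟨c0, c1, c2, c3⟩ := hc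
  simp [appendChar, h4, c0, c1, c2]
  refine ⟨by omega, by omega, by omega, hQ _ ⟨?_, ?_, ?_, ?_, ?_, ?_⟩ ?_ ?_ ?_⟩
  · refine I.heap.congr ?_ ?_ ?_ (fun f _ _ k _ => ?_) (fun k _ => ?_) ?_
    · simp
    · simp
    · simp
    · simp [Function.update_of_ne (ne_endFld (v := v) (by omega : 2 ≤ f))]
    · simp
    · simpa using I.heap.closed
  · exact I.counts.congr I.heap (by simp) (fun k _ => by simp)
  · have key : ∀ i : ℕ, i ≤ s.length →
        (i : ℤ) - t.fld (endFld !v) 0 ≠ t.fld (endFld v) 0 + 1 := fun i hi => by omega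
    have key' : ((s.length + 1 : ℕ) : ℤ) - t.fld (endFld !v) 0 = t.fld (endFld v) 0 + 1 := by
      push_cast; omega
    refine ⟨?_, fun i d hi hd => ?_, fun i hi hi' => ?_, fun i hi hi' => ?_⟩
    · simp; omega
    · rcases Nat.lt_or_ge s.length i with hl | hl
      · obtain rfl : i = s.length + 1 := by
          have := (List.getElem?_eq_some_iff.1 hd).1
          simp at this; omega
        simp at hd
        simp only [St.setPos_pos, St.setPos_fld, St.setFld_fld, St.setFld_pos, St.setReg_fld,
          ne_eq, endFld_not_ne, not_false_eq_true, Function.update_of_ne, key', hd]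
        simp
      · rw [List.getElem?_append_left (by omega)] at hd
        have := I.arrays.char i d hi hd
        simp [key i hl, this]
    · rcases Nat.lt_or_ge s.length i with hl | hl
      · obtain rfl : i = s.length + 1 := by simp at hi'; omega
        rw [presurf_of_length_lt hl, I.heap.even]
        simp only [St.setPos_pos, St.setPos_fld, St.setFld_fld, St.setFld_pos, St.setReg_fld,
          ne_eq, endFld_not_ne, not_false_eq_true, Function.update_of_ne, key']
        simp
      · have := I.arrays.start i hi hl
        simp [key i hl, this]
    · rcases Nat.lt_or_ge s.length i with hl | hl
      · obtain rfl : i = s.length + 1 := by simp at hi'; omega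
        rw [sufsurf_of_length_lt hl, I.heap.even]
        simp only [St.setPos_pos, St.setPos_fld, St.setFld_fld, St.setFld_pos, St.setReg_fld,
          ne_eq, endFld_not_ne, not_false_eq_true, Function.update_of_ne, key']
        simp
      · have := I.arrays.finish i hi hl
        simp [key i hl, this]
  · intro u
    by_cases hu : u = v
    · subst hu; simp; omega
    · obtain rfl : u = !v := by cases u <;> cases v <;> simp at hu ⊢
      simp; omega
  · exact ⟨by simp [c0], by simp [c1], by simp [c2], by simp [c3]⟩
  · simp
  · simp
  · simp
  · simp

/-! ### Creating a node -/

/-- For the node `R[10]` of `y`, `R[13] ←` the length of `x = c y c` and `R[14] ←` the node of the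
longest proper palindromic suffix of `x`, where `c` is the character `R[0]`. -/
def findLink : Code :=
  .seq (.ld 12 13 10) (.seq (.add 13 13 3) (.seq (.move 14 2) (.ite (.eq 10 3) .skip
    (.seq (.ld 15 20 10) (.seq (.move 21 0) (.seq search (.seq (.ite (.eq 20 1) (.move 20 3) .skip)
      (.seq (.ld 14 20 20) (.seq (.move 21 0) (.seq search (.move 14 20)))))))))))

theorem wp_findLink {w B K : ℕ} {Q : St → Prop} {t : St} {h : Node σ → ℤ}
    {X : Set (List (Fin σ))} {c : Fin σ} {o : Option (List (Fin σ))} (F : Fits w B K)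
    (H : Heap K t.fld h X) (hPB : t.fld 3 0 ≤ B) (hc : Consts t.reg c) (ho : ∀ y ∈ o, y ∈ X)
    (h10 : t.reg 10 = h (.ofOption o)) (hz : linkStr ((Node.ofOption o).wrap c) ∈ X)
    (hQ : ∀ reg : ℕ → ℤ, Consts reg c → reg 4 = t.reg 4 → reg 10 = t.reg 10 →
      reg 13 = ((Node.ofOption o).wrap c).length →
      reg 14 = h (.pal (linkStr ((Node.ofOption o).wrap c))) → Q { t with reg := reg }) :
    findLink.wp w B K Q t := by
  have hw : (32 : ℤ) * B ≤ 2 ^ w := by exact_mod_cast F.blocks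
  have hP3 := H.blocks
  have hcl := H.natCast_lt c
  have hM := F.keys
  have hu := ofOption_mem_nodeSet ho
  have hb := H.bound _ hu
  have hlen := H.len _ hu
  have hwl := length_wrap (Node.ofOption o) c
  obtain ⟨c0, c1, c2, c3⟩ := hc
  simp [findLink, h10, c3, hlen, c2]
  refine ⟨by omega, by omega, by omega, fun he => ?_, fun he => ?_⟩
  · have : Node.ofOption o = .odd := H.inj hu (odd_mem_nodeSet X) (he.trans H.odd.symm)
    have e : linkStr ((Node.ofOption o).wrap c) = [] := by rw [this]; exact linkStr_singleton c
    refine hQ _ ⟨?_, ?_, ?_, ?_⟩ ?_ ?_ ?_ ?_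
    all_goals simp [*]
    · rfl
    · rw [← this, e, H.even]
  · have : ∃ y, o = some y := by
      cases o with
      | none => exact absurd H.odd he
      | some y => exact ⟨y, rfl⟩
    obtain ⟨y, rfl⟩ := this
    have hyX := ho y rfl
    have hroot := H.beforeRoot _ hu
    refine ⟨by omega, wp_seq.2 (wp_search (by omega) H.height H.width F.keys
      H.closed hPB (by simpa using hroot.1) (by simpa using hroot.2) (by simp [c0])
      (by simp [c0, hcl]) fun reg' e e20 => ?_)⟩
    simp [c0] at e20
    have e' : ∀ r, r < 13 → reg' r = t.reg r := fun r hr => by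
      rw [e r (by omega)]
      simp only [St.setReg_reg]
      repeat rw [Function.update_of_ne (by omega)]
    obtain ⟨o', ho1, ho2, ho3⟩ := H.before y hyX c
    change reg' 20 = find _ _ _ _ (t.fld 15 (h (.pal y))) _ at e20
    rw [ho3] at e20
    have hx : linkStr ((Node.ofOption (some y)).wrap c) = (Node.ofOption o').wrap c :=
      linkStr_wrap ho1
    rw [hx] at hz hQ
    have hu' := ofOption_mem_nodeSet ho2
    have hroot' := H.nextRoot _ hu'
    have hb' := H.bound _ hu'
    -- the second search starts at the node that was found
    have hfin : ∀ reg : ℕ → ℤ, (∀ r, r < 20 → reg r = reg' r) → reg 20 = h (.ofOption o') →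
        Code.wp w B K (.seq (.ld 14 20 20) (.seq (.move 21 0) (.seq search (.move 14 20)))) Q
          { t with reg := reg } := by
      intro reg e1 e2
      have r0 : reg 0 = (c : ℕ) := by rw [e1 0 (by omega), e' 0 (by omega), c0]
      simp [e2]
      refine ⟨by omega, wp_seq.2 (wp_search (by omega) H.height H.width F.keys
        H.closed hPB (by simpa using hroot'.1) (by simpa using hroot'.2) (by simp [r0])
        (by simp [r0, hcl]) fun reg'' f f20 => ?_)⟩
      simp [r0, (H.next _ hu' c).1 hz] at f20
      have f' : ∀ r, r < 20 → reg'' r = reg' r := fun r hr => by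
        rw [f r (by omega), ← e1 r hr]
        simp only [St.setReg_reg]
        repeat rw [Function.update_of_ne (by omega)]
      have f13 : reg'' 13 = (((Node.ofOption (some y)).wrap c).length : ℤ) := by
        rw [f' 13 (by omega), e 13 (by omega), hwl]
        simp
      refine hQ _ ⟨?_, ?_, ?_, ?_⟩ ?_ ?_ ?_ ?_
      all_goals simp [*]
    have hb0 : 0 ≤ reg' 20 ∧ reg' 20 < 2 ^ w ∧ (reg' 20 = 0 → o' = none) ∧
        (reg' 20 ≠ 0 → reg' 20 = h (.ofOption o')) := by
      rw [e20]
      cases o' with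
      | none => simp
      | some z =>
        have := H.bound _ (pal_mem_nodeSet (ho2 z rfl))
        simp [Node.ofOption]
        omega
    rw [wp_seq_eq]
    simp only [(e' 1 (by omega)).trans c1]
    refine ⟨⟨hb0.1, hb0.2.1⟩, ⟨le_rfl, by positivity⟩, fun h0 => ?_, fun h0 => ?_⟩
    · refine hfin _ (fun r hr => ?_) ?_
      · exact Function.update_of_ne (by omega) _ _
      · rw [hb0.2.2.1 h0]
        simpa [(e' 3 (by omega)).trans c3, Node.ofOption] using H.odd.symm
    · exact hfin _ (fun _ _ => rfl) (hb0.2.2.2 h0)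

theorem _root_.WordRAM.St.setFld_fld_of_ne {t : St} {f f' : ℕ} {k k' x : ℤ}
    (h : f ≠ f' ∨ k ≠ k') : (t.setFld f' k' x).fld f k = t.fld f k := by
  by_cases hf : f = f'
  · subst hf
    simp [h.resolve_left (fun h => h rfl)]
  · simp [hf]

/-- `R[12] ←` a new block for a node of length `R[13]` with the suffix link `R[14]`, without edges;
`R[16]` is the root of the trie of the palindromic suffixes by preceding characters. -/
def allocNode : Code :=
  .seq (.ld 3 12 1) (.seq (.add 17 12 2) (.seq (.st 3 1 17) (.seq (.st 12 12 13)
    (.seq (.st 13 12 14) (.seq (.st 14 12 1) (.seq (.st 15 12 16) (.seq (.st 16 12 1)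
      (.seq (.st 17 12 1) (.seq (.st 18 12 1) (.st 19 12 1))))))))))

theorem wp_allocNode {w B K : ℕ} {Q : St → Prop} {t : St} (h0 : 1 ≤ t.fld 3 0)
    (hB : t.fld 3 0 < B) (h1 : t.reg 1 = 0) (h2 : t.reg 2 = 1)
    (hQ : ∀ t' : St, (∀ r, r ≠ 12 → r ≠ 17 → t'.reg r = t.reg r) → t'.reg 12 = t.fld 3 0 →
      t'.fld 3 0 = t.fld 3 0 + 1 → (∀ f, f ≠ 3 → ∀ k, k ≠ t.fld 3 0 → t'.fld f k = t.fld f k) →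
      (∀ f, f < 3 → t'.fld f = t.fld f) →
      t'.fld 12 (t.fld 3 0) = t.reg 13 → t'.fld 13 (t.fld 3 0) = t.reg 14 →
      t'.fld 14 (t.fld 3 0) = 0 → t'.fld 15 (t.fld 3 0) = t.reg 16 → t'.fld 16 (t.fld 3 0) = 0 →
      t'.fld 17 (t.fld 3 0) = 0 → t'.fld 18 (t.fld 3 0) = 0 → t'.fld 19 (t.fld 3 0) = 0 →
      t'.pos = t.pos → t'.lo = t.lo → Q t') :
    allocNode.wp w B K Q t := by
  have hb : 0 < B := by omega
  simp [allocNode, h1, h2, hb]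
  refine ⟨by omega, hQ _ ?_ ?_ ?_ ?_ ?_ ?_ ?_ ?_ ?_ ?_ ?_ ?_ ?_ ?_ ?_⟩
  · intro r h12 h17
    simp [h12, h17]
  · simp
  · simp
  · intro f hf k hk
    iterate 8 rw [St.setFld_fld_of_ne (Or.inr hk)]
    rw [St.setFld_fld_of_ne (Or.inl hf)]
    rfl
  · intro f hf
    have : ∀ g, 3 ≤ g → f ≠ g := fun g hg => by omega
    simp [this]
  all_goals simp

/-- Create the node of `x = c y c`, where `R[10]` is the node of `y` and `R[0]` is `c`;
`R[12] ←` the new node. -/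
def createNode (v : Bool) : Code :=
  .seq findLink (.seq (.ld 12 15 14) (.seq (.sub 15 4 15) (.seq (.pld 0 v 21 15)
    (.seq (.ld 15 20 14) (.seq (.move 25 14) (.seq insert (.seq (.move 16 27) (.seq allocNode
      (.seq (.ld 14 20 10) (.seq (.move 21 0) (.seq (.move 25 12) (.seq insert
        (.st 14 10 27)))))))))))))

open Classical in
theorem wp_createNode {w B K : ℕ} {v : Bool} {Q : St → Prop} {t : St} {h : Node σ → ℤ}
    {X : Set (List (Fin σ))} {s : List (Fin σ)} {c : Fin σ} {o : Option (List (Fin σ))}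
    {S T : ℕ → List (Fin σ)} (F : Fits w B K) (G : Stage K v t h X c (s ++ [c]) s S T)
    (hPB : t.fld 3 0 + 2 * K + 4 ≤ B) (hS : ∀ i, S i ∈ X) (hT : ∀ i, T i ∈ X)
    (hlb : IsLongestBefore s c o) (ho : ∀ y ∈ o, y ∈ X) (h10 : t.reg 10 = h (.ofOption o))
    (hxX : (Node.ofOption o).wrap c ∉ X)
    (hQ : ∀ (t' : St) (h' : Node σ → ℤ),
      Stage K v t' h' (Insert.insert ((Node.ofOption o).wrap c) X) c (s ++ [c]) s S T →
      t'.reg 12 = h' (.pal ((Node.ofOption o).wrap c)) →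
      t.fld 3 0 ≤ t'.fld 3 0 → t'.fld 3 0 ≤ t.fld 3 0 + 2 * K + 3 → t'.lo = t.lo → Q t') :
    (createNode v).wp w B K Q t := by
  have H := G.heap
  have hP3 := H.blocks
  have hu := ofOption_mem_nodeSet ho
  have hls := isLongestSuffix_append hlb
  have hx0 : (Node.ofOption o).wrap c ≠ [] := wrap_ne_nil _ _
  have hspec := linkStr_spec hx0
  have hzX : linkStr ((Node.ofOption o).wrap c) ∈ X :=
    G.counts.subset (mem_palSubstrings_of_proper hls hspec.1 hspec.2.1 hspec.2.2.1)
  have hzb := H.bound _ (pal_mem_nodeSet hzX)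
  have hzl := H.len _ (pal_mem_nodeSet hzX)
  have hub := H.bound _ hu
  have hlx := hls.2.1.length_le
  have hlxn : ((Node.ofOption o).wrap c).length ≤ s.length + 1 := by simpa using hlx
  generalize hx : (Node.ofOption o).wrap c = x at *
  simp only [Node.len] at hzl
  have hlen := G.arrays.length
  have e1 := G.end_le v
  have e2 := G.end_le (!v)
  simp at hlen
  -- the character before the suffix link
  obtain ⟨b, hbx⟩ : ∃ b, (b :: linkStr x) <:+ x := by
    obtain ⟨a, ha⟩ := hspec.2.1
    rcases List.eq_nil_or_concat a with rfl | ⟨a, d, rfl⟩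
    · have := congrArg List.length ha
      simp at this; omega
    · exact ⟨d, a, by simpa using ha⟩
  have hbs := (cons_suffix_iff (hspec.2.1.trans hls.2.1)).1 (hbx.trans hls.2.1)
  have hbc := G.arrays.char ((s ++ [c]).length - (linkStr x).length) b (by omega) hbs.2
  have hzl' : (linkStr x).length ≤ s.length := by have := hspec.2.2.1; omega
  rw [show (((s ++ [c]).length - (linkStr x).length : ℕ) : ℤ) - t.fld (endFld !v) 0 =
    t.fld (endFld v) 0 - (linkStr x).length by simp; omega] at hbc
  have hbl := H.natCast_lt b
  have hroot := H.beforeRoot _ (pal_mem_nodeSet hzX)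
  refine wp_seq.2 (wp_findLink F H (by omega) G.consts ho h10 (by rwa [hx]) ?_)
  intro reg hc r4 r10 r13 r14
  rw [hx] at r13 r14
  simp [r14, r4, hzl, G.last, hbc]
  refine ⟨by omega, by omega, by omega, wp_seq.2 (wp_insert (M := 2 ^ K) (P := t.fld 3 0) (by omega)
    (by omega) H.height H.width rfl rfl F.keys H.closed (by simpa using hroot.1)
    (by simpa using hroot.2) (by simp) (by simpa using hbl) (by simp; omega) (by simp; omega) ?_)⟩
  intro t1 a1 a2 a3 a4 a5 a6 a7 a8 a9
  simp at a3 a4 a5 a7 a9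
  have a1' : ∀ r, r < 15 → t1.reg r = reg r := fun r hr => by
    rw [a1 r (by omega)]
    simp only [St.setReg_reg]
    repeat rw [Function.update_of_ne (by omega)]
  rw [wp_seq_move]
  refine wp_seq.2 (wp_allocNode (by simp; omega) (by simp; omega)
    (by simpa [a1' 1 (by omega)] using hc.zero) (by simpa [a1' 2 (by omega)] using hc.one) ?_)
  intro t2 b1 b2 b3 b4 b5 b12 b13 b14 b15 b16 b17 b18 b19 bpos blo
  simp [a2, a6, a1'] at b2 b3 b4 b5 b12 b13 b14 b15 b16 b17 b18 b19 bpos blo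
  have b1' : ∀ r, r < 12 → t2.reg r = reg r := fun r hr => by
    rw [b1 r (by omega) (by omega), ← a1' r (by omega)]
    exact Function.update_of_ne (by omega) _ _
  have H20 := H.nextRoot _ hu
  have hcl := H.natCast_lt c
  have r0 : t2.reg 0 = (c : ℕ) := (b1' 0 (by omega)).trans hc.char
  have r10' : t2.reg 10 = h (Node.ofOption o) := ((b1' 10 (by omega)).trans r10).trans h10
  -- the contents of the old blocks
  have d : ∀ f, f ≠ 3 → f ≠ 18 → f ≠ 19 → ∀ k, k ≠ t.fld 3 0 + K + 1 → t2.fld f k = t.fld f k :=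
    fun f h3 h18 h19 k hk => by rw [b4 f h3 k hk, a5 f h18 h19 h3]
  have d' : ∀ k, k < t.fld 3 0 → t2.fld 18 k = t.fld 18 k ∧ t2.fld 19 k = t.fld 19 k := by
    intro k hk
    rw [b4 18 (by omega) k (by omega), b4 19 (by omega) k (by omega)]
    exact a7 k hk
  have hc2 : Closed (t2.fld 18) (t2.fld 19) (t.fld 3 0 + K + 1 + 1) := by
    intro k k0 k1
    by_cases hk : k = t.fld 3 0 + K + 1
    · rw [hk, b18, b19]; omega
    · rw [b4 18 (by omega) k hk, b4 19 (by omega) k hk]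
      have := a8 k k0 (by omega)
      omega
  have hc2' : Closed (t2.fld 18) (t2.fld 19) (t.fld 3 0 + K + 1) := by
    intro k k0 k1
    rw [b4 18 (by omega) k (by omega), b4 19 (by omega) k (by omega)]
    exact a8 k k0 k1
  have u14 := d 14 (by omega) (by omega) (by omega) (h (Node.ofOption o)) (by omega)
  simp [r10', b2, r0, u14]
  refine ⟨by omega, wp_seq.2 (wp_insert (M := 2 ^ K) (P := t.fld 3 0 + K + 1 + 1)
    (by omega) (by omega) ?_ ?_ b3 rfl F.keys hc2 (by simpa using H20.1)
    (by simp; omega) (by simp) (by simpa using hcl) (by simp; omega) (by simp) ?_)⟩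
  · simpa [d 4 _ _ _ 0 (by omega)] using H.height
  · simpa [d 5 _ _ _ 0 (by omega)] using H.width
  intro t3 g1 g2 g3 g4 g5 g6 g7 g8 g9
  simp at g1 g3 g4 g5 g7 g9
  have r10'' : t3.reg 10 = h (Node.ofOption o) := by rw [g1 10 (by omega)]; simpa using r10'
  have e : ∀ f, f ≠ 3 → f ≠ 18 → f ≠ 19 → ∀ k, k ≠ t.fld 3 0 + K + 1 → t3.fld f k = t.fld f k :=
    fun f h3 h18 h19 k hk => by rw [g5 f h18 h19 h3, d f h3 h18 h19 k hk]
  have e' : ∀ k, k < t.fld 3 0 → t3.fld 18 k = t.fld 18 k ∧ t3.fld 19 k = t.fld 19 k := by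
    intro k hk
    rw [(g7 k (by omega)).1, (g7 k (by omega)).2]
    exact d' k hk
  simp [r10'', g2]
  have ee : ∀ f, f ≠ 3 → f ≠ 14 → f ≠ 18 → f ≠ 19 → ∀ k, k ≠ t.fld 3 0 + K + 1 →
      (t3.setFld 14 (h (Node.ofOption o)) (t.fld 3 0 + K + 1 + 1)).fld f k = t.fld f k :=
    fun f h3 h14 h18 h19 k hk => by rw [St.setFld_fld_of_ne (Or.inl h14), e f h3 h18 h19 k hk]
  have e3 : (t3.setFld 14 (h (Node.ofOption o)) (t.fld 3 0 + K + 1 + 1)).fld 3 0 =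
      t.fld 3 0 + 2 * K + 3 := by
    rw [St.setFld_fld_of_ne (Or.inl (by omega)), g6]; ring
  have eq : ∀ f, f ≠ 3 → f ≠ 14 → f ≠ 18 → f ≠ 19 →
      (t3.setFld 14 (h (Node.ofOption o)) (t.fld 3 0 + K + 1 + 1)).fld f (t.fld 3 0 + K + 1) =
        t2.fld f (t.fld 3 0 + K + 1) :=
    fun f h3 h14 h18 h19 => by rw [St.setFld_fld_of_ne (Or.inl h14), g5 f h18 h19 h3]
  have e18 : ∀ f, f ≠ 14 →
      (t3.setFld 14 (h (Node.ofOption o)) (t.fld 3 0 + K + 1 + 1)).fld f = t3.fld f :=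
    fun f hf => funext fun k => St.setFld_fld_of_ne (Or.inl hf)
  have ex : Function.update h (.pal x) (t.fld 3 0 + K + 1) (.pal x) = t.fld 3 0 + K + 1 :=
    Function.update_self _ _ _
  have eX : ∀ y ∈ X, Function.update h (.pal x) (t.fld 3 0 + K + 1) (.pal y) = h (.pal y) := by
    intro y hy
    refine Function.update_of_ne ?_ _ _
    rintro he
    cases he
    exact hxX hy
  have hx' : x ∉ palSubstrings s := fun h => hxX (G.counts.subset h)
  have hx0' : ¬ 0 < sufcnt s x + linkCount s x := fun h =>
    hx' ((mem_palSubstrings_iff hx0 hls.1).2 h)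
  generalize hq : t.fld 3 0 + K + 1 = q at *
  refine ⟨by omega, hQ _ (Function.update h (.pal x) q) ⟨?_, ?_, ?_, ?_, ?_, ?_⟩ ?_ ?_ ?_ ?_⟩
  · refine H.insert (b := b) (q := q) (c := c) ho hx.symm hxX hzX hbx (by omega) (by omega) ?_ ?_
      (fun k hk => ?_) (fun k hk => ?_) (fun k hk => ?_) (fun k hk hne => ?_) (fun k hk => ?_) ?_
      ?_ ?_ ?_ ?_ ?_ (fun a => ?_) (fun a => ?_)
    · exact ee 4 (by omega) (by omega) (by omega) (by omega) 0 (by omega)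
    · exact ee 5 (by omega) (by omega) (by omega) (by omega) 0 (by omega)
    · exact ee 12 (by omega) (by omega) (by omega) (by omega) k (by omega)
    · exact ee 13 (by omega) (by omega) (by omega) (by omega) k (by omega)
    · exact ee 15 (by omega) (by omega) (by omega) (by omega) k (by omega)
    · rw [St.setFld_fld_of_ne (Or.inr hne), e 14 (by omega) (by omega) (by omega) k (by omega)]
    · rw [e18 18 (by omega), e18 19 (by omega)]
      exact e' k hk
    · rw [e18 18 (by omega), e18 19 (by omega), e3, show t.fld 3 0 + 2 * (K : ℤ) + 3 =
        q + 1 + K + 1 by omega]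
      exact g8
    · rw [eq 12 (by omega) (by omega) (by omega) (by omega), b12, r13]
    · rw [eq 13 (by omega) (by omega) (by omega) (by omega), b13, r14]
    · rw [St.setFld_fld_of_ne (Or.inr (by omega)), g5 14 (by omega) (by omega) (by omega), b14]
    · rw [eq 15 (by omega) (by omega) (by omega) (by omega), b15]
      omega
    · simp
      simp at e3
      omega
    · rw [eq 15 (by omega) (by omega) (by omega) (by omega), b15, e18 18 (by omega),
        e18 19 (by omega), find_congr (B := q) hc2' (fun k k0 k1 => g7 k (by omega)) K (by omega)
        (by omega), find_congr (B := q) a8 (fun k k0 k1 => ⟨b4 18 (by omega) k (by omega),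
          b4 19 (by omega) k (by omega)⟩) K (by omega) (by omega), a9 _ (by omega) (H.natCast_lt a)]
      simp [Fin.ext_iff]
    · rw [e18 18 (by omega), e18 19 (by omega)]
      simp only [St.setFld_fld, Function.update_self]
      rw [g9 _ (by omega) (H.natCast_lt a), find_congr (B := t.fld 3 0) H.closed
        (fun k _ hk => d' k hk) K H20.1 H20.2]
      simp [Fin.ext_iff]
  · refine ⟨fun y hy => Or.inr (G.counts.subset hy), ?_, ?_, ?_⟩
    · rintro y (rfl | hy) hy0
      · rw [ex, eq 16 (by omega) (by omega) (by omega) (by omega), b16]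
        omega
      · have := H.bound _ (pal_mem_nodeSet hy)
        rw [eX y hy, ee 16 (by omega) (by omega) (by omega) (by omega) _ (by omega)]
        exact G.counts.cnt y hy hy0
    · rintro y (rfl | hy) hy0
      · rw [ex, eq 17 (by omega) (by omega) (by omega) (by omega), b17]
        omega
      · have := H.bound _ (pal_mem_nodeSet hy)
        rw [eX y hy, ee 17 (by omega) (by omega) (by omega) (by omega) _ (by omega)]
        exact G.counts.linkCount y hy hy0
    · rw [ee 2 (by omega) (by omega) (by omega) (by omega) 0 (by omega)]
      exact G.counts.count
  · have ev : ∀ v, (t3.setFld 14 (h (Node.ofOption o)) (q + 1)).fld (endFld v) 0 =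
        t.fld (endFld v) 0 := fun v => by
      have := @endFld_le v
      exact ee _ (by omega) (by omega) (by omega) (by omega) 0 (by omega)
    have ep : (t3.setFld 14 (h (Node.ofOption o)) (q + 1)).pos = t.pos := by
      rw [St.setFld_pos, g3, bpos, a3]
    refine ⟨?_, fun i c h1 hc => ?_, fun i h1 h2 => ?_, fun i h1 h2 => ?_⟩
    · rw [ev, ev]; exact G.arrays.length
    · rw [ev, ep]; exact G.arrays.char i c h1 hc
    · rw [ev, ep, eX _ (hS i)]; exact G.arrays.start i h1 h2
    · rw [ev, ep, eX _ (hT i)]; exact G.arrays.finish i h1 h2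
  · intro u
    have := @endFld_le u
    rw [e3, ee _ (by omega) (by omega) (by omega) (by omega) 0 (by omega)]
    have := G.end_le u
    omega
  · have : ∀ r, r < 12 → t3.reg r = reg r := fun r hr => by
      rw [g1 r (by omega), ← b1' r hr]
      repeat rw [Function.update_of_ne (by omega)]
    exact ⟨(this 0 (by omega)).trans hc.char, (this 1 (by omega)).trans hc.zero,
      (this 2 (by omega)).trans hc.one, (this 3 (by omega)).trans hc.two⟩
  · have := @endFld_le v
    rw [ee _ (by omega) (by omega) (by omega) (by omega) 0 (by omega), ← G.last, ← r4,
      ← b1' 4 (by omega)]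
    change t3.reg 4 = _
    rw [g1 4 (by omega)]
    repeat rw [Function.update_of_ne (by omega)]
  · rw [ex, ← b2]
    change t3.reg 12 = _
    rw [g1 12 (by omega)]
    repeat rw [Function.update_of_ne (by omega)]
  · omega
  · exact e3.le
  · change t3.lo = _
    rw [g4, blo, a4]

/-- `R[12] ←` the node of `c y c`, where `R[10]` is the node of `y` and `R[0]` is `c`; it is created
if it does not exist. -/
def ensureNode (v : Bool) : Code :=
  .seq (.ld 14 20 10) (.seq (.move 21 0) (.seq search (.seq (.move 12 20)
    (.ite (.eq 12 1) (createNode v) .skip))))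

theorem wp_ensureNode {w B K : ℕ} {v : Bool} {Q : St → Prop} {t : St} {h : Node σ → ℤ}
    {X : Set (List (Fin σ))} {s : List (Fin σ)} {c : Fin σ} {o : Option (List (Fin σ))}
    {S T : ℕ → List (Fin σ)} (F : Fits w B K) (G : Stage K v t h X c (s ++ [c]) s S T)
    (hPB : t.fld 3 0 + 2 * K + 4 ≤ B) (hS : ∀ i, S i ∈ X) (hT : ∀ i, T i ∈ X)
    (hlb : IsLongestBefore s c o) (ho : ∀ y ∈ o, y ∈ X) (h10 : t.reg 10 = h (.ofOption o))
    (hQ : ∀ (t' : St) (h' : Node σ → ℤ) (X' : Set (List (Fin σ))),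
      Stage K v t' h' X' c (s ++ [c]) s S T → (Node.ofOption o).wrap c ∈ X' →
      t'.reg 12 = h' (.pal ((Node.ofOption o).wrap c)) →
      t.fld 3 0 ≤ t'.fld 3 0 → t'.fld 3 0 ≤ t.fld 3 0 + 2 * K + 3 → t'.lo = t.lo → Q t') :
    (ensureNode v).wp w B K Q t := by
  have hw : (32 : ℤ) * B ≤ 2 ^ w := by exact_mod_cast F.blocks
  have H := G.heap
  have hu := ofOption_mem_nodeSet ho
  have hb := H.bound _ hu
  have hroot := H.nextRoot _ hu
  have hcl := H.natCast_lt c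
  obtain ⟨c0, c1, c2, c3⟩ := G.consts
  simp [ensureNode, h10]
  refine ⟨by omega, wp_seq.2 (wp_search (by omega) H.height H.width F.keys
    H.closed (by omega) (by simpa using hroot.1) (by simpa using hroot.2) (by simp [c0])
    (by simp [c0, hcl]) fun reg e e20 => ?_)⟩
  simp [c0] at e20
  have e' : ∀ r, r < 20 → reg r = t.reg r := fun r hr => by
    rw [e r hr]
    simp only [St.setReg_reg]
    repeat rw [Function.update_of_ne (by omega)]
  have hG : ∀ x, Stage K v { t with reg := Function.update reg 12 x } h X c (s ++ [c]) s S T := by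
    intro x
    refine ⟨G.heap, G.counts, G.arrays, G.end_le, G.consts.congr fun r hr => ?_, ?_⟩
    · exact (Function.update_of_ne (by omega) _ _).trans (e' r (by omega))
    · simpa [e'] using G.last
  have hnext := H.next _ hu c
  have hb0 : 0 ≤ reg 20 ∧ reg 20 < 2 ^ w ∧ (reg 20 = 0 ↔ (Node.ofOption o).wrap c ∉ X) := by
    rw [e20]
    by_cases hX : (Node.ofOption o).wrap c ∈ X
    · have := H.bound _ (pal_mem_nodeSet hX)
      rw [hnext.1 hX]
      refine ⟨by omega, by omega, fun h => by omega, fun h => absurd hX h⟩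
    · rw [hnext.2 hX]; simp [hX]
  simp [(e' 1 (by omega)).trans c1]
  refine ⟨⟨hb0.1, hb0.2.1⟩, fun h0 => ?_, fun h0 => ?_⟩
  · refine wp_createNode F (hG _) hPB hS hT hlb ho ?_ (hb0.2.2.1 h0) ?_
    · simp [e', h10]
    · exact fun t' h' G' => hQ t' h' _ G' (Or.inl rfl)
  · have hX : (Node.ofOption o).wrap c ∈ X := not_not.1 fun h => h0 (hb0.2.2.2 h)
    refine hQ _ h X (hG _) hX ?_ le_rfl ?_ rfl
    · simp [e20, hnext.1 hX]
    · simp; omega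

/-! ### Updating the counters -/

/-- Count the new position, whose longest palindromic suffix has the node `R[12]`; if this node was
not used before, then its suffix link and the node itself are counted as well. -/
def countNode : Code :=
  .seq (.ld 16 13 12) (.seq (.ld 17 14 12) (.seq (.add 14 13 14) (.seq (.add 13 13 2)
    (.seq (.st 16 12 13) (.ite (.eq 14 1) (.seq (.ld 13 15 12) (.seq (.ld 17 16 15)
      (.seq (.add 16 16 2) (.seq (.st 17 15 16) (.seq (.ld 2 16 1) (.seq (.add 16 16 2)
        (.st 2 1 16))))))) .skip)))))

theorem sufcnt_le (s t : List (Fin σ)) : sufcnt s t ≤ s.length :=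
  (Finset.card_filter_le _ _).trans (by simp)

theorem ncard_palSubstrings_le (s : List (Fin σ)) : (palSubstrings s).ncard ≤ s.length + 1 := by
  induction s using List.reverseRecOn with
  | nil =>
    have : palSubstrings ([] : List (Fin σ)) ⊆ {[]} := fun t ht => by simpa using ht.2
    simpa using Set.ncard_le_ncard this
  | append_singleton s c ih =>
    rw [palSubstrings_append (isLongestSuffix_sufpal _)]
    have := Set.ncard_insert_le (sufpal (s ++ [c]) (s ++ [c]).length) (palSubstrings s)
    simp only [List.length_append, List.length_singleton] at this ⊢
    omega

theorem linkCount_le (s t : List (Fin σ)) : linkCount s t ≤ s.length + 1 :=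
  (Set.ncard_le_ncard (fun _ h => h.1) (finite_palSubstrings s)).trans (ncard_palSubstrings_le s)

open Classical in
theorem Counts.append {fld fld' : ℕ → ℤ → ℤ} {h : Node σ → ℤ} {X : Set (List (Fin σ))}
    {s x : List (Fin σ)} {c : Fin σ} (C : Counts fld h X s) (hx : IsLongestSuffix (s ++ [c]) x)
    (hX : x ∈ X)
    (h16 : ∀ t ∈ X, t ≠ [] →
      fld' 16 (h (.pal t)) = fld 16 (h (.pal t)) + if t = x then 1 else 0)
    (h17 : ∀ t ∈ X, t ≠ [] → fld' 17 (h (.pal t)) =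
      fld 17 (h (.pal t)) + if x ∉ palSubstrings s ∧ t = linkStr x then 1 else 0)
    (h2 : fld' 2 0 = fld 2 0 + if x ∈ palSubstrings s then 0 else 1) :
    Counts fld' h X (s ++ [c]) := by
  refine ⟨?_, fun t ht h0 => ?_, fun t ht h0 => ?_, ?_⟩
  · rw [palSubstrings_append hx]
    exact Set.insert_subset hX C.subset
  · rw [h16 t ht h0, C.cnt t ht h0, sufcnt_append hx]
    push_cast; rfl
  · rw [h17 t ht h0, C.linkCount t ht h0]
    by_cases hm : x ∈ palSubstrings s
    · unfold Eertree.linkCount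
      rw [palSubstrings_append_of_mem hx hm]
      simp [hm]
    · rw [linkCount_append hx hm]
      simp [hm]
  · rw [h2, C.count, palSubstrings_append hx]
    split_ifs with hm
    · rw [Set.insert_eq_of_mem hm]; simp
    · rw [Set.ncard_insert_of_notMem hm (finite_palSubstrings s)]; simp

theorem wp_countNode {w B K : ℕ} {v : Bool} {Q : St → Prop} {t : St} {h : Node σ → ℤ}
    {X : Set (List (Fin σ))} {s x : List (Fin σ)} {c : Fin σ}
    {S T : ℕ → List (Fin σ)} (F : Fits w B K) (G : Stage K v t h X c (s ++ [c]) s S T)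
    (hPB : t.fld 3 0 ≤ B) (hx : IsLongestSuffix (s ++ [c]) x) (hX : x ∈ X)
    (h12 : t.reg 12 = h (.pal x))
    (hQ : ∀ t' : St, Stage K v t' h X c (s ++ [c]) (s ++ [c]) S T → t'.reg 12 = t.reg 12 →
      t'.fld 3 0 = t.fld 3 0 → t'.lo = t.lo → Q t') :
    countNode.wp w B K Q t := by
  have hw : (32 : ℤ) * B ≤ 2 ^ w := by exact_mod_cast F.blocks
  have H := G.heap
  have hP3 := H.blocks
  have hx0 : x ≠ [] := hx.ne_nil (by simp)
  have hzX := H.link_mem x hX hx0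
  have hb := H.bound _ (pal_mem_nodeSet hX)
  have hbz := H.bound _ (pal_mem_nodeSet hzX)
  have hC := G.counts
  have b1 := sufcnt_le s x
  have b2 := linkCount_le s x
  have hlen := G.arrays.length
  have hE := G.end_le v
  have hE' := G.end_le (!v)
  simp at hlen
  have hlink := H.link _ (pal_mem_nodeSet hX)
  rw [link_pal hx0] at hlink
  obtain ⟨c0, c1, c2, c3⟩ := G.consts
  simp [countNode, h12, hC.cnt x hX hx0, hC.linkCount x hX hx0, c1, c2, hlink]
  have hm := mem_palSubstrings_iff (s := s) hx0 hx.1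
  have hinj : ∀ y ∈ X, ∀ z ∈ X, h (.pal y) = h (.pal z) ↔ y = z := fun y hy z hz =>
    ⟨fun he => by have := H.inj (pal_mem_nodeSet hy) (pal_mem_nodeSet hz) he; cases this; rfl,
      fun he => he ▸ rfl⟩
  -- only the counters change
  have hfin : ∀ t' : St, (∀ f, f ≠ 2 → f ≠ 16 → f ≠ 17 → t'.fld f = t.fld f) → t'.pos = t.pos →
      (∀ r, r < 13 → t'.reg r = t.reg r) → t'.lo = t.lo → Counts t'.fld h X (s ++ [c]) → Q t' := by
    intro t' h1 h2 h3 h4 h5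
    have ev : ∀ v, t'.fld (endFld v) = t.fld (endFld v) := fun v => by
      have := @endFld_le v
      exact h1 _ (by omega) (by omega) (by omega)
    refine hQ t' ⟨?_, h5, ⟨?_, ?_, ?_, ?_⟩, ?_, ?_, ?_⟩ (h3 12 (by omega))
      (congrFun (h1 3 (by omega) (by omega) (by omega)) 0) h4
    · refine H.congr ?_ ?_ ?_ (fun f hf hf' k _ => ?_) (fun k _ => ?_) ?_
      · rw [h1 3 (by omega) (by omega) (by omega)]
      · rw [h1 4 (by omega) (by omega) (by omega)]
      · rw [h1 5 (by omega) (by omega) (by omega)]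
      · rw [h1 f (by omega) (by omega) (by omega)]
      · rw [h1 18 (by omega) (by omega) (by omega), h1 19 (by omega) (by omega) (by omega)]
        simp
      · rw [h1 18 (by omega) (by omega) (by omega), h1 19 (by omega) (by omega) (by omega),
          h1 3 (by omega) (by omega) (by omega)]
        exact H.closed
    · rw [ev, ev]; exact G.arrays.length
    · rw [ev, h2]; exact G.arrays.char
    · rw [ev, h2]; exact G.arrays.start
    · rw [ev, h2]; exact G.arrays.finish
    · intro v
      rw [ev, h1 3 (by omega) (by omega) (by omega)]
      exact G.end_le v
    · exact ⟨(h3 0 (by omega)).trans c0, (h3 1 (by omega)).trans c1, (h3 2 (by omega)).trans c2,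
        (h3 3 (by omega)).trans c3⟩
    · rw [h3 4 (by omega), ev]; exact G.last
  refine ⟨by omega, by omega, fun h0 => ⟨by omega, by omega, by omega,
    hfin _ (fun f f2 f16 f17 => ?_) rfl
    (fun r hr => ?_) rfl (hC.append hx hX (fun y hy hy0 => ?_) (fun y hy hy0 => ?_) ?_)⟩,
    fun h0 => hfin _ (fun f f2 f16 f17 => ?_) rfl
    (fun r hr => ?_) rfl (hC.append hx hX (fun y hy hy0 => ?_) (fun y hy hy0 => ?_) ?_)⟩
  · simp [f2, f16, f17]
  · rcases (by omega : r ≠ 13 ∧ r ≠ 14 ∧ r ≠ 15 ∧ r ≠ 16) with ⟨_, _, _, _⟩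
    simp [*]
  · by_cases hyx : y = x
    · subst hyx; simp [hC.cnt y hX hx0]
    · simp [hyx, hinj _ hy _ hX]
  · have : x ∉ palSubstrings s := by rw [hm]; omega
    by_cases hyz : y = linkStr x
    · subst hyz; simp [this]
    · simp [hyz, hinj _ hy _ hzX]
  · have : x ∉ palSubstrings s := by rw [hm]; omega
    simp [this]
  · simp [f16]
  · rcases (by omega : r ≠ 13 ∧ r ≠ 14) with ⟨_, _⟩
    simp [*]
  · by_cases hyx : y = x
    · subst hyx; simp [hC.cnt y hX hx0]
    · simp [hyx, hinj _ hy _ hX]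
  · have : x ∈ palSubstrings s := by rw [hm]; omega
    simp [this]
  · have : x ∈ palSubstrings s := by rw [hm]; omega
    simp [this]

/-! ### Updating the surfaces -/

theorem presurf_append {s x : List (Fin σ)} {c : Fin σ} (hx : IsLongestSuffix (s ++ [c]) x)
    (i : ℕ) : presurf (s ++ [c]) i = if i = sufStart (s ++ [c]) then x else presurf s i := by
  have hne : s ++ [c] ≠ [] := by simp
  split_ifs with hi
  · subst hi
    rw [presurf_of_isSurface (isSurface_sufStart hne), hx.sufStart_eq hne,
      sub_suffix_eq (hx.ne_nil hne) hx.2.1]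
  · by_cases h : ∃ j, IsSurface s i j
    · obtain ⟨j, hj⟩ := h
      rw [presurf_of_isSurface hj, presurf_of_isSurface (isSurface_append_iff.2 (Or.inr ⟨hj, hi⟩)),
        sub_append hj.palAt.2.2.1]
    · rw [presurf_of_forall fun j hj => h ⟨j, hj⟩, presurf_of_forall fun j hj => ?_]
      rcases isSurface_append_iff.1 hj with ⟨h1, _⟩ | ⟨h1, _⟩
      · exact hi h1
      · exact h ⟨j, h1⟩

theorem sufsurf_append {s x : List (Fin σ)} {c : Fin σ} (hx : IsLongestSuffix (s ++ [c]) x)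
    {z : List (Fin σ)} (hz : presurf s (sufStart (s ++ [c])) = z) (j : ℕ) :
    sufsurf (s ++ [c]) j = if j = s.length + 1 then x else
      if z ≠ [] ∧ j = sufStart (s ++ [c]) + z.length - 1 then [] else sufsurf s j := by
  split_ifs with h1 h2
  · subst h1
    rw [← hx.sufpal_eq, ← sufsurf_length]
    simp
  · obtain ⟨hz0, rfl⟩ := h2
    subst hz
    have hs := isSurface_of_presurf_ne hz0
    refine sufsurf_of_forall fun i hi => ?_
    rcases isSurface_append_iff.1 hi with ⟨_, h⟩ | ⟨h, hne⟩
    · exact h1 h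
    · exact hne (h.eq_suflen.trans hs.eq_suflen.symm)
  · by_cases h : ∃ i, IsSurface s i j
    · obtain ⟨i, hi⟩ := h
      have hne : i ≠ sufStart (s ++ [c]) := by
        rintro rfl
        rw [presurf_of_isSurface hi] at hz
        subst hz
        have hp := hi.palAt
        refine h2 ⟨sub_ne_nil hp.1 hp.2.1 hp.2.2.1, ?_⟩
        rw [length_sub hp.1 hp.2.1 hp.2.2.1]
        have := hp.2.1
        omega
      rw [sufsurf_of_isSurface hi, sufsurf_of_isSurface (isSurface_append_iff.2 (Or.inr ⟨hi, hne⟩)),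
        sub_append hi.palAt.2.2.1]
    · rw [sufsurf_of_forall fun i hi => h ⟨i, hi⟩, sufsurf_of_forall fun i hi => ?_]
      rcases isSurface_append_iff.1 hi with ⟨_, h3⟩ | ⟨h3, _⟩
      · exact h1 h3
      · exact h ⟨i, h3⟩

theorem presurf_mem_palSubstrings (s : List (Fin σ)) (i : ℕ) : presurf s i ∈ palSubstrings s := by
  by_cases h : ∃ j, IsSurface s i j
  · obtain ⟨j, hj⟩ := h
    rw [presurf_of_isSurface hj]
    exact ⟨hj.2.1, sub_infix _ _ _⟩
  · rw [presurf_of_forall fun j hj => h ⟨j, hj⟩]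
    exact nil_mem_palSubstrings s

theorem sufsurf_mem_palSubstrings (s : List (Fin σ)) (j : ℕ) : sufsurf s j ∈ palSubstrings s := by
  by_cases h : ∃ i, IsSurface s i j
  · obtain ⟨i, hi⟩ := h
    rw [sufsurf_of_isSurface hi]
    exact ⟨hi.2.1, sub_infix _ _ _⟩
  · rw [sufsurf_of_forall fun i hi => h ⟨i, hi⟩]
    exact nil_mem_palSubstrings s

/-- Store the new surface, which ends at the last position `R[4]` and has the node `R[12]`, and
delete the surface with the same start position. -/
def storeSurface (v : Bool) : Code :=
  .seq (.ld 12 13 12) (.seq (.sub 14 4 13) (.seq (.add 14 14 2) (.seq (.pld (startArr v) v 15 14)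
    (.seq (.ite (.eq 15 2) .skip (.seq (.ld 12 16 15) (.seq (.add 16 14 16) (.seq (.sub 16 16 2)
      (.pst (startArr !v) v 16 2)))))
    (.seq (.pst (startArr v) v 14 12) (.pst (startArr !v) v 4 12))))))

/-- Allocate a block.  As every push does so, the positions of the string remain below the number of
blocks, and all entries of the position arrays that later operations access lie in blocks that are
used already. -/
def reserve : Code :=
  .seq (.ld 3 13 1) (.seq (.st 18 13 1) (.seq (.st 19 13 1) (.seq (.touch 13)
    (.seq (.add 13 13 2) (.st 3 1 13)))))

theorem wp_reserve {w B K : ℕ} {v : Bool} {Q : St → Prop} {t : St} {h : Node σ → ℤ}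
    {X : Set (List (Fin σ))} {s : List (Fin σ)} {c : Fin σ}
    (G : Stage K v t h X c s s (presurf s) (sufsurf s)) (hPB : t.fld 3 0 < B)
    (hlo : t.lo ≤ t.fld 3 0)
    (hQ : ∀ t' : St, Inv K v t'.fld t'.pos h X s → t'.fld 3 0 = t.fld 3 0 + 1 →
      t'.lo = t'.fld 3 0 → Q t') :
    reserve.wp w B K Q t := by
  have H := G.heap
  have hP3 := H.blocks
  obtain ⟨c0, c1, c2, c3⟩ := G.consts
  simp [reserve, c1, c2]
  refine ⟨by omega, by omega, by omega, hQ _ ⟨?_, ?_, ⟨?_, ?_, ?_, ?_⟩, ?_⟩ ?_ ?_⟩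
  · refine H.congr ?_ ?_ ?_ (fun f hf hf' k _ => ?_) (fun k hk => ?_) fun k k0 k1 => ?_
    · simp
    · simp
    · simp
    · rcases (by omega : f ≠ 3 ∧ f ≠ 18 ∧ f ≠ 19) with ⟨h3, h18, h19⟩
      simp [h3, h18, h19]
    · simp [hk.ne]
    · simp at k1 ⊢
      by_cases hk : k = t.fld 3 0
      · subst hk; simp; omega
      · have := H.closed k k0 (by omega)
        simp [hk]; omega
  · exact G.counts.congr H (by simp) fun k _ => by simp
  · simpa using G.arrays.length
  · simpa using G.arrays.char
  · simpa using G.arrays.start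
  · simpa using G.arrays.finish
  · intro u
    have := G.end_le u
    simp; omega
  · simp
  · simp; omega

theorem wp_storeSurface {w B K : ℕ} {v : Bool} {Q : St → Prop} {t : St} {h : Node σ → ℤ}
    {X : Set (List (Fin σ))} {s x : List (Fin σ)} {c : Fin σ} (F : Fits w B K)
    (G : Stage K v t h X c (s ++ [c]) (s ++ [c]) (presurf s) (sufsurf s))
    (hPB : t.fld 3 0 < B) (hx : IsLongestSuffix (s ++ [c]) x)
    (h12 : t.reg 12 = h (.pal x))
    (hQ : ∀ t' : St,
      Stage K v t' h X c (s ++ [c]) (s ++ [c]) (presurf (s ++ [c])) (sufsurf (s ++ [c])) →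
      t'.fld 3 0 = t.fld 3 0 → t'.lo = t.lo → Q t') :
    (storeSurface v).wp w B K Q t := by
  have hw : (32 : ℤ) * B ≤ 2 ^ w := by exact_mod_cast F.blocks
  have H := G.heap
  have hP3 := H.blocks
  have hne : s ++ [c] ≠ [] := by simp
  have hx0 : x ≠ [] := hx.ne_nil hne
  have hlx0 := List.length_pos_iff.2 hx0
  have hlx := hx.2.1.length_le
  have hX : x ∈ X := G.counts.subset hx.mem_palSubstrings
  have hstart := hx.sufStart_eq hne
  have hlen := G.arrays.length
  have hE := G.end_le v
  have hE' := G.end_le (!v)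
  obtain ⟨c0, c1, c2, c3⟩ := G.consts
  have hxl := H.len _ (pal_mem_nodeSet hX)
  have hb := H.bound _ (pal_mem_nodeSet hX)
  simp only [Node.len] at hxl
  have ha1 := presurf_append hx
  have ha2 := sufsurf_append hx rfl
  set i₀ := sufStart (s ++ [c])
  set z := presurf s i₀ with hz
  have hsX : palSubstrings s ⊆ X := fun y hy => G.counts.subset
    ⟨hy.1, hy.2.trans (List.infix_append' [] s [c])⟩
  have hzX : z ∈ X := hsX (presurf_mem_palSubstrings s i₀)
  have hbz := H.bound _ (pal_mem_nodeSet hzX)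
  have hzl := H.len _ (pal_mem_nodeSet hzX)
  simp only [Node.len] at hzl
  have hzE := G.arrays.start i₀ (by omega) (by omega)
  simp at hlen hlx
  simp at hstart
  rw [show (i₀ : ℤ) - t.fld (endFld !v) 0 = t.fld (endFld v) 0 - x.length + 1 by omega, ← hz] at hzE
  simp [storeSurface, h12, hxl, c2, G.last, hzE, wp_seq_eq, hzl]
  have hz1 : h (.pal z) = 1 ↔ z = [] := by
    rw [← H.even]
    refine ⟨fun he => ?_, fun he => by rw [he]⟩
    have := H.inj (pal_mem_nodeSet hzX) (pal_mem_nodeSet H.nil_mem) he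
    exact Node.pal.inj this
  have hzs : z ≠ [] → 1 ≤ z.length ∧ i₀ + z.length ≤ s.length + 1 := by
    intro h
    have hs : PalAt s i₀ (i₀ + z.length - 1) := (isSurface_of_presurf_ne h).palAt
    have := hs.2.2.1
    have := List.length_pos_iff.2 h
    omega
  -- only the surfaces change
  have hfin : ∀ t' : St, t'.fld = t.fld → (∀ r, r < 5 → t'.reg r = t.reg r) → t'.lo = t.lo →
      t'.pos 0 = t.pos 0 →
      (∀ p, t'.pos (startArr v) (view v p) = if p = t.fld (endFld v) 0 - x.length + 1 then
        h (.pal x) else t.pos (startArr v) (view v p)) →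
      (∀ p, t'.pos (startArr !v) (view v p) = if p = t.fld (endFld v) 0 then h (.pal x) else
        if z ≠ [] ∧ p = t.fld (endFld v) 0 - x.length + 1 + z.length - 1 then 1
        else t.pos (startArr !v) (view v p)) → Q t' := by
    intro t' h1 h2 h3 h4 h5 h6
    refine hQ t' ⟨?_, ?_, ⟨?_, fun i d h1' hd => ?_, fun i h1' h2' => ?_, fun i h1' h2' => ?_⟩, ?_,
      G.consts.congr fun r hr => h2 r (by omega), ?_⟩ (by rw [h1]) h3
    · rw [h1]; exact G.heap
    · rw [h1]; exact G.counts
    · rw [h1]; exact G.arrays.length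
    · rw [h1, h4]; exact G.arrays.char i d h1' hd
    · rw [h1, h5, ha1]
      have := G.arrays.start i h1' h2'
      simp at h2'
      by_cases hi : i = i₀
      · rw [if_pos hi, if_pos (by omega)]
      · rw [if_neg hi, if_neg (by omega), this]
    · rw [h1, h6, ha2]
      have := G.arrays.finish i h1' h2'
      simp at h2'
      by_cases hi : i = s.length + 1
      · rw [if_pos hi, if_pos (by omega)]
      · rw [if_neg hi, if_neg (by omega)]
        by_cases hi' : z ≠ [] ∧ i = i₀ + z.length - 1
        · have := hzs hi'.1
          rw [if_pos hi', if_pos ⟨hi'.1, by omega⟩, H.even]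
        · rw [if_neg hi', if_neg, this]
          rintro ⟨h7, h8⟩
          have := hzs h7
          exact hi' ⟨h7, by omega⟩
    · rw [h1]; exact G.end_le
    · rw [h1, h2 4 (by omega)]; exact G.last
  refine ⟨by omega, by omega, by omega, by omega, fun h0 => ⟨by omega, by omega,
    hfin _ rfl (fun r hr => ?_) rfl ?_ (fun p => ?_) fun p => ?_⟩, fun h0 => ?_⟩
  · simp only [St.setPos_reg, St.setReg_reg]
    repeat rw [Function.update_of_ne (by omega)]
  · simp
  · simp [Function.update_apply]
  · simp [Function.update_apply, hz1.1 h0]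
  · have hzs' := hzs fun he => h0 (hz1.2 he)
    refine ⟨by omega, by omega, by omega, by omega,
      hfin _ rfl (fun r hr => ?_) rfl ?_ (fun p => ?_) fun p => ?_⟩
    · simp only [St.setPos_reg, St.setReg_reg]
      repeat rw [Function.update_of_ne (by omega)]
    · simp
    · simp [Function.update_apply]
    · simp [Function.update_apply, hz1.not.1 h0]

/-- Append the character `R[0]` in the direction `v`. -/
def push (v : Bool) : Code :=
  .seq (findInner v) (.seq (appendChar v) (.seq (ensureNode v) (.seq countNode
    (.seq (storeSurface v) reserve))))

/-- The two trie insertions, for the table of the new node and for the edge to it, need at most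
`K + 1` blocks each; one block is needed for the node itself and one is allocated by `reserve`. -/
theorem wp_push {w B K : ℕ} {v : Bool} {Q : St → Prop} {t : St} {h : Node σ → ℤ}
    {X : Set (List (Fin σ))} {s : List (Fin σ)} {c : Fin σ} (F : Fits w B K)
    (I : Inv K v t.fld t.pos h X s) (hPB : t.fld 3 0 + 2 * K + 4 ≤ B)
    (hc : t.reg 0 = (c : ℕ)) (hlo : t.lo ≤ t.fld 3 0)
    (hQ : ∀ (t' : St) (h' : Node σ → ℤ) (X' : Set (List (Fin σ))),
      Inv K v t'.fld t'.pos h' X' (s ++ [c]) → t'.fld 3 0 ≤ t.fld 3 0 + 2 * K + 4 →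
      t'.lo = t'.fld 3 0 → Q t') :
    (push v).wp w B K Q t := by
  have hS : ∀ i, presurf s i ∈ X := fun i => I.counts.subset (presurf_mem_palSubstrings s i)
  have hT : ∀ i, sufsurf s i ∈ X := fun i => I.counts.subset (sufsurf_mem_palSubstrings s i)
  refine wp_seq.2 (wp_findInner F I (by omega) hc fun reg o hcc hlb ho r4 r10 => ?_)
  refine wp_seq.2 (wp_appendChar (t := { t with reg := reg }) I (by simp; omega) hcc r4
    fun t₁ G₁ p₁ s₁ l₁ => ?_)
  simp only at p₁ s₁ l₁
  refine wp_seq.2 (wp_ensureNode F G₁ (by omega) hS hT hlb ho (s₁.trans r10)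
    fun t₂ h₂ X₂ G₂ m₂ s₂ q₂ p₂ l₂ => ?_)
  have hx := isLongestSuffix_append hlb
  refine wp_seq.2 (wp_countNode F G₂ (by omega) hx m₂ s₂ fun t₃ G₃ s₃ p₃ l₃ => ?_)
  refine wp_seq.2 (wp_storeSurface F G₃ (by omega) hx (s₃.trans s₂) fun t₄ G₄ p₄ l₄ => ?_)
  refine wp_reserve G₄ (by omega) (by omega) fun t₅ I₅ p₅ l₅ => hQ t₅ h₂ X₂ I₅ (by omega) l₅

/-! ### Removing a character -/

theorem sub_of_longestSuffix {s x : List (Fin σ)} {c : Fin σ} (hx : IsLongestSuffix (s ++ [c]) x)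
    {r : ℕ} (h1 : sufStart (s ++ [c]) ≤ r) (h2 : r ≤ s.length) :
    sub s (sufStart (s ++ [c])) r = x.take (r + 1 - sufStart (s ++ [c])) := by
  have hl := hx.2.1.length_le
  have hi := hx.sufStart_eq (by simp)
  have h0 := List.length_pos_iff.2 (hx.ne_nil (by simp))
  simp at hl hi
  have e1 : sufStart (s ++ [c]) - 1 = (s ++ [c]).length - x.length := by simp; omega
  have e2 : r - (sufStart (s ++ [c]) - 1) = r + 1 - sufStart (s ++ [c]) := by omega
  rw [← sub_append h2 (t := [c]), sub_eq (by omega) h1 (by simp; omega), List.drop_take, e2, e1,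
    ← List.suffix_iff_eq_drop.1 hx.2.1]

theorem suffix_of_palindrome {t y : List (Fin σ)} (ht : t.Palindrome) (hy : y.Palindrome)
    (h : y <+: t) : y <:+ t := by
  rw [← ht.reverse_eq, ← hy.reverse_eq]
  exact List.reverse_suffix.2 h

/-- Before the last character was appended, the suffix link `z` of the longest palindromic suffix
was the longest palindrome at its start position; it was a surface there if and only if no surface
ends at the same position now. -/
theorem isSurface_linkStr {s x : List (Fin σ)} {c : Fin σ} (hx : IsLongestSuffix (s ++ [c]) x)
    (hz : linkStr x ≠ []) :
    sub s (sufStart (s ++ [c])) (sufStart (s ++ [c]) + (linkStr x).length - 1) = linkStr x ∧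
    ∀ j, IsSurface s (sufStart (s ++ [c])) j ↔
      j = sufStart (s ++ [c]) + (linkStr x).length - 1 ∧
        sufsurf (s ++ [c]) (sufStart (s ++ [c]) + (linkStr x).length - 1) = [] := by
  have hl := hx.2.1.length_le
  have hi := hx.sufStart_eq (by simp)
  have hx0 := hx.ne_nil (by simp)
  have h0 := List.length_pos_iff.2 hx0
  have hz0 := List.length_pos_iff.2 hz
  obtain ⟨g1, g2, g3, g4⟩ := linkStr_spec hx0
  simp at hl hi
  set i₀ := sufStart (s ++ [c])
  have hsub : sub s i₀ (i₀ + (linkStr x).length - 1) = linkStr x := by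
    rw [sub_of_longestSuffix hx (by omega) (by omega)]
    rw [← show (linkStr x).length = i₀ + (linkStr x).length - 1 + 1 - i₀ by omega]
    exact (List.prefix_iff_eq_take.1 (prefix_of_palindrome hx.1 g1 g2)).symm
  refine ⟨hsub, fun j => ?_⟩
  rw [sufsurf_eq_nil_iff]
  refine isSurface_sufStart_iff (palAt_iff.2 ⟨⟨by omega, by omega, by omega⟩, hsub.symm ▸ g1⟩)
    fun r hr => ?_
  obtain ⟨⟨h1, h2, h3⟩, hp⟩ := palAt_iff.1 hr
  have hlen := length_sub h1 h2 h3
  have hpre : sub s i₀ r <+: x := by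
    rw [sub_of_longestSuffix hx h2 h3]
    exact List.take_prefix _ _
  have := g4 _ hp (suffix_of_palindrome hx.1 hp hpre) (by omega)
  omega

theorem presurf_of_append {s x : List (Fin σ)} {c : Fin σ} (hx : IsLongestSuffix (s ++ [c]) x)
    {i : ℕ} (hi : i ≤ s.length) :
    presurf s i = if i = sufStart (s ++ [c]) then
      if sufsurf (s ++ [c]) (sufStart (s ++ [c]) + (linkStr x).length - 1) = [] then linkStr x
      else [] else presurf (s ++ [c]) i := by
  rw [presurf_append hx]
  by_cases h : i = sufStart (s ++ [c])
  · rw [if_pos h, h]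
    have hl := hx.2.1.length_le
    have hi' := hx.sufStart_eq (by simp)
    simp at hl hi'
    have hz : linkStr x ≠ [] := linkStr_ne_nil (by omega)
    obtain ⟨h1, h2⟩ := isSurface_linkStr hx hz
    split_ifs with hn
    · rw [presurf_of_isSurface ((h2 _).2 ⟨rfl, hn⟩), h1]
    · exact presurf_of_forall fun j hj => hn ((h2 j).1 hj).2
  · rw [if_neg h, if_neg h]

theorem sufsurf_of_append {s x : List (Fin σ)} {c : Fin σ} (hx : IsLongestSuffix (s ++ [c]) x)
    {j : ℕ} (hj : j ≤ s.length) :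
    sufsurf s j = if linkStr x ≠ [] ∧ j = sufStart (s ++ [c]) + (linkStr x).length - 1 ∧
        sufsurf (s ++ [c]) j = [] then linkStr x else sufsurf (s ++ [c]) j := by
  have hs := sufsurf_append hx rfl j
  rw [if_neg (by omega)] at hs
  split_ifs with h
  · obtain ⟨hz, rfl, hn⟩ := h
    obtain ⟨h1, h2⟩ := isSurface_linkStr hx hz
    rw [sufsurf_of_isSurface ((h2 _).2 ⟨rfl, hn⟩), h1]
  · rw [hs, if_neg]
    rintro ⟨h1, h2⟩
    have h3 := isSurface_of_presurf_ne h1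
    have hz : linkStr x ≠ [] := by
      have hl := hx.2.1.length_le
      have hi' := hx.sufStart_eq (by simp)
      have := h3.palAt.2.1
      have := h3.palAt.2.2.1
      simp at hl hi'
      exact linkStr_ne_nil (by omega)
    obtain ⟨h4, h5⟩ := isSurface_linkStr hx hz
    rw [← h2] at h3
    obtain ⟨h6, h7⟩ := (h5 j).1 h3
    exact h ⟨hz, h6, h6 ▸ h7⟩

open Classical in
theorem Counts.of_append {fld fld' : ℕ → ℤ → ℤ} {h : Node σ → ℤ} {X : Set (List (Fin σ))}
    {s x : List (Fin σ)} {c : Fin σ} (C : Counts fld h X (s ++ [c]))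
    (hx : IsLongestSuffix (s ++ [c]) x)
    (h16 : ∀ t ∈ X, t ≠ [] →
      fld' 16 (h (.pal t)) = fld 16 (h (.pal t)) - if t = x then 1 else 0)
    (h17 : ∀ t ∈ X, t ≠ [] → fld' 17 (h (.pal t)) =
      fld 17 (h (.pal t)) - if x ∉ palSubstrings s ∧ t = linkStr x then 1 else 0)
    (h2 : fld' 2 0 = fld 2 0 - if x ∈ palSubstrings s then 0 else 1) :
    Counts fld' h X s := by
  refine ⟨?_, fun t ht h0 => ?_, fun t ht h0 => ?_, ?_⟩
  · refine Set.Subset.trans ?_ C.subset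
    rw [palSubstrings_append hx]
    exact Set.subset_insert _ _
  · rw [h16 t ht h0, C.cnt t ht h0, sufcnt_append hx]
    push_cast; ring
  · rw [h17 t ht h0, C.linkCount t ht h0]
    by_cases hm : x ∈ palSubstrings s
    · unfold Eertree.linkCount
      rw [palSubstrings_append_of_mem hx hm]
      simp [hm]
    · rw [linkCount_append hx hm]
      simp [hm]
  · rw [h2, C.count, palSubstrings_append hx]
    split_ifs with hm
    · rw [Set.insert_eq_of_mem hm]; simp
    · rw [Set.ncard_insert_of_notMem hm (finite_palSubstrings s)]; simp

/-- Undo the counting of the last position, whose longest palindromic suffix has the node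
`R[12]`. -/
def uncountNode : Code :=
  .seq (.ld 16 13 12) (.seq (.sub 13 13 2) (.seq (.st 16 12 13) (.seq (.ld 17 14 12)
    (.seq (.add 13 13 14) (.ite (.eq 13 1) (.seq (.ld 13 15 12) (.seq (.ld 17 16 15)
      (.seq (.sub 16 16 2) (.seq (.st 17 15 16) (.seq (.ld 2 16 1) (.seq (.sub 16 16 2)
        (.st 2 1 16))))))) .skip)))))

theorem wp_uncountNode {w B K : ℕ} {v : Bool} {Q : St → Prop} {t : St} {h : Node σ → ℤ}
    {X : Set (List (Fin σ))} {s x : List (Fin σ)} {c : Fin σ} (F : Fits w B K)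
    (I : Inv K v t.fld t.pos h X (s ++ [c])) (hPB : t.fld 3 0 ≤ B)
    (hx : IsLongestSuffix (s ++ [c]) x) (r1 : t.reg 1 = 0) (r2 : t.reg 2 = 1)
    (h12 : t.reg 12 = h (.pal x))
    (hQ : ∀ t' : St, Counts t'.fld h X s → (∀ f, f ≠ 2 → f ≠ 16 → f ≠ 17 → t'.fld f = t.fld f) →
      t'.pos = t.pos → (∀ r, r < 13 → t'.reg r = t.reg r) → t'.lo = t.lo → Q t') :
    uncountNode.wp w B K Q t := by
  have hw : (32 : ℤ) * B ≤ 2 ^ w := by exact_mod_cast F.blocks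
  have H := I.heap
  have hC := I.counts
  have hP3 := H.blocks
  have hx0 : x ≠ [] := hx.ne_nil (by simp)
  have hX : x ∈ X := hC.subset hx.mem_palSubstrings
  have hzX := H.link_mem x hX hx0
  have hb := H.bound _ (pal_mem_nodeSet hX)
  have hbz := H.bound _ (pal_mem_nodeSet hzX)
  have b1 := sufcnt_le s x
  have b2 := linkCount_le s x
  have hlen := I.arrays.length
  have hE := I.end_lt v
  have hE' := I.end_lt (!v)
  simp at hlen
  have hlink := H.link _ (pal_mem_nodeSet hX)
  rw [link_pal hx0] at hlink
  have hcnt := hC.cnt x hX hx0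
  rw [sufcnt_append hx, if_pos rfl] at hcnt
  have hlc := hC.linkCount x hX hx0
  rw [linkCount_append_self hx] at hlc
  simp [uncountNode, h12, hcnt, hlc, r1, r2, hlink]
  have hm := mem_palSubstrings_iff (s := s) hx0 hx.1
  have hinj : ∀ y ∈ X, ∀ z ∈ X, h (.pal y) = h (.pal z) ↔ y = z := fun y hy z hz =>
    ⟨fun he => Node.pal.inj (H.inj (pal_mem_nodeSet hy) (pal_mem_nodeSet hz) he),
      fun he => he ▸ rfl⟩
  refine ⟨by omega, by omega, fun h0 => ⟨by omega, by omega, by omega, hQ _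
    (hC.of_append hx (fun y hy hy0 => ?_) (fun y hy hy0 => ?_) ?_) (fun f f2 f16 f17 => ?_) rfl
    (fun r hr => ?_) rfl⟩, fun h0 => hQ _
    (hC.of_append hx (fun y hy hy0 => ?_) (fun y hy hy0 => ?_) ?_) (fun f f2 f16 f17 => ?_) rfl
    (fun r hr => ?_) rfl⟩
  · by_cases hyx : y = x
    · subst hyx; simp [hcnt]
    · simp [hyx, hinj _ hy _ hX]
  · have : x ∉ palSubstrings s := by rw [hm]; omega
    by_cases hyz : y = linkStr x
    · subst hyz; simp [this]
    · simp [hyz, hinj _ hy _ hzX]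
  · have : x ∉ palSubstrings s := by rw [hm]; omega
    simp [this]
  · simp [f2, f16, f17]
  · rcases (by omega : r ≠ 13 ∧ r ≠ 14 ∧ r ≠ 15 ∧ r ≠ 16) with ⟨_, _, _, _⟩
    simp [*]
  · by_cases hyx : y = x
    · subst hyx; simp [hcnt]
    · simp [hyx, hinj _ hy _ hX]
  · have : x ∈ palSubstrings s := by rw [hm]; omega
    simp [this]
  · have : x ∈ palSubstrings s := by rw [hm]; omega
    simp [this]
  · simp [f16]
  · rcases (by omega : r ≠ 13 ∧ r ≠ 14) with ⟨_, _⟩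
    simp [*]

/-- Remove the surface that ends at the last position `R[4]` and has the node `R[12]`; the suffix
link of this node becomes a surface unless another surface ends at the same position. -/
def restoreSurface (v : Bool) : Code :=
  .seq (.ld 12 13 12) (.seq (.sub 14 4 13) (.seq (.add 14 14 2) (.seq (.ld 13 15 12)
    (.seq (.pst (startArr v) v 14 2)
    (.seq (.ite (.eq 15 2) .skip (.seq (.ld 12 16 15) (.seq (.add 16 14 16) (.seq (.sub 16 16 2)
      (.seq (.pld (startArr !v) v 17 16) (.ite (.eq 17 2)
        (.seq (.pst (startArr v) v 14 15) (.pst (startArr !v) v 16 15)) .skip))))))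
    (.seq (.sub 4 4 2) (.st (endFld v) 1 4)))))))

theorem wp_restoreSurface {w B K : ℕ} {v : Bool} {Q : St → Prop} {t : St} {h : Node σ → ℤ}
    {X : Set (List (Fin σ))} {s x : List (Fin σ)} {c : Fin σ} (F : Fits w B K)
    (H : Heap K t.fld h X) (C : Counts t.fld h X s)
    (A : Arrays v t.fld t.pos h (s ++ [c]) (presurf (s ++ [c])) (sufsurf (s ++ [c])))
    (he : ∀ v, t.fld (endFld v) 0 < t.fld 3 0) (hPB : t.fld 3 0 ≤ B)
    (hx : IsLongestSuffix (s ++ [c]) x) (hsX : palSubstrings (s ++ [c]) ⊆ X)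
    (r1 : t.reg 1 = 0) (r2 : t.reg 2 = 1) (r4 : t.reg 4 = t.fld (endFld v) 0)
    (h12 : t.reg 12 = h (.pal x))
    (hQ : ∀ t' : St, Inv K v t'.fld t'.pos h X s → t'.fld 3 0 = t.fld 3 0 → t'.lo = t.lo → Q t') :
    (restoreSurface v).wp w B K Q t := by
  have hw : (32 : ℤ) * B ≤ 2 ^ w := by exact_mod_cast F.blocks
  have hP3 := H.blocks
  have hne : s ++ [c] ≠ [] := by simp
  have hx0 : x ≠ [] := hx.ne_nil hne
  have hlx0 := List.length_pos_iff.2 hx0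
  have hlx := hx.2.1.length_le
  have hX : x ∈ X := hsX hx.mem_palSubstrings
  have hstart := hx.sufStart_eq hne
  have hlen := A.length
  have hE := he v
  have hE' := he (!v)
  have hxl := H.len _ (pal_mem_nodeSet hX)
  have hb := H.bound _ (pal_mem_nodeSet hX)
  simp only [Node.len] at hxl
  have hlink := H.link _ (pal_mem_nodeSet hX)
  rw [link_pal hx0] at hlink
  have hzX := H.link_mem x hX hx0
  have hzlt := (linkStr_spec hx0).2.2.1
  have ha1 := @presurf_of_append _ _ _ _ hx
  have ha2 := @sufsurf_of_append _ _ _ _ hx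
  set i₀ := sufStart (s ++ [c])
  generalize linkStr x = z at *
  have hbz := H.bound _ (pal_mem_nodeSet hzX)
  have hzl := H.len _ (pal_mem_nodeSet hzX)
  simp only [Node.len] at hzl
  -- the word `1` names the node `even` and stands for an absent surface
  have hnil : ∀ y ∈ X, h (.pal y) = 1 ↔ y = [] := fun y hy => by
    rw [← H.even]
    exact ⟨fun he => Node.pal.inj (H.inj (pal_mem_nodeSet hy) (pal_mem_nodeSet H.nil_mem) he),
      fun he => by rw [he]⟩
  simp at hlen hlx
  simp at hstart
  have hyE : z ≠ [] → t.pos (startArr !v) (view v (t.fld (endFld v) 0 - x.length + 1 +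
      z.length - 1)) = h (.pal (sufsurf (s ++ [c]) (i₀ + z.length - 1))) := by
    intro h0
    have := List.length_pos_iff.2 h0
    rw [← A.finish (i₀ + z.length - 1) (by omega) (by simp; omega)]
    congr 2
    omega
  have hyX := hsX (sufsurf_mem_palSubstrings (s ++ [c]) (i₀ + z.length - 1))
  have hby := H.bound _ (pal_mem_nodeSet hyX)
  simp [restoreSurface, h12, hxl, r1, r2, r4, hlink, wp_seq_eq, hzl]
  -- only the surfaces and the last position change
  have hfin : ∀ t' : St, t'.fld = Function.update t.fld (endFld v)
        (Function.update (t.fld (endFld v)) 0 (t.fld (endFld v) 0 - 1)) → t'.lo = t.lo →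
      t'.pos 0 = t.pos 0 →
      (∀ p, t'.pos (startArr v) (view v p) = if p = t.fld (endFld v) 0 - x.length + 1 then
        (if z ≠ [] ∧ sufsurf (s ++ [c]) (i₀ + z.length - 1) = [] then h (.pal z) else 1)
        else t.pos (startArr v) (view v p)) →
      (∀ p, t'.pos (startArr !v) (view v p) =
        if z ≠ [] ∧ sufsurf (s ++ [c]) (i₀ + z.length - 1) = [] ∧
          p = t.fld (endFld v) 0 - x.length + 1 + z.length - 1 then h (.pal z)
        else t.pos (startArr !v) (view v p)) → Q t' := by
    intro t' h1 h3 h4 h5 h6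
    have e3 : ∀ f, 2 ≤ f → t'.fld f = t.fld f := fun f hf => by
      rw [h1, Function.update_of_ne (ne_endFld hf)]
    have ev : t'.fld (endFld v) 0 = t.fld (endFld v) 0 - 1 := by rw [h1]; simp
    have ev' : t'.fld (endFld !v) 0 = t.fld (endFld !v) 0 := by rw [h1]; simp
    refine hQ t' ⟨?_, ?_, ⟨?_, fun i d h1' hd => ?_, fun i h1' h2' => ?_, fun i h1' h2' => ?_⟩,
      fun u => ?_⟩ (by rw [e3 3 (by omega)]) h3
    · refine H.congr ?_ ?_ ?_ (fun f hf _ k _ => ?_) (fun k _ => ?_) ?_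
      · rw [e3 3 (by omega)]
      · rw [e3 4 (by omega)]
      · rw [e3 5 (by omega)]
      · rw [e3 f (by omega)]
      · rw [e3 18 (by omega), e3 19 (by omega)]; simp
      · rw [e3 18 (by omega), e3 19 (by omega), e3 3 (by omega)]; exact H.closed
    · exact C.congr H (by rw [e3 2 (by omega)])
        (fun k _ => by rw [e3 16 (by omega), e3 17 (by omega)]; simp)
    · rw [ev, ev']; omega
    · have hi : i ≤ s.length := by
        have := (List.getElem?_eq_some_iff.1 hd).1
        omega
      rw [ev', h4]
      exact A.char i d h1' (by rw [List.getElem?_append_left (by omega), hd])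
    · rw [ev', h5, ha1 h2']
      have := A.start i h1' (by simp; omega)
      by_cases hi : i = i₀
      · rw [if_pos hi, if_pos (by omega)]
        by_cases hz : z = []
        · simp [hz, H.even]
        · split_ifs <;> simp_all [H.even]
      · rw [if_neg hi, if_neg (by omega), this]
    · rw [ev', h6, ha2 h2']
      have := A.finish i h1' (by simp; omega)
      by_cases hi : z ≠ [] ∧ i = i₀ + z.length - 1 ∧ sufsurf (s ++ [c]) i = []
      · have := List.length_pos_iff.2 hi.1
        rw [if_pos hi, if_pos ⟨hi.1, hi.2.1 ▸ hi.2.2, by omega⟩]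
      · rw [if_neg hi, if_neg, this]
        rintro ⟨h7, h8, h9⟩
        have := List.length_pos_iff.2 h7
        have e : i = i₀ + z.length - 1 := by omega
        exact hi ⟨h7, e, e ▸ h8⟩
    · rw [e3 3 (by omega)]
      by_cases hu : u = v
      · subst hu; omega
      · obtain rfl : u = !v := by cases u <;> cases v <;> simp at hu ⊢
        omega
  refine ⟨by omega, by omega, by omega, by omega, fun h0 => ⟨by omega,
    hfin _ rfl rfl ?_ (fun p => ?_) fun p => ?_⟩, fun h0 => ?_⟩
  · simp
  · simp [Function.update_apply, (hnil z hzX).1 h0]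
  · simp [(hnil z hzX).1 h0]
  have hz0 : z ≠ [] := fun he => h0 ((hnil z hzX).2 he)
  have hz0' := List.length_pos_iff.2 hz0
  rw [hyE hz0]
  refine ⟨by omega, by omega, by omega, by omega, fun h1 => ⟨by omega, by omega, by omega,
    hfin _ rfl rfl ?_ (fun p => ?_) fun p => ?_⟩, fun h1 => ⟨by omega,
    hfin _ rfl rfl ?_ (fun p => ?_) fun p => ?_⟩⟩
  · simp
  · have := (hnil _ hyX).1 h1
    by_cases hp : p = t.fld (endFld v) 0 - x.length + 1 <;> simp [hz0, this, hp]
  · have := (hnil _ hyX).1 h1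
    simp [Function.update_apply, hz0, this]
  · simp
  · have := (hnil _ hyX).not.1 h1
    simp [Function.update_apply, this]
  · have := (hnil _ hyX).not.1 h1
    simp [this]

/-- Remove the last character in the direction `v`. -/
def pop (v : Bool) : Code :=
  .seq (.const 1 0) (.seq (.const 2 1) (.seq (.ld (endFld v) 4 1)
    (.seq (.pld (startArr !v) v 12 4) (.seq uncountNode (restoreSurface v)))))

theorem wp_pop {w B K : ℕ} {v : Bool} {Q : St → Prop} {t : St} {h : Node σ → ℤ}
    {X : Set (List (Fin σ))} {s : List (Fin σ)} {c : Fin σ} (F : Fits w B K)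
    (I : Inv K v t.fld t.pos h X (s ++ [c])) (hPB : t.fld 3 0 ≤ B)
    (hQ : ∀ t' : St, Inv K v t'.fld t'.pos h X s → t'.fld 3 0 = t.fld 3 0 → t'.lo = t.lo → Q t') :
    (pop v).wp w B K Q t := by
  have hP3 := I.heap.blocks
  obtain ⟨hE, hE1, hE2⟩ := I.end_bounds
  have hx := isLongestSuffix_sufpal (s ++ [c])
  have h12 := I.arrays.finish (s ++ [c]).length (by simp) le_rfl
  rw [sufsurf_length, show ((s ++ [c]).length : ℤ) - t.fld (endFld !v) 0 = t.fld (endFld v) 0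
    by omega] at h12
  have : 1 ≤ (s ++ [c]).length := by simp
  simp [pop]
  refine ⟨by omega, by omega, wp_seq.2 (wp_uncountNode F I hPB hx (by simp) (by simp)
    (by simp [h12]) fun t' C hf hp hr hl => ?_)⟩
  simp at hf hp hl
  have ev : ∀ v, t'.fld (endFld v) = t.fld (endFld v) := fun v => by
    have := @endFld_le v
    exact hf _ (by omega) (by omega) (by omega)
  have e3 := hf 3 (by omega) (by omega) (by omega)
  refine wp_restoreSurface F ?_ C ⟨?_, ?_, ?_, ?_⟩ ?_ ?_ hx I.counts.subset ?_ ?_ ?_ ?_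
    fun t'' I' h1 h2 => hQ t'' I' ?_ ?_
  · refine I.heap.congr ?_ ?_ ?_ (fun f h12 h15 k _ => ?_) (fun k _ => ?_) ?_
    · rw [e3]
    · rw [hf 4 (by omega) (by omega) (by omega)]
    · rw [hf 5 (by omega) (by omega) (by omega)]
    · rw [hf f (by omega) (by omega) (by omega)]
    · rw [hf 18 (by omega) (by omega) (by omega), hf 19 (by omega) (by omega) (by omega)]
      simp
    · rw [hf 18 (by omega) (by omega) (by omega), hf 19 (by omega) (by omega) (by omega), e3]
      exact I.heap.closed
  · rw [ev, ev]; exact I.arrays.length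
  · rw [ev, hp]; exact I.arrays.char
  · rw [ev, hp]; exact I.arrays.start
  · rw [ev, hp]; exact I.arrays.finish
  · intro u
    rw [ev, e3]; exact I.end_lt u
  · rw [e3]; exact hPB
  · rw [hr 1 (by omega)]; simp
  · rw [hr 2 (by omega)]; simp
  · rw [hr 4 (by omega), ev]; simp
  · rw [hr 12 (by omega)]; simp [h12]
  · rw [h1, e3]
  · rw [h2, hl]

/-! ### The queries -/

/-- The node of the longest palindromic suffix, in the direction `v`. -/
def longestSuffixQuery (v : Bool) : Code := .seq (loadSuffix v) (.move 0 7)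

/-- Whether the longest palindromic suffix, in the direction `v`, occurs only once. -/
def suffixUniqueQuery (v : Bool) : Code :=
  .seq (loadSuffix v) (.seq (.ld 16 8 7) (.seq (.ld 17 9 7) (.seq (.add 8 8 9)
    (.ite (.eq 8 2) (.const 0 1) (.const 0 0)))))

/-- The edge of the node `R[0]` with the label `R[1]`; a node that was created for an earlier string
is recognized by its counters. -/
def nextQuery : Code :=
  .seq (.const 2 0) (.seq (.ld 14 20 0) (.seq (.move 21 1) (.seq search
    (.ite (.eq 20 2) (.const 0 0) (.seq (.ld 16 3 20) (.seq (.ld 17 4 20) (.seq (.add 3 3 4)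
      (.ite (.eq 3 2) (.const 0 0) (.move 0 20)))))))))

/-- The entry of the array `f` at the position `R[0]` of the string. -/
def arrayQuery (f : ℕ) : Code :=
  .seq (.const 1 0) (.seq (.ld 1 2 1) (.seq (.sub 0 0 2) (.pld f false 0 0)))

section

variable {w B K : ℕ} {v : Bool} {t : St} {h : Node σ → ℤ} {X : Set (List (Fin σ))}
  {s : List (Fin σ)}

theorem word_zero (w : ℕ) : word w 0 = 0 := by simp [word]

theorem isUnique_reverse {x : List (Fin σ)} (hs : s ≠ []) (hx : IsLongestSuffix s.reverse x) :
    IsUnique s.reverse x ↔ IsUnique s x := by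
  have hs' : s.reverse ≠ [] := by simpa using hs
  have h0 := hx.ne_nil hs'
  have h1 := sufcnt_pos_of_suffix hs' hx
  have h2 : sufcnt s.reverse x = sufcnt s x := by rw [sufcnt_reverse, precnt_eq_sufcnt h0 hx.1]
  rw [isUnique_iff h0 hx.1 h1, isUnique_iff h0 hx.1 (h2 ▸ h1), h2, linkCount_reverse]

theorem wp_longestSuffixQuery (F : Fits w B K) (I : Inv K v t.fld t.pos h X s)
    (hPB : t.fld 3 0 ≤ B) : (longestSuffixQuery v).wp w B K
      (fun t' => word w (t'.reg 0) = word w (h (.pal (sufpal s s.length)))) t := by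
  refine wp_seq.2 (wp_loadSuffix F I hPB fun reg r0 r1 r2 r3 r4 r6 r7 => ?_)
  simp [r7]

theorem Inv.counts_bounds (I : Inv K v t.fld t.pos h X s) (F : Fits w B K) (hPB : t.fld 3 0 ≤ B)
    {y : List (Fin σ)} (hy : y ∈ X) (h0 : y ≠ []) :
    t.fld 16 (h (.pal y)) = sufcnt s y ∧ t.fld 17 (h (.pal y)) = linkCount s y ∧
      (sufcnt s y + linkCount s y : ℤ) < 2 ^ w := by
  have hw : (32 : ℤ) * B ≤ 2 ^ w := by exact_mod_cast F.blocks
  have b1 := sufcnt_le s y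
  have b2 := linkCount_le s y
  obtain ⟨hE, hE1, hE2⟩ := I.end_bounds
  have hP3 := I.heap.blocks
  exact ⟨I.counts.cnt y hy h0, I.counts.linkCount y hy h0, by omega⟩

theorem wp_suffixUniqueQuery (F : Fits w B K) (I : Inv K v t.fld t.pos h X s)
    (hPB : t.fld 3 0 ≤ B) (hs : s ≠ []) : (suffixUniqueQuery v).wp w B K
      (fun t' => word w (t'.reg 0) = if IsUnique s (sufpal s s.length) then 1 else 0) t := by
  have hw : (32 : ℤ) * B ≤ 2 ^ w := by exact_mod_cast F.blocks
  refine wp_seq.2 (wp_loadSuffix F I hPB fun reg r0 r1 r2 r3 r4 r6 r7 => ?_)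
  have hx := isLongestSuffix_sufpal s
  generalize sufpal s s.length = x at *
  have hx0 := hx.ne_nil hs
  have hX := I.counts.subset hx.mem_palSubstrings
  have hb := I.heap.bound _ (pal_mem_nodeSet hX)
  have hP3 := I.heap.blocks
  obtain ⟨e1, e2, e3⟩ := I.counts_bounds F hPB hX hx0
  have hu := isUnique_iff hx0 hx.1 (sufcnt_pos_of_suffix hs hx)
  have h1 : word w 1 = 1 := by
    rw [show (1 : ℤ) = ((1 : ℕ) : ℤ) by rfl]
    exact word_natCast_of_lt (by have : (1 : ℤ) < 2 ^ w := by omega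
                                 exact_mod_cast this)
  have h0 := word_zero w
  simp [r7, e1, e2, r2, hu]
  refine ⟨by omega, by omega, by omega, fun h => ?_, fun h => ?_⟩
  · rw [if_pos (by omega)]; exact h1
  · rw [if_neg (by omega)]; exact h0

theorem wp_nextQuery (F : Fits w B K) (I : Inv K v t.fld t.pos h X s) (hPB : t.fld 3 0 ≤ B)
    {u : Node σ} (hu : u ∈ nodeSet X) (c : Fin σ) (r0 : t.reg 0 = h u) (r1 : t.reg 1 = (c : ℕ)) :
    nextQuery.wp w B K
      (fun t' => word w (t'.reg 0) = (next s u c).elim 0 fun v => word w (h v)) t := by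
  have hw : (32 : ℤ) * B ≤ 2 ^ w := by exact_mod_cast F.blocks
  have H := I.heap
  have hP3 := H.blocks
  have hb := H.bound _ hu
  have hroot := H.nextRoot _ hu
  have hcl := H.natCast_lt c
  have h0 := word_zero w
  simp [nextQuery, r0, r1]
  refine ⟨by omega, wp_seq.2 (wp_search (by omega) H.height H.width F.keys
    H.closed hPB (by simpa using hroot.1) (by simpa using hroot.2) (by simp)
    (by simp [hcl]) fun reg e e20 => ?_)⟩
  simp at e20
  have e2 : reg 2 = 0 := by rw [e 2 (by omega)]; simp
  have hnext := H.next _ hu c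
  have hx0 : u.wrap c ≠ [] := wrap_ne_nil u c
  have hp : u.wrap c ∈ palSubstrings s ↔ u.wrap c <:+: s := by
    refine ⟨fun h => h.2, fun h => ⟨?_, h⟩⟩
    rcases hu with rfl | ⟨y, hy, rfl⟩
    · exact List.Palindrome.singleton c
    · exact List.Palindrome.cons_concat c (H.palindrome y hy)
  have hX : u.wrap c <:+: s → u.wrap c ∈ X := fun h => I.counts.subset (hp.2 h)
  unfold next
  generalize u.wrap c = x at *
  by_cases hxX : x ∈ X
  · rw [hnext.1 hxX] at e20
    have hbx := H.bound _ (pal_mem_nodeSet hxX)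
    obtain ⟨e1, e2', e3⟩ := I.counts_bounds F hPB hxX hx0
    have hm := mem_palSubstrings_iff (s := s) hx0 (H.palindrome x hxX)
    simp [e20, e2, e1, e2']
    refine ⟨by omega, fun h => by omega, fun _ => ⟨by omega, by omega, fun h => ?_, fun h => ?_⟩⟩
    · rw [if_neg fun h' => by have := hm.1 (hp.2 h'); omega]
      exact h0
    · rw [if_pos (hp.1 (hm.2 (by omega)))]
      rfl
  · rw [hnext.2 hxX] at e20
    simp [e20, e2]
    rw [if_neg fun h => hxX (hX h)]
    exact h0

/-- Store the eertree of the empty string, where `R[0] = 2 ^ R[1]` bounds the alphabet and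
`R[2] = 1`. -/
def initCode : Code :=
  .seq (.const 3 0) (.seq (.const 4 2) (.seq (.const 5 3) (.seq (.st 2 3 2) (.seq (.st 3 3 5)
    (.seq (.st 4 3 1) (.seq (.st 5 3 0) (.seq (.st 13 2 4) (.seq (.sub 6 3 2) (.seq (.st 12 4 6)
      (.seq (.st 13 4 4) (.touch 4)))))))))))

/-- The creation of the data structure: the least power of two that is not below the alphabet size
is computed by repeated doubling. -/
def createProg : Prog :=
  .seq (.const 8 1) (.seq (.const 9 0) (.seq (.const 10 1)
    (.seq (.loop (.lt 8 0) (.seq (.add 8 8 8) (.add 9 9 10))) initCode.compile)))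

/-- The implementation of double-ended eertrees.  The operations at the front are those at the back
in the reverse direction. -/
def package : Package where
  create := createProg
  pushBack := (push false).call
  pushFront := (push true).call
  popBack := (pop false).call
  popFront := (pop true).call
  even := (Code.const 0 1).call
  odd := (Code.const 0 2).call
  next := nextQuery.call
  link := (Code.ld 13 0 0).call
  len := (Code.ld 12 0 0).call
  count := (Code.seq (.const 1 0) (.ld 2 0 1)).call
  longestPrefix := (longestSuffixQuery true).call
  longestSuffix := (longestSuffixQuery false).call
  prefixUnique := (suffixUniqueQuery true).call
  suffixUnique := (suffixUniqueQuery false).call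
  presurf := (arrayQuery 1).call
  sufsurf := (arrayQuery 2).call
  cnt := (Code.ld 16 0 0).call

theorem nextQuery_cost : nextQuery.cost K + 3 ≤ 1000 * (K + 1) := by
  simp [nextQuery, search, searchStep, Code.cost]
  omega

theorem represents {m : Memory} {fld pos : ℕ → ℤ → ℤ} {C L : ℕ} (F : Fits w B K) (hK : K < 2 ^ w)
    (I : Inv K false fld pos h X s) (hm : MemRel w m fld pos (fld 3 0)) (hB : fld 3 0 = B)
    (hL : K ≤ L + 1) (hC : 2000 ≤ C) (hCL : L = Nat.log 2 σ) : package.Represents w C s m := by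
  have hw : (32 : ℤ) * B ≤ 2 ^ w := by exact_mod_cast F.blocks
  have H := I.heap
  have hP3 := H.blocks
  have hsub : nodes s ⊆ nodeSet X := nodeSet_mono I.counts.subset
  have hused : 32 * B ≤ m.used := by
    have := hm.lo
    rw [hB] at this
    exact_mod_cast this
  have hb : ∀ u ∈ nodes s, (word w (h u) : ℤ) = h u := fun u hu => by
    have := H.bound u (hsub hu)
    exact word_of_lt (by omega) (by omega)
  have hlt : ∀ u : Node σ, word w (h u) < 2 ^ w := fun u => word_lt w _
  have hcl : ∀ c : Fin σ, (c : ℕ) < 2 ^ w := fun c => by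
    have h1 := H.natCast_lt c
    have h2 := F.keys
    have : ((c : ℕ) : ℤ) < 2 ^ w := by
      have : (0 : ℤ) < 2 ^ K := by positivity
      omega
    exact_mod_cast this
  have hlen : s.length < 2 ^ w := by
    obtain ⟨hE, hE1, hE2⟩ := I.end_bounds
    have : (s.length : ℤ) < 2 ^ w := by omega
    exact_mod_cast this
  refine ⟨fun u => word w (h u), ?_, fun u hu => ⟨?_, hlt u⟩, ?_, ?_, fun u hu c => ?_,
    fun u hu => ?_, fun u hu => ?_, ?_, ?_, ?_, fun hs => ?_, fun hs => ?_, fun i hi => ?_,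
    fun i hi => ?_, fun y hy h0 => ⟨?_, precnt_eq_sufcnt h0 hy.1⟩⟩
  · intro u hu u' hu' he
    have : (word w (h u) : ℤ) = word w (h u') := congrArg _ he
    rw [hb u hu, hb u' hu'] at this
    exact H.inj (hsub hu) (hsub hu') this
  · have h1 := H.bound u (hsub hu)
    have h2 := hb u hu
    show 0 < word w (h u)
    omega
  · refine answers_call F.blocks hK rfl rfl (by simp) (by simp) hm hused ?_ ?_
    · simp [Code.cost]; omega
    · show word w _ = word w (h (.pal []))
      rw [H.even]; rfl
  · refine answers_call F.blocks hK rfl rfl (by simp) (by simp) hm hused ?_ ?_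
    · simp [Code.cost]; omega
    · show word w _ = word w (h .odd)
      rw [H.odd]; rfl
  · refine answers_call F.blocks hK rfl rfl (by simp) (by simpa using ⟨hlt u, hcl c⟩) hm hused ?_ ?_
    · have := nextQuery_cost (K := K)
      subst hCL
      nlinarith
    · exact wp_nextQuery F I hB.le (hsub hu) c (hb u hu) rfl
  · refine answers_call F.blocks hK rfl rfl (by simp) (by simpa using hlt u) hm hused ?_ ?_
    · simp [Code.cost]; omega
    · have h1 := H.bound u (hsub hu)
      simp [start, hb u hu, H.link u (hsub hu)]
      omega
  · refine answers_call F.blocks hK rfl rfl (by simp) (by simpa using hlt u) hm hused ?_ ?_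
    · simp [Code.cost]; omega
    · have h1 := H.bound u (hsub hu)
      have h2 : (start [word w (h u)] fld pos (fld 3 0)).reg 0 = h u := hb u hu
      rw [wp_ld, h2, St.setReg_reg, Function.update_self]
      exact ⟨by decide, by omega, congrArg _ (H.len u (hsub hu))⟩
  · refine answers_call F.blocks hK rfl rfl (by simp) (by simp) hm hused ?_ ?_
    · simp [Code.cost]; omega
    · have := ncard_palSubstrings_le s
      obtain ⟨hE, hE1, hE2⟩ := I.end_bounds
      have : (palSubstrings s).ncard < 2 ^ w := by
        have : ((palSubstrings s).ncard : ℤ) < 2 ^ w := by omega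
        exact_mod_cast this
      simp [start, I.counts.count, word_natCast_of_lt this]
      omega
  · refine answers_call F.blocks hK rfl rfl (by simp) (by simp) hm hused ?_ ?_
    · simp [longestSuffixQuery, loadSuffix, Code.cost]; omega
    · have := wp_longestSuffixQuery (t := start [] fld pos (fld 3 0)) F I.reverse hB.le
      rwa [← prepal_one_reverse, List.reverse_reverse] at this
  · refine answers_call F.blocks hK rfl rfl (by simp) (by simp) hm hused ?_ ?_
    · simp [longestSuffixQuery, loadSuffix, Code.cost]; omega
    · exact wp_longestSuffixQuery (t := start [] fld pos (fld 3 0)) F I hB.le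
  · refine answers_call F.blocks hK rfl rfl (by simp) (by simp) hm hused ?_ ?_
    · simp [suffixUniqueQuery, loadSuffix, Code.cost]; omega
    · have := wp_suffixUniqueQuery (t := start [] fld pos (fld 3 0)) F I.reverse hB.le
        (by simpa using hs)
      have hx := isLongestSuffix_sufpal s.reverse
      simp only [isUnique_reverse hs hx] at this
      simp only [← prepal_one_reverse, List.reverse_reverse] at this
      exact this
  · refine answers_call F.blocks hK rfl rfl (by simp) (by simp) hm hused ?_ ?_
    · simp [suffixUniqueQuery, loadSuffix, Code.cost]; omega
    · exact wp_suffixUniqueQuery (t := start [] fld pos (fld 3 0)) F I hB.le hs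
  · rw [Finset.mem_Icc] at hi
    refine answers_call F.blocks hK rfl rfl (by simp) (by simp; omega) hm hused ?_ ?_
    · simp [arrayQuery, Code.cost]; omega
    · have := I.arrays.start i hi.1 hi.2
      obtain ⟨hE, hE1, hE2⟩ := I.end_bounds
      simp [endFld, startArr, view] at this hE hE1 hE2
      simp [arrayQuery, start, view, this]
      omega
  · rw [Finset.mem_Icc] at hi
    refine answers_call F.blocks hK rfl rfl (by simp) (by simp; omega) hm hused ?_ ?_
    · simp [arrayQuery, Code.cost]; omega
    · have := I.arrays.finish i hi.1 hi.2
      obtain ⟨hE, hE1, hE2⟩ := I.end_bounds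
      simp [endFld, startArr, view] at this hE hE1 hE2
      simp [arrayQuery, start, view, this]
      omega
  · have hX := I.counts.subset hy
    refine answers_call F.blocks hK rfl rfl (by simp) (by simpa using hlt _) hm hused ?_ ?_
    · simp [Code.cost]; omega
    · have h1 := H.bound _ (pal_mem_nodeSet hX)
      have h2 := sufcnt_le s y
      simp [start, hb _ (pal_mem_nodeSet hy), I.counts.cnt y hX h0, precnt_eq_sufcnt h0 hy.1,
        word_natCast_of_lt (h2.trans_lt hlen)]
      omega

end

/-! ### Creation -/

/-- The invariant of the data structure after `n` operations: the memory holds the eertree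
of `s`, all cells of the blocks in use count as used, and at most `2 * K + 4` blocks were allocated
per operation.  The heap contains the nodes of all palindromes in the set `X`, also of those that
do not occur in `s`. -/
def Stored (w K n : ℕ) (s : List (Fin σ)) (m : Memory) : Prop :=
  ∃ fld pos h X, MemRel w m fld pos (fld 3 0) ∧ Inv K false fld pos h X s ∧
    fld 3 0 ≤ (3 + n * (2 * K + 4) : ℕ)

theorem palSubstrings_nil : palSubstrings ([] : List (Fin σ)) = {[]} := by
  refine Set.eq_singleton_iff_unique_mem.2 ⟨nil_mem_palSubstrings _, fun t ht => ?_⟩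
  simpa using ht.2

/-- The heap of the empty string consists of the roots `even` and `odd` in the blocks `1`
and `2`. -/
theorem inv_nil {K : ℕ} (hσ : σ ≤ 2 ^ K) {fld : ℕ → ℤ → ℤ}
    (h0 : fld 0 0 = 0) (h1 : fld 1 0 = 0) (h2 : fld 2 0 = 1) (h3 : fld 3 0 = 3) (h4 : fld 4 0 = K)
    (h5 : fld 5 0 = 2 ^ K) (e12 : fld 12 1 = 0) (e13 : fld 13 1 = 2) (o12 : fld 12 2 = -1)
    (o13 : fld 13 2 = 2) (hz : ∀ f, 14 ≤ f → fld f = 0) (pos : ℕ → ℤ → ℤ) :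
    Inv K false fld pos (fun v : Node σ => v.casesOn 2 fun _ => 1) {[]} [] := by
  have hnil : ∀ v ∈ nodeSet ({[]} : Set (List (Fin σ))), v = .odd ∨ v = .pal [] := by
    rintro v (rfl | ⟨t, rfl, rfl⟩)
    · exact Or.inl rfl
    · exact Or.inr rfl
  have hfind : ∀ c, find (0 : ℤ → ℤ) 0 (2 ^ K) K 0 c = 0 := fun c =>
    find_zero rfl rfl K c
  refine ⟨?_, ⟨palSubstrings_nil.le, fun t ht h => absurd ht h, fun t ht h => absurd ht h, ?_⟩,
    ⟨?_, fun i c _ hc => by simp at hc, fun i h1 h2 => ?_, fun i h1 h2 => ?_⟩, fun v => ?_⟩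
  · constructor
    case height => exact h4
    case width => exact h5
    case alphabet => exact hσ
    case blocks => exact h3.ge
    case nil_mem => rfl
    case palindrome => rintro t rfl; exact .nil
    case link_mem => exact fun t ht h => absurd ht h
    case inner_mem => intro t c ht; cases ht
    case even => rfl
    case odd => rfl
    case inj =>
      intro v hv v' hv' he
      rcases hnil v hv with rfl | rfl <;> rcases hnil v' hv' with rfl | rfl <;> simp at he ⊢
    case bound => intro v hv; rcases hnil v hv with rfl | rfl <;> simp [h3]
    case len => intro v hv; rcases hnil v hv with rfl | rfl <;> simp [o12, e12, Node.len]
    case link => intro v hv; rcases hnil v hv with rfl | rfl <;> simp [o13, e13, Eertree.link]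
    case nextRoot => intro v _; simp [hz, h3]
    case beforeRoot => intro v _; simp [hz, h3]
    case next =>
      exact fun v _ c => ⟨fun h => absurd h (wrap_ne_nil v c), fun _ => by simp [hz, hfind]⟩
    case before =>
      intro t ht c
      refine ⟨none, fun y _ hy => ?_, (fun y hy => by cases hy), by simp [hz, hfind]⟩
      rw [Set.mem_singleton_iff.1 ht] at hy
      simp at hy
    case closed => intro k _ _; simp [hz, h3]
    case null => simp [hz]
  · rw [h2, palSubstrings_nil, Set.ncard_singleton]; rfl
  · simp [endFld, h0, h1]
  · simp at h2; omega
  · simp at h2; omega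
  · cases v <;> simp [endFld, h0, h1, h3]

theorem wp_initCode {w B K : ℕ} (hB : 3 ≤ B) (hσ : σ ≤ 2 ^ K) {t : St} (hf : t.fld = fun _ _ => 0)
    (r0 : t.reg 0 = 2 ^ K) (r1 : t.reg 1 = K) (r2 : t.reg 2 = 1) (hlo : t.lo = 0) :
    initCode.wp w B K (fun t' => (∃ h X, Inv K false t'.fld t'.pos h X ([] : List (Fin σ))) ∧
      t'.fld 3 0 = 3 ∧ t'.lo = 3) t := by
  simp [initCode, r0, r1, r2, hf, hlo]
  refine ⟨by omega, by omega, by omega, _, _, inv_nil hσ ?_ ?_ ?_ ?_ ?_ ?_ ?_ ?_ ?_ ?_ ?_ _⟩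
  all_goals try simp
  intro f h14
  funext k
  repeat rw [Function.update_of_ne (by omega)]
  rfl

/-- The loop of `createProg`. -/
theorem exec_double {w σ : ℕ} (hw : 2 * σ ≤ 2 ^ w) (n : ℕ) : ∀ (j : ℕ) (κ : Config),
    j + n = Nat.clog 2 σ → κ.reg 0 = σ → κ.reg 8 = 2 ^ j → κ.reg 9 = j → κ.reg 10 = 1 →
    ∃ κ', Exec w (.loop (.lt 8 0) (.seq (.add 8 8 8) (.add 9 9 10))) κ (3 * n + 1) κ' ∧
      κ'.reg 8 = 2 ^ Nat.clog 2 σ ∧ κ'.reg 9 = Nat.clog 2 σ ∧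
      (∀ r, 10 ≤ r → κ'.reg r = κ.reg r) ∧ κ'.mem = κ.mem := by
  induction n with
  | zero =>
    intro j κ hj h0 h8 h9 h10
    simp at hj
    refine ⟨κ, .loop_false ?_, hj ▸ h8, hj ▸ h9, fun r _ => rfl, rfl⟩
    show ¬ κ.reg 8 < κ.reg 0
    have := Nat.le_pow_clog one_lt_two σ
    rw [h0, h8, hj]; omega
  | succ n ih =>
    intro j κ hj h0 h8 h9 h10
    have hlt : 2 ^ j < σ := Nat.pow_lt_of_lt_clog (by omega)
    have hj2 : j < 2 ^ j := Nat.lt_two_pow_self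
    set κ1 := κ.setReg 8 ((κ.reg 8 + κ.reg 8) % 2 ^ w) with hκ1
    set κ2 := κ1.setReg 9 ((κ1.reg 9 + κ1.reg 10) % 2 ^ w) with hκ2
    obtain ⟨κ', e, g8, g9, g, gm⟩ := ih (j + 1) κ2 (by omega)
      (by simp [hκ2, hκ1, Config.setReg, h0])
      (by simp [hκ2, hκ1, Config.setReg, h8]; rw [Nat.mod_eq_of_lt (by omega)]; ring)
      (by simp [hκ2, hκ1, Config.setReg, h9, h10]; rw [Nat.mod_eq_of_lt (by omega)])
      (by simp [hκ2, hκ1, Config.setReg, h10])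
    refine ⟨κ', ?_, g8, g9, fun r hr => ?_, gm⟩
    · rw [show 3 * (n + 1) + 1 = (1 + 1) + (3 * n + 1) + 1 by ring]
      refine .loop_true ?_ (.seq (.add _ _ _ _) (.add _ _ _ _)) e
      show κ.reg 8 < κ.reg 0
      omega
    · rw [g r hr]
      simp only [hκ2, hκ1, Config.setReg]
      rw [Function.update_of_ne (by omega), Function.update_of_ne (by omega)]

theorem two_pow_clog_le (hσ : 1 ≤ σ) : 2 ^ Nat.clog 2 σ ≤ 2 * σ := by
  rcases Nat.eq_zero_or_pos (Nat.clog 2 σ) with h | h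
  · rw [h]; omega
  · have h1 : 2 ^ (Nat.clog 2 σ - 1) < σ := Nat.pow_lt_of_lt_clog (by omega)
    have h2 : 2 ^ Nat.clog 2 σ = 2 * 2 ^ (Nat.clog 2 σ - 1) := by
      rw [← pow_succ']; congr 1; omega
    omega

theorem runs_create {w K : ℕ} (hσ : 1 ≤ σ) (hw : 96 + 4 * σ ≤ 2 ^ w) (hK : Nat.clog 2 σ = K) :
    ∃ t res m, Runs w package.create [σ] Memory.empty t res m ∧ t ≤ 3 * K + 200 ∧
      m.used ≤ 96 ∧ Stored w K 0 ([] : List (Fin σ)) m := by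
  have hM : 2 ^ K < 2 ^ w := by
    have := hK ▸ two_pow_clog_le hσ
    omega
  have hKK : K < 2 ^ K := Nat.lt_two_pow_self
  set κ : Config := ⟨fun r => [σ].getD r 0, Memory.empty⟩ with hκ
  set κ1 := ((κ.setReg 8 (1 % 2 ^ w)).setReg 9 (0 % 2 ^ w)).setReg 10 (1 % 2 ^ w) with hκ1
  have h1 : 1 % 2 ^ w = 1 := Nat.mod_eq_of_lt (by omega)
  obtain ⟨κ2, e2, g8, g9, g, gm⟩ := exec_double (w := w) (σ := σ) (by omega) K 0 κ1 (by omega)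
    (by simp [hκ1, hκ, Config.setReg]) (by simp [hκ1, Config.setReg, h1])
    (by simp [hκ1, Config.setReg]) (by simp [hκ1, Config.setReg, h1])
  rw [hK] at g8 g9
  have g10 : ∀ r, κ2.reg (r + 10) = if r = 0 then 1 else 0 := by
    intro r
    rw [g _ (by omega)]
    rcases r with _ | r
    · simp [hκ1, Config.setReg, h1]
    · simp [hκ1, hκ, Config.setReg]
  have hlt : ∀ r, κ2.reg (r + 8) < 2 ^ w := by
    rintro (_ | _ | r)
    · rw [g8]; exact hM
    · rw [g9]; omega
    · rw [show r + 1 + 1 + 8 = r + 10 by ring, g10]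
      split_ifs <;> omega
  have hrel : Rel w κ2 ⟨fun r => (κ2.reg (r + 8) : ℕ), fun _ _ => 0, fun _ _ => 0, 0⟩ := by
    refine ⟨fun r => (word_natCast_of_lt (hlt r)).symm, ?_⟩
    rw [gm]
    exact ⟨fun f _ k => (word_zero w).symm, fun f _ p => (word_zero w).symm, by simp⟩
  obtain ⟨t, κ3, s', e, c, r, ⟨⟨h, X, I⟩, h3, hlo⟩, -, u, -⟩ := result_of_wp (B := 3) (K := K)
    (by omega) (by omega) initCode _ _ κ2 rfl hrel
    (wp_initCode (σ := σ) le_rfl (hK ▸ Nat.le_pow_clog one_lt_two σ) rfl (by simp [g8])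
      (by simp [g9]) (by simpa using g10 0) rfl)
  refine ⟨_, _, κ3.mem, ⟨κ3.reg, .seq (.const _ _ _) (.seq (.const _ _ _) (.seq (.const _ _ _)
    (.seq e2 e))), rfl⟩, ?_, ?_, s'.fld, s'.pos, h, X, ?_, I, ?_⟩
  · simp [initCode, Code.cost] at c
    omega
  · have : κ2.mem.used = 0 := by rw [gm]; rfl
    omega
  · rw [h3, ← hlo]; exact r.mem
  · rw [h3]; simp

/-! ### Sequences of operations -/

theorem push_cost (v : Bool) (K : ℕ) : (push v).cost K + 3 ≤ 4000 * (K + 1) := by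
  simp [push, findInner, loadSuffix, findShorter, appendChar, ensureNode, createNode, findLink,
    allocNode, countNode, storeSurface, reserve, search, searchStep, Code.insert, insertStep,
    Code.cost]
  omega

theorem pop_cost (v : Bool) (K : ℕ) : (pop v).cost K + 3 ≤ 4000 := by
  simp [pop, uncountNode, restoreSurface, Code.cost]

section

variable {w K : ℕ} {v : Bool} {fld pos : ℕ → ℤ → ℤ} {h : Node σ → ℤ} {X : Set (List (Fin σ))}
  {s : List (Fin σ)} {m : Memory}

theorem runs_push (hK : K < 2 ^ w) (keys : (2 : ℤ) ^ K + 2 ^ K ≤ 2 ^ w)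
    (hm : MemRel w m fld pos (fld 3 0)) (I : Inv K v fld pos h X s)
    (hw : 32 * (fld 3 0 + 2 * K + 4) ≤ 2 ^ w) (c : Fin σ) :
    ∃ t res m', Runs w (push v).call [(c : ℕ)] m t res m' ∧ t ≤ 4000 * (K + 1) ∧
      m'.used ≤ m.used + 32 * (2 * K + 4) ∧ ∃ fld' pos' h' X',
        MemRel w m' fld' pos' (fld' 3 0) ∧ Inv K v fld' pos' h' X' (s ++ [c]) ∧
        fld' 3 0 ≤ fld 3 0 + 2 * K + 4 := by
  have hP := I.heap.blocks
  obtain ⟨B, hB⟩ := Int.eq_ofNat_of_zero_le (by omega : 0 ≤ fld 3 0 + 2 * K + 4)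
  have hw' : 32 * B ≤ 2 ^ w := by
    rw [hB] at hw
    exact_mod_cast hw
  have hc : (c : ℕ) < 2 ^ w := by
    have h1 := I.heap.natCast_lt c
    have : (0 : ℤ) < 2 ^ K := by positivity
    have : ((c : ℕ) : ℤ) < 2 ^ w := by omega
    exact_mod_cast this
  have hwf : (push v).wf = true := by cases v <;> rfl
  have hwp := wp_push (t := start [(c : ℕ)] fld pos (fld 3 0)) (c := c)
    (Q := fun t' => ∃ h' X', Inv K v t'.fld t'.pos h' X' (s ++ [c]) ∧
      t'.fld 3 0 ≤ fld 3 0 + 2 * K + 4 ∧ t'.lo = t'.fld 3 0) ⟨hw', keys⟩ I hB.le rfl le_rfl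
    fun t' h' X' I' h3 hlo => ⟨h', X', I', h3, hlo⟩
  obtain ⟨t, m', s', e, ht, r, ⟨h', X', I', h3, hlo⟩, -, hu, -⟩ :=
    runs_call hw' hK hwf (by simp) (by simpa using hc) hm hwp
  refine ⟨t, _, m', e, ht.trans (push_cost v K), ?_, s'.fld, s'.pos, h', X', hlo ▸ r, I', h3⟩
  have := hm.lo
  omega

theorem runs_pop (hK : K < 2 ^ w) (keys : (2 : ℤ) ^ K + 2 ^ K ≤ 2 ^ w)
    (hm : MemRel w m fld pos (fld 3 0)) {c : Fin σ} (I : Inv K v fld pos h X (s ++ [c]))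
    (hw : 32 * fld 3 0 ≤ 2 ^ w) :
    ∃ t res m', Runs w (pop v).call [] m t res m' ∧ t ≤ 4000 ∧ m'.used ≤ m.used ∧ ∃ fld' pos',
      MemRel w m' fld' pos' (fld' 3 0) ∧ Inv K v fld' pos' h X s ∧ fld' 3 0 = fld 3 0 := by
  have hP := I.heap.blocks
  obtain ⟨B, hB⟩ := Int.eq_ofNat_of_zero_le (by omega : 0 ≤ fld 3 0)
  have hw' : 32 * B ≤ 2 ^ w := by
    rw [hB] at hw
    exact_mod_cast hw
  have hwf : (pop v).wf = true := by cases v <;> rfl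
  have hwp := wp_pop (t := start [] fld pos (fld 3 0)) (c := c)
    (Q := fun t' => Inv K v t'.fld t'.pos h X s ∧ t'.fld 3 0 = fld 3 0 ∧ t'.lo = fld 3 0)
    ⟨hw', keys⟩ I hB.le fun t' I' h3 hlo => ⟨I', h3, hlo⟩
  obtain ⟨t, m', s', e, ht, r, ⟨I', h3, hlo⟩, -, hu, -⟩ :=
    runs_call hw' hK hwf (by simp) (by simp) hm hwp
  refine ⟨t, _, m', e, ht.trans (pop_cost v K), ?_, s'.fld, s'.pos, ?_, I', h3⟩
  · have := hm.lo
    omega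
  · rw [h3, ← hlo]; exact r

theorem Stored.op {n C : ℕ} (H : Stored w K n s m) (hK : K < 2 ^ w)
    (keys : (2 : ℤ) ^ K + 2 ^ K ≤ 2 ^ w) (hw : 32 * (3 + (n + 1) * (2 * K + 4)) ≤ 2 ^ w)
    (hL : K ≤ Nat.log 2 σ + 1) (hC : 8000 ≤ C) (o : Op σ) (ho : o.Allowed s) :
    ∃ t res m', Runs w (package.prog o) o.args m t res m' ∧ t ≤ o.bound C ∧
      m'.used ≤ m.used + o.bound C ∧ Stored w K (n + 1) (o.apply s) m' := by
  obtain ⟨fld, pos, h, X, hm, I, hB⟩ := H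
  have hw' : (32 : ℤ) * (3 + (n + 1) * (2 * K + 4)) ≤ 2 ^ w := by exact_mod_cast hw
  have hnn : (0 : ℤ) ≤ n * (2 * K + 4) := by positivity
  push_cast at hB
  have hwB : 32 * (fld 3 0 + 2 * K + 4) ≤ 2 ^ w := by linarith
  have hb : 8000 * (Nat.log 2 σ + 1) ≤ C * (Nat.log 2 σ + 1) := Nat.mul_le_mul_right _ hC
  cases o with
  | pushBack c =>
    obtain ⟨t, res, m', e, ht, hu, fld', pos', h', X', hm', I', h3⟩ := runs_push hK keys hm I hwB c
    refine ⟨t, res, m', e, ?_, ?_, fld', pos', h', X', hm', I', ?_⟩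
    · simp only [Op.bound]; omega
    · simp only [Op.bound]; omega
    · push_cast; linarith
  | pushFront c =>
    obtain ⟨t, res, m', e, ht, hu, fld', pos', h', X', hm', I', h3⟩ :=
      runs_push hK keys hm I.reverse hwB c
    refine ⟨t, res, m', e, ?_, ?_, fld', pos', h', X', hm', by simpa [Op.apply] using I'.reverse,
      ?_⟩
    · simp only [Op.bound]; omega
    · simp only [Op.bound]; omega
    · push_cast; linarith
  | popBack =>
    obtain ⟨s, c, rfl⟩ := (List.eq_nil_or_concat s).resolve_left ho
    rw [List.concat_eq_append] at I ⊢
    obtain ⟨t, res, m', e, ht, hu, fld', pos', hm', I', h3⟩ :=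
      runs_pop hK keys hm I (by linarith)
    refine ⟨t, res, m', e, ?_, ?_, fld', pos', h, X, hm', by simpa [Op.apply] using I', ?_⟩
    · simp only [Op.bound]; omega
    · simp only [Op.bound]; omega
    · push_cast; linarith
  | popFront =>
    obtain ⟨c, s, rfl⟩ := List.exists_cons_of_ne_nil ho
    have Ir := I.reverse
    rw [List.reverse_cons] at Ir
    obtain ⟨t, res, m', e, ht, hu, fld', pos', hm', I', h3⟩ :=
      runs_pop hK keys hm Ir (by linarith)
    refine ⟨t, res, m', e, ?_, ?_, fld', pos', h, X, hm', by simpa [Op.apply] using I'.reverse, ?_⟩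
    · simp only [Op.bound]; omega
    · simp only [Op.bound]; omega
    · push_cast; linarith

theorem Stored.represents {n C : ℕ} (H : Stored w K n s m) (hK : K < 2 ^ w)
    (keys : (2 : ℤ) ^ K + 2 ^ K ≤ 2 ^ w) (hw : 32 * (3 + n * (2 * K + 4)) ≤ 2 ^ w)
    (hL : K ≤ Nat.log 2 σ + 1) (hC : 2000 ≤ C) : package.Represents w C s m := by
  obtain ⟨fld, pos, h, X, hm, I, hB⟩ := H
  have hP := I.heap.blocks
  obtain ⟨B, hB'⟩ := Int.eq_ofNat_of_zero_le (by omega : 0 ≤ fld 3 0)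
  exact Eertree.represents ⟨by omega, keys⟩ hK I hm hB' hL hC rfl

/-- By determinism, every memory that arises in `N` operations satisfies the invariant. -/
theorem stored_of_reaches {n N C : ℕ} (hσ : 1 ≤ σ) (hw₀ : 96 + 4 * σ ≤ 2 ^ w)
    (hσK : Nat.clog 2 σ = K) (hK : K < 2 ^ w)
    (keys : (2 : ℤ) ^ K + 2 ^ K ≤ 2 ^ w) (hw : 32 * (3 + N * (2 * K + 4)) ≤ 2 ^ w)
    (hL : K ≤ Nat.log 2 σ + 1) (hC : 8000 ≤ C) (H : package.Reaches w n s m) (hn : n ≤ N) :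
    Stored w K n s m := by
  induction H with
  | create hr =>
    obtain ⟨t, res, m', hr', -, -, S⟩ := runs_create hσ hw₀ hσK
    obtain ⟨-, -, rfl⟩ := hr.deterministic hr'
    exact S
  | op o _ ha hr ih =>
    have hnN : 32 * (3 + (_ + 1) * (2 * K + 4)) ≤ 2 ^ w := le_trans (by gcongr) hw
    obtain ⟨t, res, m', hr', -, -, S⟩ := (ih (by omega)).op hK keys hnN hL hC o ha
    obtain ⟨-, -, rfl⟩ := hr.deterministic hr'
    exact S

end

end Eertree

theorem theorem1 :
    ∃ (D : Eertree.Package) (C : ℕ), ∀ σ w N : ℕ, 1 ≤ σ →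
      C * (σ + (N + 1) * (Nat.log 2 σ + 1)) ≤ 2 ^ w →
      -- creating the data structure for the empty string
      (∃ (t res : ℕ) (m : WordRAM.Memory),
        WordRAM.Runs w D.create [σ] WordRAM.Memory.empty t res m ∧
        t ≤ C * (Nat.log 2 σ + 1) ∧ m.used ≤ C * (Nat.log 2 σ + 1)) ∧
      -- the cost of the operations
      (∀ (n : ℕ) (s : List (Fin σ)) (m : WordRAM.Memory), n < N → D.Reaches w n s m →
        ∀ o : Eertree.Op σ, o.Allowed s →
          ∃ (t res : ℕ) (m' : WordRAM.Memory),
            WordRAM.Runs w (D.prog o) o.args m t res m' ∧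
            t ≤ o.bound C ∧ m'.used ≤ m.used + o.bound C) ∧
      -- the correctness of the data structure after every sequence of operations
      (∀ (n : ℕ) (s : List (Fin σ)) (m : WordRAM.Memory), n ≤ N → D.Reaches w n s m →
        D.Represents w C s m) := by
  refine ⟨Eertree.package, 8000, fun σ w N hσ hw => ?_⟩
  set L := Nat.log 2 σ with hL
  obtain ⟨K, hK⟩ : ∃ K, Nat.clog 2 σ = K := ⟨_, rfl⟩
  have hKL : K ≤ L + 1 := hK ▸ Nat.clog_le_of_le_pow (Nat.lt_pow_succ_log_self one_lt_two σ).le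
  have hNL : (N + 1) * (L + 1) = N * (L + 1) + L + 1 := by ring
  have hNK : N * (2 * K + 4) ≤ 6 * (N * (L + 1)) := by
    calc N * (2 * K + 4) ≤ N * (6 * (L + 1)) := by gcongr; omega
      _ = 6 * (N * (L + 1)) := by ring
  have h0 : 96 + 4 * σ ≤ 2 ^ w := by omega
  have h1 : K < 2 ^ w := by omega
  have h2 : 32 * (3 + N * (2 * K + 4)) ≤ 2 ^ w := by omega
  have h3 : 2 ^ K ≤ 2 * σ := hK ▸ Eertree.two_pow_clog_le hσ
  have h4 : (2 : ℤ) ^ K + 2 ^ K ≤ 2 ^ w := by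
    have : 2 ^ K + 2 ^ K ≤ 2 ^ w := by omega
    exact_mod_cast this
  have stored : ∀ {n : ℕ} {s : List (Fin σ)} {m : WordRAM.Memory}, n ≤ N →
      Eertree.package.Reaches w n s m → Eertree.Stored w K n s m := fun hn H =>
    Eertree.stored_of_reaches hσ h0 hK h1 h4 h2 hKL le_rfl H hn
  refine ⟨?_, fun n s m hn H o ho => ?_, fun n s m hn H => ?_⟩
  · obtain ⟨t, res, m, e, ht, hu, -⟩ := Eertree.runs_create hσ h0 hK
    exact ⟨t, res, m, e, by omega, by omega⟩
  · have hn' : 32 * (3 + (n + 1) * (2 * K + 4)) ≤ 2 ^ w := le_trans (by gcongr; omega) h2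
    obtain ⟨t, res, m', e, ht, hu, -⟩ := (stored hn.le H).op h1 h4 hn' hKL le_rfl o ho
    exact ⟨t, res, m', e, ht, hu⟩
  · exact (stored hn H).represents h1 h4 (le_trans (by gcongr) h2) hKL (by norm_num)
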